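/- **Theorem (multi-clock gadget).** Let $\mathcal H$ be a complex Hilbert space, $L\ge 0$, $n\ge 1$, and for $\alpha=1,\dots,L$ let $\Gamma_0^\alpha$ and $M_0^\alpha,\dots,M_{n-1}^\alpha$ be bounded operators on $\mathcal H$; the lower index $i$ is read modulo $n$. Write $A\propto B$ if $A=cB$ for some $c\in\mathbb C$. Assume: * the $\Gamma_0^\alpha$ are orthogonal projections that commute with each other, and $\Gamma=\prod_\alpha\Gamma_0^\alpha$ is nonzero and of finite rank (the latter is automatic if $\dim\mathcal H<\infty$); * for all $\alpha$ and $i$: (i) $M_i^\alpha M_{i+1}^\alpha (M_{i+1}^\alpha)^\dagger (M_i^\alpha)^\dagger\propto (M_i^\alpha (M_i^\alpha)^\dagger)^2$, (ii) $(M_i^\alpha (M_i^\alpha)^\dagger)^2\propto M_i^\alpha (M_i^\alpha)^\dagger$, (iii) $M_i^\alpha (M_i^\alpha)^\dagger\propto (M_{i-1}^\alpha)^\dagger M_{i-1}^\alpha$, (iv) $\Gamma_0^\alpha M_0^\alpha (M_0^\alpha)^\dagger\Gamma_0^\alpha\propto\Gamma_0^\alpha$; * for all $\alpha\ne\beta$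 and all $i$: $[M_i^\alpha,\Gamma_0^\beta]=[(M_i^\alpha)^\dagger,\Gamma_0^\beta]=0$ and $[M_i^\alpha,M_0^\beta(M_0^\beta)^\dagger]=[(M_i^\alpha)^\dagger,M_0^\beta(M_0^\beta)^\dagger]=0$. Let $\mathcal H_{I^\alpha}=\mathbb C^n$ with orthonormal basis $\{|i\rangle_\alpha\}_{i=0}^{n-1}$ and $|n\rangle_\alpha\equiv|0\rangle_\alpha$. Let $\chi(\alpha,i)$ be the set of all $\beta\neq\alpha$ such that $[M_i^\alpha,M_j^\beta]\ne0$ or $[M_i^\alpha,(M_j^\beta)^\dagger]\neq0$ for some $j$, and let $\hat\chi(\alpha,i)=\bigotimes_{\beta\in\chi(\alpha,i)}|0\rangle\langle0|_\beta$. On $\mathcal H\otimes\mathcal H_{I^1}\otimes\cdots\otimes\mathcal H_{I^L}$ (identities on the remaining factors are omitted) put $$H_0=-\sum_\alpha\Gamma_0^\alpha\otimes|0\rangle\langle0|_\alpha,$$ $$V=\sum_{\alpha,i}\Big((M_i^\alpha)^\dagger\otimes|i+1\rangle\langle i|_\alpha\otimes\hat\chi(\alpha,i)+M_i^\alpha\otimes|i\rangle\langle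 i+1|_\alpha\otimes\hat\chi(\alpha,i)\Big),$$ let $d$ be the dimension of the ground space of $H_0$, and let $H=H_0+\lambda V$ with $\lambda\in\mathbb R$. Then there are a function $f:\mathbb R\to\mathbb R$ and constants $\lambda_0>0$ and $C$ such that for all $|\lambda|<\lambda_0$ the Hamiltonian $H$ has orthonormal eigenvectors $\varphi_1,\dots,\varphi_d$ belonging to its $d$ lowest energies $E_1,\dots,E_d$ (counted with multiplicity), and for every such choice the effective Hamiltonian $H_{\mathrm{eff}}=\sum_i E_i|\varphi_i\rangle\langle\varphi_i|$ and the projection $\Pi=\sum_i|\varphi_i\rangle\langle\varphi_i|$ satisfy, in operator norm, $$\Big\|H_{\mathrm{eff}}-f(\lambda)\,\Pi-(-1)^{n-1}\lambda^n\Big(\sum_\alpha H^\alpha_{\mathrm{target}}\Big)\otimes|0\rangle\langle0|^{\otimes L}\Big\|\le C\,|\lambda|^{n+1},$$ where $H^\alpha_{\mathrm{target}}=\Gamma M_0^\alpha\cdots M_{n-1}^\alpha\Gamma+\Gamma (M_{n-1}^\alpha)^\dagger\cdots (M_0^\alpha)^\dagger\Gamma$. -/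

import Mathlib

open scoped TensorProduct

namespace ClockGadget

noncomputable section

/-- `A ∝ B`: there is a scalar `c` with `A = c B`. -/
def PropTo {K : Type*} [AddCommGroup K] [Module ℂ K] (A B : K) : Prop :=
  ∃ c : ℂ, A = c • B

/-! ### Effective Hamiltonians -/

section Effective

variable {K : Type*} [NormedAddCommGroup K] [InnerProductSpace ℂ K]

/-- The ground state energy of `A`: the infimum of `⟨ψ, A ψ⟩ / ‖ψ‖²` over the nonzero vectors. -/
def groundEnergy (A : K →L[ℂ] K) : ℝ :=
  ⨅ ψ : {ψ : K // ψ ≠ 0}, A.rayleighQuotient (ψ : K)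

/-- The ground space of `A`: the eigenspace for the ground state energy. -/
def groundSpace (A : K →L[ℂ] K) : Submodule ℂ K :=
  Module.End.eigenspace (A : K →ₗ[ℂ] K) (groundEnergy A : ℂ)

/-- `φ 0, …, φ (d - 1)` are mutually orthogonal normalized eigenvectors of `A`, with energies
`E 0, …, E (d - 1)`, which belong to the `d` lowest energies of `A` (counted with multiplicity):
on the orthogonal complement of their span, `A` is bounded below by each `E i`. -/
structure IsLowestEigensystem (A : K →L[ℂ] K) {d : ℕ} (E : Fin d → ℝ) (φ : Fin d → K) :
    Prop where
  orthonormal : Orthonormal ℂ φ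
  eigenvector : ∀ i, A (φ i) = (E i : ℂ) • φ i
  lowest : ∀ ψ : K, (∀ i, inner ℂ (φ i) ψ = 0) → ∀ i, E i * ‖ψ‖ ^ 2 ≤ A.reApplyInnerSelf ψ

/-- The effective Hamiltonian `∑ i, E i |φ i⟩⟨φ i|`. -/
def effectiveHamiltonian {d : ℕ} (E : Fin d → ℝ) (φ : Fin d → K) : K →L[ℂ] K :=
  ∑ i, (E i : ℂ) • InnerProductSpace.rankOne ℂ (φ i) (φ i)

/-- The projection `Π = ∑ i, |φ i⟩⟨φ i|` onto the low energy space. -/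
def lowEnergyProjection {d : ℕ} (φ : Fin d → K) : K →L[ℂ] K :=
  ∑ i, InnerProductSpace.rankOne ℂ (φ i) (φ i)

/-- The effective Hamiltonian with its energy shifted by `δ`, that is `H_eff - δ Π`. -/
def shiftedEffectiveHamiltonian {d : ℕ} (E : Fin d → ℝ) (φ : Fin d → K) (δ : ℝ) : K →L[ℂ] K :=
  effectiveHamiltonian E φ - (δ : ℂ) • lowEnergyProjection φ

end Effective

/-! ### The clocks -/

/-- The space `(ℂ^n)^{⊗ L}` of `L` clocks, with orthonormal basis `|s 1⟩ ⊗ ⋯ ⊗ |s L⟩` indexed by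
the configurations `s` of the clocks. -/
abbrev ClockSpace (L n : ℕ) : Type := EuclideanSpace ℂ (Fin L → Fin n)

/-- The operator `|i⟩⟨j|` on the clock `α`, tensored with the identity on the other clocks. -/
def ketBra {L n : ℕ} (α : Fin L) (i j : Fin n) : ClockSpace L n →L[ℂ] ClockSpace L n :=
  Matrix.toEuclideanCLM (𝕜 := ℂ) (Matrix.of fun s t : Fin L → Fin n =>
    if s α = i ∧ t α = j ∧ ∀ β, β ≠ α → s β = t β then (1 : ℂ) else 0)

open Classical in
/-- The operator `⨂_{β ∈ S} |0⟩⟨0|_β`, tensored with the identity on the clocks outside `S`. -/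
def zeroProj {L n : ℕ} [NeZero n] (S : Set (Fin L)) : ClockSpace L n →L[ℂ] ClockSpace L n :=
  Matrix.toEuclideanCLM (𝕜 := ℂ) (Matrix.diagonal fun s : Fin L → Fin n =>
    if ∀ β ∈ S, s β = 0 then (1 : ℂ) else 0)

/-! ### The gadget

The indices `i : Fin n` are added and subtracted modulo `n`, in accordance with `|n⟩ ≡ |0⟩`. -/

section Gadget

variable {H : Type*} [NormedAddCommGroup H] [InnerProductSpace ℂ H] [CompleteSpace H]
variable {L n : ℕ}

/-- The set `χ(α, i)` of the indices `β ≠ α` such that `M_i^α` fails to commute with some `M_j^β`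
or with some `(M_j^β)†`. -/
def chi (M : Fin L → Fin n → H →L[ℂ] H) (α : Fin L) (i : Fin n) : Set (Fin L) :=
  {β | β ≠ α ∧ ∃ j, ¬ Commute (M α i) (M β j) ∨ ¬ Commute (M α i) ((M β j).adjoint)}

/-- `H_0 = - ∑ α, Γ_0^α ⊗ |0⟩⟨0|_α`. -/
def unperturbed [NeZero n] (Γ₀ : Fin L → H →L[ℂ] H) :
    (H ⊗[ℂ] ClockSpace L n) →L[ℂ] (H ⊗[ℂ] ClockSpace L n) :=
  - ∑ α, TensorProduct.mapL (Γ₀ α) (ketBra α 0 0)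

/-- `V = ∑ α, ∑ i, ((M_i^α)† ⊗ |i+1⟩⟨i|_α χ̂(α,i) + M_i^α ⊗ |i⟩⟨i+1|_α χ̂(α,i))`. -/
def perturbation [NeZero n] (M : Fin L → Fin n → H →L[ℂ] H) :
    (H ⊗[ℂ] ClockSpace L n) →L[ℂ] (H ⊗[ℂ] ClockSpace L n) :=
  ∑ α, ∑ i,
    (TensorProduct.mapL ((M α i).adjoint) (ketBra α (i + 1) i * zeroProj (chi M α i)) +
      TensorProduct.mapL (M α i) (ketBra α i (i + 1) * zeroProj (chi M α i)))

/-- `Γ = ∏ α, Γ_0^α` (the factors commute in all uses, so that their order is irrelevant). -/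
def totalProj (Γ₀ : Fin L → H →L[ℂ] H) : H →L[ℂ] H :=
  (List.ofFn Γ₀).prod

/-- `H_target^α = Γ M_0^α ⋯ M_{n-1}^α Γ + Γ (M_{n-1}^α)† ⋯ (M_0^α)† Γ`. -/
def targetHamiltonian (Γ₀ : Fin L → H →L[ℂ] H) (M : Fin L → Fin n → H →L[ℂ] H) (α : Fin L) :
    H →L[ℂ] H :=
  totalProj Γ₀ * (List.ofFn (M α)).prod * totalProj Γ₀ +
    totalProj Γ₀ * (List.ofFn fun i => (M α i).adjoint).reverse.prod * totalProj Γ₀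

end Gadget

end

end ClockGadget

open ClockGadget

/-!
The unperturbed Hamiltonian `H₀`, shifted by `L` to ground state energy zero, is the number operator
`A₀ = ∑ α, (1 - q α)` of the commuting projections `q α = Γ_0^α ⊗ |0⟩⟨0|_α`. Its kernel is the range
of `P = ∏ α, q α = Γ ⊗ |0⟩⟨0|^{⊗ L}`, and it has a gap `1` above (`norm_sub_prod_sq_le`).

*Perturbation theory.* Let `R(g)` be the reduced resolvent, so that `(A₀ - g) R(g) = 1 - P`. The
truncated Brillouin–Wigner series `u = ∑ k ≤ n, (-λ)^k (R(g) V)^k P` satisfies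
`(A₀ + λ V - g) u = -g P + ∑ k < n, λ (-λ)^k P V (R(g) V)^k P + O(λ^(n+1))` (`brillouinWigner`). If
the words `P V (R(g) V)^k P` are multiples of `P`, apart from a term `(1 - g)^{-(n-1)} T` in the
last one, then `g` can be chosen such that all the multiples of `P` cancel: this is a fixed point
equation on the interval `[-1/2, 1/2]` (`exists_selfConsistent_energy`). What remains is
`(A₀ + λ V - g) u = (-1)^(n-1) λ^n T + O(λ^(n+1))`. As `u` and `P` are `O(λ)`-close to the low
energy projection, this determines the shifted effective Hamiltonian up to `O(λ^(n+1))`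
(`norm_shiftedEffectiveHamiltonian_sub_le`, `effectiveHamiltonian_of_words`). No convergence of a
perturbation series is needed, and the energies need not be continued analytically in `λ`.

*Walks of the clocks.* It remains to compute the words, that is the walks of the `L` clocks which
return to the start. The rules (ii)–(iv) show that the operator which a single clock has accumulated
depends, up to a scalar, only on the number and the direction of the steps which separate it from
the start (`IsClockState`), as long as it has not gone around its cycle: a step back cancels the
last step (`exists_bwd_fwdOp`, `exists_fwd_bwdOp`). The factors of different clocks commute where it
matters: a step of the clock `α` which is not suppressed by `χ̂(α, i)` commutes with the operators
of the clocks which are away from the start, and the commutation relations with `Γ_0^β` and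
`M_0^β (M_0^β)†` take care of the clocks at the start (`commute_state_of_chi`). So the maps
`x ↦ (∏ α, B α) x ⊗ |s⟩` with such states `B`, at most `j` steps away from the start, span a space
`walkSpan` which is preserved by the resolvent and mapped by `V` into the one for `j + 1`. For
`j < n` its elements are compressed to multiples of `P` (`groundProj_smul_of_mem_walkSpan`). At
order `n`, the only further walks are those which lead one clock straight around its cycle. The
unperturbed energy is `1` all along such a walk, so that it contributes `(1 - g)^{-(n-1)}` times one
of the two terms of `H_target^α` (`exists_word_eq`).
-/

open scoped TensorProduct

namespace ClockGadget

noncomputable section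

open scoped InnerProductSpace

/-! ### Quadratic forms and spectral projections -/

section Perturbation

variable {K : Type*} [NormedAddCommGroup K] [InnerProductSpace ℂ K]

lemma abs_reApplyInnerSelf_le (W : K →L[ℂ] K) (x : K) :
    |W.reApplyInnerSelf x| ≤ ‖W‖ * ‖x‖ ^ 2 := by
  rw [ContinuousLinearMap.reApplyInnerSelf_apply]
  calc |RCLike.re ⟪W x, x⟫_ℂ| ≤ ‖⟪W x, x⟫_ℂ‖ := RCLike.abs_re_le_norm _
    _ ≤ ‖W x‖ * ‖x‖ := norm_inner_le_norm _ _
    _ ≤ (‖W‖ * ‖x‖) * ‖x‖ := by gcongr; exact W.le_opNorm x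
    _ = ‖W‖ * ‖x‖ ^ 2 := by ring

lemma reApplyInnerSelf_add (A B : K →L[ℂ] K) (x : K) :
    (A + B).reApplyInnerSelf x = A.reApplyInnerSelf x + B.reApplyInnerSelf x := by
  simp [ContinuousLinearMap.reApplyInnerSelf_apply, inner_add_left]

lemma reApplyInnerSelf_sub (A B : K →L[ℂ] K) (x : K) :
    (A - B).reApplyInnerSelf x = A.reApplyInnerSelf x - B.reApplyInnerSelf x := by
  simp [ContinuousLinearMap.reApplyInnerSelf_apply, inner_sub_left]

lemma reApplyInnerSelf_smul_one (c : ℝ) (x : K) :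
    ((c : ℂ) • (1 : K →L[ℂ] K)).reApplyInnerSelf x = c * ‖x‖ ^ 2 := by
  rw [ContinuousLinearMap.reApplyInnerSelf_apply]
  change RCLike.re ⟪(c : ℂ) • x, x⟫_ℂ = _
  have h : RCLike.re ⟪x, x⟫_ℂ = ‖x‖ ^ 2 := inner_self_eq_norm_sq x
  rw [inner_smul_left, Complex.conj_ofReal, ← h]
  exact Complex.re_ofReal_mul _ _

variable {A₀ P W : K →L[ℂ] K}

lemma form_lower (hgap : ∀ x, ‖x - P x‖ ^ 2 ≤ A₀.reApplyInnerSelf x) (x : K) :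
    ‖x - P x‖ ^ 2 - ‖W‖ * ‖x‖ ^ 2 ≤ (A₀ + W).reApplyInnerSelf x := by
  rw [reApplyInnerSelf_add]
  have := abs_le.1 (abs_reApplyInnerSelf_le W x)
  linarith [hgap x]

lemma form_upper (hAP : A₀ * P = 0) {x : K} (hx : P x = x) :
    (A₀ + W).reApplyInnerSelf x ≤ ‖W‖ * ‖x‖ ^ 2 := by
  have h0 : A₀ x = 0 := by
    rw [← hx]; exact DFunLike.congr_fun hAP x
  rw [reApplyInnerSelf_add, ContinuousLinearMap.reApplyInnerSelf_apply A₀, h0]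
  have := abs_le.1 (abs_reApplyInnerSelf_le W x)
  simp; linarith

lemma inner_sub_apply_eq_zero [CompleteSpace K] (hP : IsStarProjection P) (x y : K) :
    ⟪P y, x - P x⟫_ℂ = 0 := by
  have h1 := ContinuousLinearMap.adjoint_inner_right P y (x - P x)
  have h2 : P.adjoint = P := hP.isSelfAdjoint.adjoint_eq
  rw [← h1, h2, map_sub]
  have h3 : P (P x) = P x := DFunLike.congr_fun hP.isIdempotentElem.eq x
  simp [h3]

/-- Pythagoras for an orthogonal projection. -/
lemma norm_sq_add_norm_sq_sub [CompleteSpace K] (hP : IsStarProjection P) (x : K) :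
    ‖P x‖ ^ 2 + ‖x - P x‖ ^ 2 = ‖x‖ ^ 2 := by
  have := norm_add_sq_eq_norm_sq_add_norm_sq_of_inner_eq_zero _ _
    (inner_sub_apply_eq_zero hP x x)
  rw [add_sub_cancel] at this
  nlinarith

/-- The energy `1/2` lies in the gap between the perturbed ground space and the rest of the
spectrum. -/
lemma isUnit_sub_half [CompleteSpace K] (hP : IsStarProjection P) (hAP : A₀ * P = 0)
    (hgap : ∀ x, ‖x - P x‖ ^ 2 ≤ A₀.reApplyInnerSelf x) (hW : ‖W‖ ≤ 1 / 16) :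
    IsUnit (A₀ + W - ((1 / 2 : ℝ) : ℂ) • (1 : K →L[ℂ] K)) := by
  set J : K →L[ℂ] K := 1 - (2 : ℂ) • P with hJ
  have hPP : P * P = P := hP.isIdempotentElem.eq
  have hJJ : J * J = 1 := by
    simp only [hJ, mul_sub, sub_mul, mul_one, one_mul, mul_smul_comm, smul_mul_assoc, hPP]
    module
  have hJu : IsUnit J := ⟨⟨J, J, hJJ, hJJ⟩, rfl⟩
  -- multiplying by the reflection `1 - 2P` turns `A₀ - 1/2` into a form bounded below
  suffices h : IsUnit ((A₀ + W - ((1 / 2 : ℝ) : ℂ) • (1 : K →L[ℂ] K)) * J) by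
    have := h.mul hJu
    rwa [mul_assoc, hJJ, mul_one] at this
  apply ContinuousLinearMap.isUnit_of_forall_le_norm_inner_map _ (c := 1 / 8) (by norm_num)
  intro x
  refine le_trans ?_ (RCLike.re_le_norm _)
  have hexp : (A₀ + W - ((1 / 2 : ℝ) : ℂ) • (1 : K →L[ℂ] K)) * J =
      A₀ + W * J - (((1 / 2 : ℝ) : ℂ) • (1 : K →L[ℂ] K) - P) := by
    have : A₀ * J = A₀ := by simp [hJ, mul_sub, hAP]
    rw [sub_mul, add_mul, this]
    simp only [hJ, mul_sub, smul_mul_assoc, one_mul]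
    push_cast; module
  rw [← ContinuousLinearMap.reApplyInnerSelf_apply, hexp, reApplyInnerSelf_sub,
    reApplyInnerSelf_sub, reApplyInnerSelf_add, reApplyInnerSelf_smul_one]
  have h1 : P.reApplyInnerSelf x = ‖P x‖ ^ 2 := by
    have h2 := inner_sub_apply_eq_zero hP x x
    rw [inner_sub_right, sub_eq_zero] at h2
    rw [ContinuousLinearMap.reApplyInnerSelf_apply, h2, inner_self_eq_norm_sq]
  have h3 := norm_sq_add_norm_sq_sub hP x
  have h4 : ‖W * J‖ ≤ 3 / 16 := by
    have hJn : ‖J‖ ≤ 3 := by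
      have hPn : ‖P‖ ≤ 1 := hP.norm_le
      calc ‖J‖ ≤ ‖(1 : K →L[ℂ] K)‖ + ‖(2 : ℂ) • P‖ := norm_sub_le _ _
        _ ≤ 1 + 2 * 1 := by
          rw [norm_smul]; gcongr
          · exact ContinuousLinearMap.norm_id_le
          · simp
        _ = 3 := by norm_num
    calc ‖W * J‖ ≤ ‖W‖ * ‖J‖ := norm_mul_le _ _
      _ ≤ (1 / 16) * 3 := by gcongr
      _ = 3 / 16 := by norm_num
  have h5 := abs_le.1 (abs_reApplyInnerSelf_le (W * J) x)
  have h6 := hgap x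
  have h7 : ‖W * J‖ * ‖x‖ ^ 2 ≤ 3 / 16 * ‖x‖ ^ 2 := by gcongr
  rw [h1]
  push_cast
  nlinarith [sq_nonneg ‖x‖]

/-- A spectral projection for the energies below `1/2`. -/
lemma exists_spectral_projection [CompleteSpace K] {A : K →L[ℂ] K} (hA : IsSelfAdjoint A)
    (hu : IsUnit (A - ((1 / 2 : ℝ) : ℂ) • (1 : K →L[ℂ] K))) :
    ∃ Q : K →L[ℂ] K, IsStarProjection Q ∧ Commute A Q ∧
      (∀ x, Q x = x → A.reApplyInnerSelf x ≤ 1 / 2 * ‖x‖ ^ 2) ∧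
      (∀ x, Q x = 0 → 1 / 2 * ‖x‖ ^ 2 ≤ A.reApplyInnerSelf x) := by
  set f : ℝ → ℝ := fun x => if x < 1 / 2 then 1 else 0 with hf
  have hns : (1 / 2 : ℝ) ∉ spectrum ℝ A := by
    rw [spectrum.notMem_iff, ← IsUnit.neg_iff]
    convert hu using 1
    rw [neg_sub, Algebra.algebraMap_eq_smul_one]
    congr 1
  have hfc : ContinuousOn f (spectrum ℝ A) := by
    intro x hx
    have hne : x ≠ 1 / 2 := fun h => hns (h ▸ hx)
    apply ContinuousAt.continuousWithinAt
    rcases lt_or_gt_of_ne hne with h | h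
    · refine (continuousAt_const (y := (1 : ℝ))).congr ?_
      filter_upwards [eventually_lt_nhds h] with y hy
      simp only [hf]; rw [if_pos hy]
    · refine (continuousAt_const (y := (0 : ℝ))).congr ?_
      filter_upwards [eventually_gt_nhds h] with y hy
      simp only [hf]; rw [if_neg (by linarith)]
  have hid : cfc (fun x : ℝ => x) A = A := cfc_id' ℝ A
  have hsub : ∀ c : ℝ, cfc (fun x : ℝ => c) A = (c : ℂ) • (1 : K →L[ℂ] K) := by
    intro c
    rw [cfc_const c A, Algebra.algebraMap_eq_smul_one]; rfl
  refine ⟨cfc f A, ⟨?_, cfc_predicate f A⟩, ?_, ?_, ?_⟩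
  · rw [IsIdempotentElem, ← cfc_mul f f A]
    congr 1; ext x; simp [hf]
  · have := cfc_commute_cfc (fun x : ℝ => x) f A
    rwa [hid] at this
  · intro x hx
    have h : 0 ≤ cfc (fun x => (1 / 2 - x) * f x) A := by
      apply cfc_nonneg
      intro y _
      simp only [hf]; split_ifs with h
      · linarith
      · simp
    rw [cfc_mul (fun x => 1 / 2 - x) f A, cfc_sub (fun _ => 1 / 2) (fun x => x) A, hid, hsub,
      ContinuousLinearMap.nonneg_iff_isPositive] at h
    have := h.re_inner_nonneg_left x
    rw [mul_apply_eq_comp, hx, ← ContinuousLinearMap.reApplyInnerSelf_apply,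
      reApplyInnerSelf_sub, reApplyInnerSelf_smul_one] at this
    linarith
  · intro x hx
    have h : 0 ≤ cfc (fun x => (x - 1 / 2) * (1 - f x)) A := by
      apply cfc_nonneg
      intro y _
      simp only [hf]; split_ifs with h
      · simp
      · linarith
    rw [cfc_mul (fun x => x - 1 / 2) (fun x => 1 - f x) A,
      cfc_sub (fun x => x) (fun _ => 1 / 2) A, cfc_sub (fun _ => 1) f A, hid, hsub, hsub,
      ContinuousLinearMap.nonneg_iff_isPositive] at h
    have := h.re_inner_nonneg_left x
    rw [mul_apply_eq_comp] at this
    simp only [sub_apply, hx] at this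
    have h2 : (((1 : ℝ) : ℂ) • (1 : K →L[ℂ] K)) x - 0 = x := by simp
    rw [h2, ← sub_apply, ← ContinuousLinearMap.reApplyInnerSelf_apply,
      reApplyInnerSelf_sub, reApplyInnerSelf_smul_one] at this
    linarith

end Perturbation

/-! ### The lowest eigenvectors of a perturbed operator -/

section Perturbation

variable {K : Type*} [NormedAddCommGroup K] [InnerProductSpace ℂ K]

lemma apply_apply_of_isStarProjection [CompleteSpace K] {P : K →L[ℂ] K} (hP : IsStarProjection P)
    (x : K) : P (P x) = P x :=
  DFunLike.congr_fun hP.isIdempotentElem.eq x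

lemma inner_apply_left [CompleteSpace K] {A : K →L[ℂ] K} (hA : IsSelfAdjoint A)
    (x y : K) : ⟪A x, y⟫_ℂ = ⟪x, A y⟫_ℂ := by
  rw [← ContinuousLinearMap.adjoint_inner_right, hA.adjoint_eq]

/-- The `d` lowest energies of the perturbed operator exist, where `d` is the rank of the
unperturbed ground projection. -/
theorem exists_isLowestEigensystem [CompleteSpace K] {A₀ P W : K →L[ℂ] K}
    (hA : IsSelfAdjoint A₀) (hWa : IsSelfAdjoint W) (hP : IsStarProjection P) (hAP : A₀ * P = 0)
    (hgap : ∀ x, ‖x - P x‖ ^ 2 ≤ A₀.reApplyInnerSelf x)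
    [FiniteDimensional ℂ (LinearMap.range (P : K →ₗ[ℂ] K))] (hW : ‖W‖ ≤ 1 / 16) {d : ℕ}
    (hd : Module.finrank ℂ (LinearMap.range (P : K →ₗ[ℂ] K)) = d) :
    ∃ (E : Fin d → ℝ) (φ : Fin d → K), IsLowestEigensystem (A₀ + W) E φ := by
  have hAW : IsSelfAdjoint (A₀ + W) := hA.add hWa
  obtain ⟨Q, hQ, hcomm, hlow, hhigh⟩ :=
    exists_spectral_projection hAW (isUnit_sub_half hP hAP hgap hW)
  set S : Submodule ℂ K := LinearMap.range (Q : K →ₗ[ℂ] K) with hS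
  have hQS : ∀ x : S, Q x = x := by
    rintro ⟨_, y, rfl⟩
    exact apply_apply_of_isStarProjection hQ y
  have hPR : ∀ x : LinearMap.range (P : K →ₗ[ℂ] K), P x = x := by
    rintro ⟨_, y, rfl⟩
    exact apply_apply_of_isStarProjection hP y
  -- the projections `P` and `Q` are injective on the range of each other
  have hinj₁ : Function.Injective ((P : K →ₗ[ℂ] K).rangeRestrict ∘ₗ S.subtype) := by
    rw [← LinearMap.ker_eq_bot, LinearMap.ker_eq_bot']
    intro x hx
    have hPx : P x = 0 := congrArg Subtype.val hx
    have h1 := hlow x (hQS x)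
    have h2 := form_lower (W := W) hgap x
    rw [hPx, sub_zero] at h2
    have h3 : ‖(x : K)‖ ^ 2 = 0 := by
      have h0 := sq_nonneg ‖(x : K)‖
      nlinarith
    exact Subtype.ext (by simpa using h3)
  have hinj₂ : Function.Injective
      ((Q : K →ₗ[ℂ] K).rangeRestrict ∘ₗ (LinearMap.range (P : K →ₗ[ℂ] K)).subtype) := by
    rw [← LinearMap.ker_eq_bot, LinearMap.ker_eq_bot']
    intro x hx
    have hQx : Q x = 0 := congrArg Subtype.val hx
    have h1 := hhigh x hQx
    have h2 := form_upper (W := W) hAP (hPR x)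
    have h3 : ‖(x : K)‖ ^ 2 = 0 := by
      have h0 := sq_nonneg ‖(x : K)‖
      nlinarith
    exact Subtype.ext (by simpa using h3)
  have : FiniteDimensional ℂ S := FiniteDimensional.of_injective _ hinj₁
  have hdS : Module.finrank ℂ S = d := by
    rw [← hd]
    exact le_antisymm (LinearMap.finrank_le_finrank_of_injective hinj₁)
      (LinearMap.finrank_le_finrank_of_injective hinj₂)
  have hinv : ∀ x ∈ S, ((A₀ + W : K →L[ℂ] K) : K →ₗ[ℂ] K) x ∈ S := by
    intro x hx
    refine ⟨(A₀ + W) x, ?_⟩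
    have := DFunLike.congr_fun hcomm.eq x
    have hx' : Q x = x := hQS ⟨x, hx⟩
    change (A₀ + W) (Q x) = Q ((A₀ + W) x) at this
    rw [hx'] at this
    exact this.symm
  have hsym := (hAW.isSymmetric).restrict_invariant hinv
  set b := hsym.eigenvectorBasis hdS with hb
  have hon : Orthonormal ℂ fun i => (b i : K) := b.orthonormal.comp_linearIsometry S.subtypeₗᵢ
  have hev : ∀ i, (A₀ + W) (b i : K) = (hsym.eigenvalues hdS i : ℂ) • (b i : K) := fun i =>
    congrArg Subtype.val (hsym.apply_eigenvectorBasis hdS i)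
  refine ⟨hsym.eigenvalues hdS, fun i => (b i : K), hon, hev, fun ψ hψ i => ?_⟩
  have hE : hsym.eigenvalues hdS i ≤ 1 / 2 := by
    have h1 := hlow (b i) (hQS (b i))
    have h2 : ‖(b i : K)‖ = 1 := hon.1 i
    have h3 : RCLike.re ⟪(b i : K), (b i : K)⟫_ℂ = ‖(b i : K)‖ ^ 2 := inner_self_eq_norm_sq _
    rw [ContinuousLinearMap.reApplyInnerSelf_apply, hev, inner_smul_left, Complex.conj_ofReal] at h1
    have h4 : RCLike.re ((hsym.eigenvalues hdS i : ℂ) * ⟪(b i : K), (b i : K)⟫_ℂ) =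
      hsym.eigenvalues hdS i * RCLike.re ⟪(b i : K), (b i : K)⟫_ℂ := Complex.re_ofReal_mul _ _
    rw [h4, h3, h2] at h1
    linarith
  have hQψ : Q ψ = 0 := by
    have h1 := b.sum_sq_norm_inner_right ⟨Q ψ, ψ, rfl⟩
    have h2 : ∀ j, ⟪b j, (⟨Q ψ, ψ, rfl⟩ : S)⟫_ℂ = 0 := by
      intro j
      change ⟪(b j : K), Q ψ⟫_ℂ = 0
      rw [← inner_apply_left hQ.isSelfAdjoint, hQS, hψ]
    simp only [h2, norm_zero] at h1
    have h3 : ‖Q ψ‖ ^ 2 = 0 := by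
      have : ‖(⟨Q ψ, ψ, rfl⟩ : S)‖ = ‖Q ψ‖ := rfl
      rw [← this, ← h1]; simp
    simpa using h3
  calc hsym.eigenvalues hdS i * ‖ψ‖ ^ 2 ≤ 1 / 2 * ‖ψ‖ ^ 2 := by gcongr
    _ ≤ _ := hhigh ψ hQψ

section Eigensystem

variable {d : ℕ} {E : Fin d → ℝ} {φ : Fin d → K}

lemma lowEnergyProjection_apply (φ : Fin d → K) (x : K) :
    lowEnergyProjection φ x = ∑ i, ⟪φ i, x⟫_ℂ • φ i := by
  simp [lowEnergyProjection]

lemma lowEnergyProjection_eigenvector (hφ : Orthonormal ℂ φ) (i : Fin d) :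
    lowEnergyProjection φ (φ i) = φ i := by
  rw [lowEnergyProjection_apply, Finset.sum_eq_single i]
  · rw [inner_self_eq_norm_sq_to_K, hφ.1 i]; simp
  · intro j _ hj
    rw [hφ.2 hj, zero_smul]
  · simp

lemma isStarProjection_lowEnergyProjection [CompleteSpace K] (hφ : Orthonormal ℂ φ) :
    IsStarProjection (lowEnergyProjection φ) := by
  constructor
  · ext x
    change lowEnergyProjection φ (lowEnergyProjection φ x) = _
    conv_lhs => rw [lowEnergyProjection_apply φ x]
    rw [map_sum, lowEnergyProjection_apply]
    exact Finset.sum_congr rfl fun i _ => by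
      rw [map_smul, lowEnergyProjection_eigenvector hφ]
  · rw [lowEnergyProjection]
    refine isSelfAdjoint_sum _ fun i _ => ?_
    rw [ContinuousLinearMap.isSelfAdjoint_iff', InnerProductSpace.adjoint_rankOne]

lemma finrank_range_lowEnergyProjection (hφ : Orthonormal ℂ φ) :
    Module.finrank ℂ (LinearMap.range (lowEnergyProjection φ : K →ₗ[ℂ] K)) = d := by
  have : LinearMap.range (lowEnergyProjection φ : K →ₗ[ℂ] K) =
      Submodule.span ℂ (Set.range φ) := by
    apply le_antisymm
    · rintro _ ⟨x, rfl⟩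
      change lowEnergyProjection φ x ∈ _
      rw [lowEnergyProjection_apply]
      exact Submodule.sum_mem _ fun i _ =>
        Submodule.smul_mem _ _ (Submodule.subset_span ⟨i, rfl⟩)
    · rw [Submodule.span_le]
      rintro _ ⟨i, rfl⟩
      exact ⟨φ i, lowEnergyProjection_eigenvector hφ i⟩
  rw [this, finrank_span_eq_card hφ.linearIndependent, Fintype.card_fin]

lemma effectiveHamiltonian_apply (E : Fin d → ℝ) (φ : Fin d → K) (x : K) :
    effectiveHamiltonian E φ x = ∑ i, (E i : ℂ) • ⟪φ i, x⟫_ℂ • φ i := by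
  rw [effectiveHamiltonian, sum_apply]
  rfl

lemma effectiveHamiltonian_eq_mul {A : K →L[ℂ] K} (h : IsLowestEigensystem A E φ) :
    effectiveHamiltonian E φ = A * lowEnergyProjection φ := by
  ext x
  change _ = A (lowEnergyProjection φ x)
  rw [lowEnergyProjection_apply, map_sum, effectiveHamiltonian_apply]
  exact Finset.sum_congr rfl fun i _ => by rw [map_smul, h.eigenvector, smul_comm]

lemma commute_lowEnergyProjection [CompleteSpace K] {A : K →L[ℂ] K} (hA : IsSelfAdjoint A)
    (h : IsLowestEigensystem A E φ) : Commute A (lowEnergyProjection φ) := by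
  rw [Commute, SemiconjBy, ← effectiveHamiltonian_eq_mul h]
  ext x
  change _ = lowEnergyProjection φ (A x)
  rw [lowEnergyProjection_apply, effectiveHamiltonian_apply]
  refine Finset.sum_congr rfl fun i _ => ?_
  rw [← inner_apply_left hA, h.eigenvector, inner_smul_left, Complex.conj_ofReal, smul_smul]

lemma norm_sum_smul_sq (hφ : Orthonormal ℂ φ) (a : Fin d → ℂ) :
    ‖∑ i, a i • φ i‖ ^ 2 = ∑ i, ‖a i‖ ^ 2 := by
  have h1 : ⟪∑ i, a i • φ i, ∑ i, a i • φ i⟫_ℂ = ∑ i, (starRingEnd ℂ) (a i) * a i :=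
    hφ.inner_sum a a Finset.univ
  have h2 : RCLike.re ⟪∑ i, a i • φ i, ∑ i, a i • φ i⟫_ℂ = ‖∑ i, a i • φ i‖ ^ 2 :=
    inner_self_eq_norm_sq _
  rw [← h2, h1, map_sum]
  refine Finset.sum_congr rfl fun i _ => ?_
  rw [← Complex.normSq_eq_conj_mul_self, ← Complex.normSq_eq_norm_sq]
  exact Complex.ofReal_re _

lemma reApplyInnerSelf_eigenvector {A : K →L[ℂ] K} (h : IsLowestEigensystem A E φ) (i : Fin d) :
    A.reApplyInnerSelf (φ i) = E i := by
  have h3 : RCLike.re ⟪φ i, φ i⟫_ℂ = ‖φ i‖ ^ 2 := inner_self_eq_norm_sq _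
  have h4 : RCLike.re ((E i : ℂ) * ⟪φ i, φ i⟫_ℂ) = E i * RCLike.re ⟪φ i, φ i⟫_ℂ :=
    Complex.re_ofReal_mul _ _
  rw [ContinuousLinearMap.reApplyInnerSelf_apply, h.eigenvector, inner_smul_left,
    Complex.conj_ofReal, h4, h3, h.orthonormal.1 i]
  ring

lemma neg_norm_le_eigenvalue {A₀ P W : K →L[ℂ] K}
    (hgap : ∀ x, ‖x - P x‖ ^ 2 ≤ A₀.reApplyInnerSelf x)
    (h : IsLowestEigensystem (A₀ + W) E φ) (i : Fin d) : -‖W‖ ≤ E i := by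
  have h1 := form_lower (W := W) hgap (φ i)
  rw [reApplyInnerSelf_eigenvector h, h.orthonormal.1 i] at h1
  nlinarith [sq_nonneg ‖φ i - P (φ i)‖]

variable [CompleteSpace K] {A₀ P W : K →L[ℂ] K}

/-- The min-max principle: the range of `P` has dimension `d`, so that it contains a vector
orthogonal to all `φ j` but the `i`-th one. -/
lemma eigenvalue_le (hA : IsSelfAdjoint A₀) (hWa : IsSelfAdjoint W)
    (hP : IsStarProjection P) (hAP : A₀ * P = 0)
    [FiniteDimensional ℂ (LinearMap.range (P : K →ₗ[ℂ] K))]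
    (hd : Module.finrank ℂ (LinearMap.range (P : K →ₗ[ℂ] K)) = d)
    (h : IsLowestEigensystem (A₀ + W) E φ) (i : Fin d) : E i ≤ ‖W‖ := by
  have hAW : IsSelfAdjoint (A₀ + W) := hA.add hWa
  let f : LinearMap.range (P : K →ₗ[ℂ] K) →ₗ[ℂ] ({j : Fin d // j ≠ i} → ℂ) :=
    LinearMap.pi fun j => (innerₛₗ ℂ (φ j)) ∘ₗ (LinearMap.range (P : K →ₗ[ℂ] K)).subtype
  have hlt : Module.finrank ℂ ({j : Fin d // j ≠ i} → ℂ) <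
      Module.finrank ℂ (LinearMap.range (P : K →ₗ[ℂ] K)) := by
    rw [hd, Module.finrank_fintype_fun_eq_card]
    have := Fintype.card_subtype_lt (p := fun j : Fin d => j ≠ i) (x := i) (by simp)
    simpa using this
  obtain ⟨g, hg, hg0⟩ :=
    (Submodule.ne_bot_iff _).1 (LinearMap.ker_ne_bot_of_finrank_lt (f := f) hlt)
  have hPg : P g = g := by
    obtain ⟨_, y, rfl⟩ := g
    exact apply_apply_of_isStarProjection hP y
  have horth : ∀ j, j ≠ i → ⟪φ j, (g : K)⟫_ℂ = 0 := fun j hj =>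
    congrFun (LinearMap.mem_ker.1 hg) ⟨j, hj⟩
  set c : ℂ := ⟪φ i, (g : K)⟫_ℂ with hc
  set ψ : K := g - c • φ i with hψ
  have hgs : (g : K) = c • φ i + ψ := by simp [hψ]
  have hii : ⟪φ i, φ i⟫_ℂ = 1 := by
    rw [inner_self_eq_norm_sq_to_K, h.orthonormal.1 i]; simp
  have hψo : ∀ j, ⟪φ j, ψ⟫_ℂ = 0 := by
    intro j
    rw [hψ, inner_sub_right, inner_smul_right]
    by_cases hj : j = i
    · rw [hj, hii, hc]; ring
    · rw [horth j hj, h.orthonormal.2 hj]; ring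
  have hform : (A₀ + W).reApplyInnerSelf g = E i * ‖c‖ ^ 2 + (A₀ + W).reApplyInnerSelf ψ := by
    have h1 : ⟪(A₀ + W) ψ, φ i⟫_ℂ = 0 := by
      rw [inner_apply_left hAW, h.eigenvector, inner_smul_right, ← inner_conj_symm, hψo]; simp
    have h2 : ⟪(A₀ + W) (φ i), φ i⟫_ℂ = E i := by
      rw [h.eigenvector, inner_smul_left, hii]; simp
    have h3 : ⟪(A₀ + W) (φ i), ψ⟫_ℂ = 0 := by
      rw [h.eigenvector, inner_smul_left, hψo]; simp
    rw [ContinuousLinearMap.reApplyInnerSelf_apply, ContinuousLinearMap.reApplyInnerSelf_apply,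
      hgs, map_add, map_smul, inner_add_left, inner_add_right, inner_add_right, inner_smul_left,
      inner_smul_right, inner_smul_left, inner_smul_right, h1, h2, h3, ← mul_assoc,
      ← Complex.normSq_eq_conj_mul_self, Complex.normSq_eq_norm_sq]
    simp only [mul_zero, add_zero, zero_add, map_add]
    congr 1
    rw [← Complex.ofReal_mul, mul_comm (E i)]
    exact Complex.ofReal_re _
  have hnorm : ‖(g : K)‖ ^ 2 = ‖c‖ ^ 2 + ‖ψ‖ ^ 2 := by
    have h1 : ⟪c • φ i, ψ⟫_ℂ = 0 := by rw [inner_smul_left, hψo]; simp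
    have h2 := norm_add_sq_eq_norm_sq_add_norm_sq_of_inner_eq_zero _ _ h1
    rw [← hgs, norm_smul, h.orthonormal.1 i] at h2
    nlinarith
  have hlow := h.lowest ψ hψo i
  have hup := form_upper (W := W) hAP hPg
  have hgpos : 0 < ‖(g : K)‖ ^ 2 := by
    have : (g : K) ≠ 0 := fun h0 => hg0 (Subtype.ext h0)
    positivity
  refine le_of_mul_le_mul_right ?_ hgpos
  calc E i * ‖(g : K)‖ ^ 2 = E i * ‖c‖ ^ 2 + E i * ‖ψ‖ ^ 2 := by rw [hnorm]; ring
    _ ≤ _ := by linarith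

/-- The low energy space is contained in the unperturbed ground space up to first order. -/
lemma norm_lowEnergyProjection_sub_le (hA : IsSelfAdjoint A₀) (hWa : IsSelfAdjoint W)
    (hP : IsStarProjection P) (hAP : A₀ * P = 0)
    (hgap : ∀ x, ‖x - P x‖ ^ 2 ≤ A₀.reApplyInnerSelf x)
    [FiniteDimensional ℂ (LinearMap.range (P : K →ₗ[ℂ] K))]
    (hd : Module.finrank ℂ (LinearMap.range (P : K →ₗ[ℂ] K)) = d)
    (h : IsLowestEigensystem (A₀ + W) E φ) :
    ‖lowEnergyProjection φ - P * lowEnergyProjection φ‖ ≤ 2 * ‖W‖ := by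
  refine ContinuousLinearMap.opNorm_le_bound _ (by positivity) fun x => ?_
  set v := lowEnergyProjection φ x with hv
  change ‖v - P v‖ ≤ _
  have hvx : ‖v‖ ≤ ‖x‖ := by
    have h1 : ‖lowEnergyProjection φ‖ ≤ 1 :=
      (isStarProjection_lowEnergyProjection h.orthonormal).norm_le
    calc ‖v‖ ≤ ‖lowEnergyProjection φ‖ * ‖x‖ := ContinuousLinearMap.le_opNorm _ _
      _ ≤ 1 * ‖x‖ := by gcongr
      _ = ‖x‖ := one_mul _
  have hAv : ‖(A₀ + W) v‖ ≤ ‖W‖ * ‖x‖ := by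
    refine abs_le_of_sq_le_sq' ?_ (by positivity) |>.2
    have h1 : (A₀ + W) v = ∑ i, ((E i : ℂ) * ⟪φ i, x⟫_ℂ) • φ i := by
      rw [hv, lowEnergyProjection_apply, map_sum]
      refine Finset.sum_congr rfl fun i _ => ?_
      rw [map_smul, h.eigenvector, smul_smul, mul_comm]
    rw [h1, norm_sum_smul_sq h.orthonormal]
    calc ∑ i, ‖(E i : ℂ) * ⟪φ i, x⟫_ℂ‖ ^ 2 ≤ ∑ i, ‖W‖ ^ 2 * ‖⟪φ i, x⟫_ℂ‖ ^ 2 := by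
          refine Finset.sum_le_sum fun i _ => ?_
          rw [norm_mul, mul_pow, Complex.norm_real, Real.norm_eq_abs]
          gcongr
          exact abs_le.2 ⟨neg_norm_le_eigenvalue hgap h i, eigenvalue_le hA hWa hP hAP hd h i⟩
      _ = ‖W‖ ^ 2 * ∑ i, ‖⟪φ i, x⟫_ℂ‖ ^ 2 := by rw [Finset.mul_sum]
      _ ≤ ‖W‖ ^ 2 * ‖x‖ ^ 2 := by
          gcongr; exact h.orthonormal.sum_inner_products_le x
      _ = _ := by ring
  have hA₀v : ‖A₀ v‖ ≤ 2 * ‖W‖ * ‖x‖ := by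
    have h1 : A₀ v = (A₀ + W) v - W v := by simp
    calc ‖A₀ v‖ ≤ ‖(A₀ + W) v‖ + ‖W v‖ := by rw [h1]; exact norm_sub_le _ _
      _ ≤ ‖W‖ * ‖x‖ + ‖W‖ * ‖x‖ := by
        gcongr
        exact (W.le_opNorm v).trans (by gcongr)
      _ = _ := by ring
  refine le_trans ?_ hA₀v
  have h1 : A₀.reApplyInnerSelf v = RCLike.re ⟪A₀ v, v - P v⟫_ℂ := by
    have h2 : A₀ (P v) = 0 := DFunLike.congr_fun hAP v
    rw [ContinuousLinearMap.reApplyInnerSelf_apply, inner_sub_right, inner_apply_left hA v (P v),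
      h2]
    simp
  have h2 := hgap v
  rw [h1] at h2
  have h3 : RCLike.re ⟪A₀ v, v - P v⟫_ℂ ≤ ‖A₀ v‖ * ‖v - P v‖ :=
    (RCLike.re_le_norm _).trans (norm_inner_le_norm _ _)
  by_contra hcon
  push Not at hcon
  nlinarith [norm_nonneg (A₀ v)]

end Eigensystem

/-- If a projection `Q` of the same finite rank as `P` is close to `P` on its range, then `P`
vanishes approximately on the orthogonal complement of that range. -/
lemma norm_sub_mul_le_of_finrank_eq [CompleteSpace K] {P Q : K →L[ℂ] K} (hP : IsStarProjection P)
    (hQ : IsStarProjection Q)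
    [FiniteDimensional ℂ (LinearMap.range (P : K →ₗ[ℂ] K))]
    [FiniteDimensional ℂ (LinearMap.range (Q : K →ₗ[ℂ] K))]
    (hd : Module.finrank ℂ (LinearMap.range (Q : K →ₗ[ℂ] K)) =
      Module.finrank ℂ (LinearMap.range (P : K →ₗ[ℂ] K))) {ε : ℝ} (hε : ε ≤ 1 / 2)
    (h : ‖Q - P * Q‖ ≤ ε) : ‖P - P * Q‖ ≤ 2 * ε := by
  have hε0 : 0 ≤ ε := (norm_nonneg _).trans h
  have hQS : ∀ x : LinearMap.range (Q : K →ₗ[ℂ] K), Q x = x := by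
    rintro ⟨_, y, rfl⟩
    exact apply_apply_of_isStarProjection hQ y
  have hclose : ∀ v : LinearMap.range (Q : K →ₗ[ℂ] K), ‖(v : K) - P v‖ ≤ ε * ‖(v : K)‖ := by
    intro v
    have h1 := (Q - P * Q).le_of_opNorm_le h v
    change ‖Q v - P (Q v)‖ ≤ _ at h1
    rwa [hQS] at h1
  have hinj : Function.Injective
      ((P : K →ₗ[ℂ] K).rangeRestrict ∘ₗ (LinearMap.range (Q : K →ₗ[ℂ] K)).subtype) := by
    rw [← LinearMap.ker_eq_bot, LinearMap.ker_eq_bot']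
    intro x hx
    have hPx : P x = 0 := congrArg Subtype.val hx
    have h1 := hclose x
    rw [hPx, sub_zero] at h1
    have h3 : ‖(x : K)‖ = 0 := by
      have h0 := norm_nonneg (x : K)
      nlinarith
    exact Subtype.ext (by simpa using h3)
  have hsurj := (LinearMap.injective_iff_surjective_of_finrank_eq_finrank hd).1 hinj
  refine ContinuousLinearMap.opNorm_le_bound _ (by positivity) fun x => ?_
  change ‖P x - P (Q x)‖ ≤ _
  rw [← map_sub]
  set ψ := x - Q x with hψ
  have hψx : ‖ψ‖ ≤ ‖x‖ := by
    have h1 := norm_sq_add_norm_sq_sub hQ x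
    rw [← hψ] at h1
    exact abs_le_of_sq_le_sq' (by nlinarith [sq_nonneg ‖Q x‖]) (by positivity) |>.2
  obtain ⟨v, hv⟩ := hsurj ⟨P ψ, ψ, rfl⟩
  have hv : P v = P ψ := congrArg Subtype.val hv
  have hvψ : ⟪(v : K), ψ⟫_ℂ = 0 := by
    rw [← hQS v]; exact inner_sub_apply_eq_zero hQ x v
  have hvn : ‖(v : K)‖ ≤ 2 * ‖P ψ‖ := by
    have h1 := hclose v
    have h2 : ‖(v : K)‖ ≤ ‖(v : K) - P v‖ + ‖P v‖ := by
      simpa using norm_add_le ((v : K) - P v) (P v)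
    rw [hv] at h1 h2
    nlinarith [norm_nonneg (v : K)]
  have hsq : ‖P ψ‖ ^ 2 ≤ ε * ‖(v : K)‖ * ‖ψ‖ := by
    have h1 : RCLike.re ⟪P ψ, P ψ⟫_ℂ = ‖P ψ‖ ^ 2 := inner_self_eq_norm_sq _
    have h2 : ⟪P ψ, P ψ⟫_ℂ = ⟪P v - v, ψ⟫_ℂ := by
      rw [inner_sub_left, hvψ, sub_zero, hv, ← inner_apply_left hP.isSelfAdjoint,
        apply_apply_of_isStarProjection hP]
    rw [← h1, h2]
    calc RCLike.re ⟪P v - v, ψ⟫_ℂ ≤ ‖⟪P v - v, ψ⟫_ℂ‖ := RCLike.re_le_norm _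
      _ ≤ ‖P v - v‖ * ‖ψ‖ := norm_inner_le_norm _ _
      _ ≤ _ := by
        gcongr
        rw [norm_sub_rev]; exact hclose v
  have hfin : ‖P ψ‖ * ‖P ψ‖ ≤ (2 * ε * ‖x‖) * ‖P ψ‖ := by
    calc ‖P ψ‖ * ‖P ψ‖ = ‖P ψ‖ ^ 2 := by ring
      _ ≤ ε * ‖(v : K)‖ * ‖ψ‖ := hsq
      _ ≤ ε * (2 * ‖P ψ‖) * ‖x‖ := by gcongr
      _ = _ := by ring
  rcases (norm_nonneg (P ψ)).eq_or_lt with h0 | h0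
  · rw [← h0]; positivity
  · exact le_of_mul_le_mul_right hfin h0

end Perturbation

/-! ### Approximate eigenprojections and the Brillouin–Wigner series -/

section Perturbation

variable {K : Type*} [NormedAddCommGroup K] [InnerProductSpace ℂ K]

/-- The Brillouin–Wigner expansion: with `u = ∑ (-λ R V)^k P`, the operator `A₀ + λ V - g` maps the
range of `u` into the range of `P`, up to the last term of the expansion. -/
lemma brillouinWigner {A₀ P V R : K →L[ℂ] K} {g : ℝ} (hAP : A₀ * P = 0)
    (hR : (A₀ - (g : ℂ) • (1 : K →L[ℂ] K)) * R = 1 - P) (lam : ℂ) (n : ℕ) :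
    (A₀ + lam • V - (g : ℂ) • (1 : K →L[ℂ] K)) *
        ∑ k ∈ Finset.range (n + 1), (-lam) ^ k • ((R * V) ^ k * P) =
      -(g : ℂ) • P + ∑ k ∈ Finset.range n, (lam * (-lam) ^ k) • (P * V * (R * V) ^ k * P) +
        (lam * (-lam) ^ n) • (V * (R * V) ^ n * P) := by
  induction n with
  | zero => simp [add_mul, sub_mul, hAP]; abel
  | succ n ih =>
    have hstep : (A₀ - (g : ℂ) • (1 : K →L[ℂ] K)) * ((R * V) ^ (n + 1) * P) =
        V * (R * V) ^ n * P - P * V * (R * V) ^ n * P := by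
      have h1 : (A₀ - (g : ℂ) • (1 : K →L[ℂ] K)) * ((R * V) ^ (n + 1) * P) =
          ((A₀ - (g : ℂ) • (1 : K →L[ℂ] K)) * R) * (V * (R * V) ^ n * P) := by
        rw [pow_succ']; simp only [mul_assoc]
      rw [h1, hR, sub_mul, one_mul]; simp only [mul_assoc]
    have hsplit : A₀ + lam • V - (g : ℂ) • (1 : K →L[ℂ] K) =
        (A₀ - (g : ℂ) • (1 : K →L[ℂ] K)) + lam • V := by abel
    rw [Finset.sum_range_succ, mul_add, ih, Finset.sum_range_succ _ n, mul_smul_comm, hsplit,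
      add_mul, hstep, smul_mul_assoc, ← mul_assoc V]
    module

variable [CompleteSpace K]

/-- An operator `u` close to `P` which intertwines `A₀ + W - g` with `t T` up to a small error
determines the effective Hamiltonian. -/
lemma norm_shiftedEffectiveHamiltonian_sub_le {d : ℕ} {E : Fin d → ℝ} {φ : Fin d → K}
    {A₀ P W T u e : K →L[ℂ] K} {g κ : ℝ} {t : ℂ}
    (hA : IsSelfAdjoint A₀) (hWa : IsSelfAdjoint W)
    (hP : IsStarProjection P) (hAP : A₀ * P = 0)
    (hgap : ∀ x, ‖x - P x‖ ^ 2 ≤ A₀.reApplyInnerSelf x)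
    [FiniteDimensional ℂ (LinearMap.range (P : K →ₗ[ℂ] K))]
    (hd : Module.finrank ℂ (LinearMap.range (P : K →ₗ[ℂ] K)) = d)
    (h : IsLowestEigensystem (A₀ + W) E φ) (hT : T = P * T * P)
    (hκ : κ ≤ 1 / 16) (hWκ : ‖W‖ ≤ κ) (huκ : ‖u - P‖ ≤ κ)
    (hu : (A₀ + W - (g : ℂ) • (1 : K →L[ℂ] K)) * u = t • T + e) :
    ‖shiftedEffectiveHamiltonian E φ g - t • T‖ ≤ 14 * κ * (‖t‖ * ‖T‖) + 2 * ‖e‖ := by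
  have hκ0 : 0 ≤ κ := (norm_nonneg _).trans hWκ
  set Q := lowEnergyProjection φ with hQdef
  have hQ : IsStarProjection Q := isStarProjection_lowEnergyProjection h.orthonormal
  have hQQ : Q * Q = Q := hQ.isIdempotentElem.eq
  have hQn : ‖Q‖ ≤ 1 := hQ.norm_le
  have hPn : ‖P‖ ≤ 1 := hP.norm_le
  have hrank : Module.finrank ℂ (LinearMap.range (Q : K →ₗ[ℂ] K)) = d :=
    finrank_range_lowEnergyProjection h.orthonormal
  have : FiniteDimensional ℂ (LinearMap.range (Q : K →ₗ[ℂ] K)) := by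
    have hle : LinearMap.range (Q : K →ₗ[ℂ] K) ≤ Submodule.span ℂ (Set.range φ) := by
      rintro _ ⟨x, rfl⟩
      change lowEnergyProjection φ x ∈ _
      rw [lowEnergyProjection_apply]
      exact Submodule.sum_mem _ fun i _ =>
        Submodule.smul_mem _ _ (Submodule.subset_span ⟨i, rfl⟩)
    have : FiniteDimensional ℂ (Submodule.span ℂ (Set.range φ)) :=
      FiniteDimensional.span_of_finite ℂ (Set.finite_range φ)
    exact Submodule.finiteDimensional_of_le hle
  have hQP : ‖Q - P * Q‖ ≤ 2 * κ :=
    (norm_lowEnergyProjection_sub_le hA hWa hP hAP hgap hd h).trans (by linarith)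
  have hPQ : ‖P - P * Q‖ ≤ 4 * κ := by
    have := norm_sub_mul_le_of_finrank_eq hP hQ (hrank.trans hd.symm) (by linarith) hQP
    linarith
  have hPQ' : ‖P - Q * P‖ ≤ 4 * κ := by
    have hs : star (P - P * Q) = P - Q * P := by
      rw [star_sub, star_mul, hP.isSelfAdjoint.star_eq, hQ.isSelfAdjoint.star_eq]
    rw [← hs, norm_star]
    exact hPQ
  set G := A₀ + W - (g : ℂ) • (1 : K →L[ℂ] K) with hG
  set B := shiftedEffectiveHamiltonian E φ g with hB
  have hBG : B = G * Q := by
    rw [hB, shiftedEffectiveHamiltonian, effectiveHamiltonian_eq_mul h, hG, sub_mul, smul_mul_assoc,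
      one_mul]
  have hGQ : Commute G Q :=
    (commute_lowEnergyProjection (hA.add hWa) h).sub_left ((Commute.one_left Q).smul_left _)
  have hBG' : B = Q * G := by rw [hBG, hGQ.eq]
  have hBQ : B * Q = B := by rw [hBG, mul_assoc, hQQ]
  have hBu : B * u * Q = Q * (t • T + e) * Q := by rw [hBG', mul_assoc Q G u, hu]
  have hsand : ∀ Z : K →L[ℂ] K, ‖Q * Z * Q‖ ≤ ‖Z‖ := fun Z =>
    calc ‖Q * Z * Q‖ ≤ ‖Q‖ * ‖Z‖ * ‖Q‖ := norm_mul₃_le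
      _ ≤ 1 * ‖Z‖ * 1 := by gcongr
      _ = ‖Z‖ := by ring
  have hBun : ‖B * u * Q‖ ≤ ‖t‖ * ‖T‖ + ‖e‖ := by
    rw [hBu]
    refine (hsand _).trans ((norm_add_le _ _).trans ?_)
    rw [norm_smul]
  have hdiff : ‖B - B * u * Q‖ ≤ ‖B‖ * (3 * κ) := by
    have h1 : B - B * u * Q = B * (Q * (Q - P * Q) - Q * (u - P) * Q) := by
      have h2 : B * (Q * (Q - P * Q) - Q * (u - P) * Q) =
          (B * Q) * Q - (B * Q) * P * Q - ((B * Q) * u * Q - (B * Q) * P * Q) := by noncomm_ring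
      rw [h2, hBQ, hBQ]; abel
    rw [h1]
    refine (norm_mul_le _ _).trans ?_
    gcongr
    calc ‖Q * (Q - P * Q) - Q * (u - P) * Q‖ ≤ ‖Q * (Q - P * Q)‖ + ‖Q * (u - P) * Q‖ :=
          norm_sub_le _ _
      _ ≤ 1 * (2 * κ) + κ := by
          gcongr
          · exact (norm_mul_le _ _).trans (by gcongr)
          · exact (hsand _).trans huκ
      _ = 3 * κ := by ring
  have hBn : ‖B‖ ≤ 2 * (‖t‖ * ‖T‖ + ‖e‖) := by
    have h1 : ‖B‖ ≤ ‖B - B * u * Q‖ + ‖B * u * Q‖ := by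
      simpa using norm_add_le (B - B * u * Q) (B * u * Q)
    nlinarith [norm_nonneg B]
  have hTQ : ‖Q * T * Q - T‖ ≤ 8 * κ * ‖T‖ := by
    have hPP : P * P = P := hP.isIdempotentElem.eq
    have h1 : Q * T * Q - T = -((P - Q * P) * T * P) - Q * P * T * (P - P * Q) := by
      have h2 : -((P - Q * P) * T * P) - Q * P * T * (P - P * Q) =
          Q * (P * T * P) * Q - P * T * P := by noncomm_ring
      rw [h2, ← hT]
    rw [h1]
    calc ‖-((P - Q * P) * T * P) - Q * P * T * (P - P * Q)‖
        ≤ ‖(P - Q * P) * T * P‖ + ‖Q * P * T * (P - P * Q)‖ := by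
          refine (norm_sub_le _ _).trans ?_
          rw [norm_neg]
      _ ≤ (4 * κ) * ‖T‖ * 1 + (1 * 1) * ‖T‖ * (4 * κ) := by
          gcongr
          · exact norm_mul₃_le.trans (by gcongr)
          · refine norm_mul₃_le.trans ?_
            gcongr
            exact (norm_mul_le _ _).trans (by gcongr)
      _ = 8 * κ * ‖T‖ := by ring
  have hdec : B - t • T = (B - B * u * Q) + (t • (Q * T * Q - T) + Q * e * Q) := by
    rw [hBu]
    simp only [mul_add, add_mul, mul_smul_comm, smul_mul_assoc, smul_sub]
    abel
  rw [hdec]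
  calc _ ≤ ‖B - B * u * Q‖ + (‖t • (Q * T * Q - T)‖ + ‖Q * e * Q‖) :=
        (norm_add_le _ _).trans (by gcongr; exact norm_add_le _ _)
    _ ≤ (2 * (‖t‖ * ‖T‖ + ‖e‖)) * (3 * κ) + (‖t‖ * (8 * κ * ‖T‖) + ‖e‖) := by
        gcongr
        · exact hdiff.trans (by gcongr)
        · rw [norm_smul]; gcongr
        · exact hsand e
    _ ≤ _ := by nlinarith [norm_nonneg e, mul_nonneg (norm_nonneg t) (norm_nonneg T)]

/-- The words of the Brillouin–Wigner expansion are self-adjoint. -/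
lemma isSelfAdjoint_word {P V R : K →L[ℂ] K} (hP : IsSelfAdjoint P) (hV : IsSelfAdjoint V)
    (hR : IsSelfAdjoint R) (k : ℕ) : IsSelfAdjoint (P * V * (R * V) ^ k * P) := by
  have h1 : V * (R * V) ^ k = (V * R) ^ k * V := by
    induction k with
    | zero => simp
    | succ k ih => rw [pow_succ, pow_succ, ← mul_assoc, ih]; simp only [mul_assoc]
  rw [IsSelfAdjoint]
  simp only [star_mul, star_pow, hP.star_eq, hV.star_eq, hR.star_eq]
  rw [mul_assoc P V, h1]
  simp only [mul_assoc]

lemma abs_inv_pow_sub_one_le {g : ℝ} (hg : g ∈ Set.Icc (-1 / 2 : ℝ) (1 / 2)) (m : ℕ) :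
    |((1 - g)⁻¹) ^ m - 1| ≤ 2 * m * 2 ^ (m - 1) * |g| := by
  have hpos : 0 < 1 - g := by linarith [hg.2]
  have hy : (1 - g)⁻¹ ≤ 2 := by
    rw [inv_le_comm₀ hpos (by norm_num)]; linarith [hg.2]
  have hy0 : 0 < (1 - g)⁻¹ := inv_pos.2 hpos
  have h1 : |(1 - g)⁻¹ - 1| ≤ 2 * |g| := by
    have : (1 - g)⁻¹ - 1 = (1 - g)⁻¹ * g := by field_simp; ring
    rw [this, abs_mul, abs_of_pos hy0]; gcongr
  have h2 := abs_pow_sub_pow_le (1 - g)⁻¹ 1 m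
  rw [one_pow] at h2
  refine h2.trans ?_
  calc |(1 - g)⁻¹ - 1| * m * max |(1 - g)⁻¹| |1| ^ (m - 1) ≤ (2 * |g|) * m * 2 ^ (m - 1) := by
        gcongr
        rw [abs_of_pos hy0, abs_one]; exact max_le hy (by norm_num)
    _ = _ := by ring

end Perturbation

/-! ### The effective Hamiltonian of a gapped perturbation problem -/

section Perturbation

variable {K : Type*} [NormedAddCommGroup K] [InnerProductSpace ℂ K] [CompleteSpace K]

/-- The scalars in the words of the expansion can be chosen real, and continuous in the energy. -/
lemma exists_continuous_coefficients {P V T : K →L[ℂ] K} {R : ℝ → K →L[ℂ] K} {n : ℕ}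
    (hP : IsStarProjection P) (hP0 : P ≠ 0) (hV : IsSelfAdjoint V) (hT : IsSelfAdjoint T)
    (hRa : ∀ g ∈ Set.Icc (-1 / 2 : ℝ) (1 / 2), IsSelfAdjoint (R g))
    (hRc : ContinuousOn R (Set.Icc (-1 / 2 : ℝ) (1 / 2)))
    (hword : ∀ g ∈ Set.Icc (-1 / 2 : ℝ) (1 / 2), ∀ k < n, ∃ c : ℂ,
      P * V * (R g * V) ^ k * P =
        c • P + (((if k + 1 = n then ((1 - g)⁻¹) ^ (n - 1) else 0 : ℝ)) : ℂ) • T) :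
    ∃ c : ℕ → ℝ → ℝ, (∀ k, ContinuousOn (c k) (Set.Icc (-1 / 2 : ℝ) (1 / 2))) ∧
      ∀ g ∈ Set.Icc (-1 / 2 : ℝ) (1 / 2), ∀ k < n, P * V * (R g * V) ^ k * P =
        (c k g : ℂ) • P + (((if k + 1 = n then ((1 - g)⁻¹) ^ (n - 1) else 0 : ℝ)) : ℂ) • T := by
  obtain ⟨p, hp⟩ : ∃ p, P p ≠ 0 := by
    by_contra hcon
    push Not at hcon
    exact hP0 (ContinuousLinearMap.ext hcon)
  set q : K := P p with hq
  have hPq : P q = q := apply_apply_of_isStarProjection hP p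
  have hqn : (‖q‖ ^ 2 : ℝ) ≠ 0 := by positivity
  set τ : ℕ → ℝ → ℝ := fun k g => if k + 1 = n then ((1 - g)⁻¹) ^ (n - 1) else 0 with hτ
  set Z : ℕ → ℝ → K →L[ℂ] K := fun k g => P * V * (R g * V) ^ k * P - (τ k g : ℂ) • T with hZ
  refine ⟨fun k g => RCLike.re ⟪Z k g q, q⟫_ℂ / ‖q‖ ^ 2, fun k => ?_, fun g hg k hk => ?_⟩
  · have hτc : ContinuousOn (τ k) (Set.Icc (-1 / 2 : ℝ) (1 / 2)) := by
      simp only [hτ]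
      split_ifs
      · refine ContinuousOn.pow (ContinuousOn.inv₀ (by fun_prop) ?_) _
        intro x hx
        have := hx.2
        linarith
      · exact continuousOn_const
    have hZc : ContinuousOn (Z k) (Set.Icc (-1 / 2 : ℝ) (1 / 2)) := by
      refine ContinuousOn.sub ?_ ?_
      · exact ((continuousOn_const.mul ((hRc.mul continuousOn_const).pow k)).mul continuousOn_const)
      · exact (Complex.continuous_ofReal.comp_continuousOn hτc).smul continuousOn_const
    refine ContinuousOn.div_const ?_ _
    have hZq : ContinuousOn (fun g => Z k g q) (Set.Icc (-1 / 2 : ℝ) (1 / 2)) :=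
      hZc.clm_apply continuousOn_const
    exact RCLike.continuous_re.comp_continuousOn (hZq.inner continuousOn_const)
  · obtain ⟨c, hc⟩ := hword g hg k hk
    have hZg : Z k g = c • P := by
      simp only [hZ, hτ]; rw [hc]; abel
    have hsa : IsSelfAdjoint (c • P) := by
      rw [← hZg]
      refine (isSelfAdjoint_word hP.isSelfAdjoint hV (hRa g hg) k).sub ?_
      rw [IsSelfAdjoint, star_smul, hT.star_eq]
      congr 1
      exact Complex.conj_ofReal _
    have hcc : (starRingEnd ℂ) c = c := by
      have h1 : (starRingEnd ℂ) c • P = c • P := by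
        have := hsa.star_eq
        rwa [star_smul, hP.isSelfAdjoint.star_eq] at this
      exact smul_left_injective ℂ hP0 h1
    have hcr : ((c.re : ℝ) : ℂ) = c := Complex.conj_eq_iff_re.1 hcc
    have hval : RCLike.re ⟪Z k g q, q⟫_ℂ / ‖q‖ ^ 2 = c.re := by
      rw [hZg]
      change RCLike.re ⟪c • P q, q⟫_ℂ / ‖q‖ ^ 2 = c.re
      rw [hPq, inner_smul_left, hcc, ← hcr]
      have h1 : RCLike.re ((c.re : ℂ) * ⟪q, q⟫_ℂ) = c.re * RCLike.re ⟪q, q⟫_ℂ :=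
        Complex.re_ofReal_mul _ _
      have h2 : RCLike.re ⟪q, q⟫_ℂ = ‖q‖ ^ 2 := inner_self_eq_norm_sq q
      rw [h1, h2, Complex.ofReal_re]
      field_simp
    simp only [hval, hcr]
    exact hc

/-- For small `λ`, the self-consistency equation `g = ∑ k, λ (-λ)^k c_k(g)` of the
Brillouin–Wigner expansion has a solution of first order. -/
lemma exists_selfConsistent_energy {c : ℕ → ℝ → ℝ}
    (hc : ∀ k, ContinuousOn (c k) (Set.Icc (-1 / 2 : ℝ) (1 / 2))) (n : ℕ) :
    ∃ D : ℝ, 0 ≤ D ∧ ∀ lam : ℝ, |lam| ≤ 1 → |lam| * D ≤ 1 / 2 →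
      ∃ g ∈ Set.Icc (-1 / 2 : ℝ) (1 / 2), |g| ≤ |lam| * D ∧
        ∑ k ∈ Finset.range n, lam * (-lam) ^ k * c k g = g := by
  choose D hD using fun k => isCompact_Icc.exists_bound_of_continuousOn (hc k)
  have hD0 : ∀ k, 0 ≤ D k := fun k =>
    (norm_nonneg _).trans (hD k 0 ⟨by norm_num, by norm_num⟩)
  refine ⟨∑ k ∈ Finset.range n, D k, Finset.sum_nonneg fun k _ => hD0 k, fun lam h1 h2 => ?_⟩
  have hbound : ∀ g ∈ Set.Icc (-1 / 2 : ℝ) (1 / 2),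
      |∑ k ∈ Finset.range n, lam * (-lam) ^ k * c k g| ≤ |lam| * ∑ k ∈ Finset.range n, D k := by
    intro g hg
    rw [Finset.mul_sum]
    refine (Finset.abs_sum_le_sum_abs _ _).trans (Finset.sum_le_sum fun k _ => ?_)
    rw [abs_mul, abs_mul, abs_pow, abs_neg]
    calc |lam| * |lam| ^ k * |c k g| ≤ |lam| * 1 * D k := by
          gcongr
          · exact pow_le_one₀ (abs_nonneg _) h1
          · exact hD k g hg
      _ = _ := by ring
  obtain ⟨g, hg, hfix⟩ := exists_mem_Icc_isFixedPt_of_mapsTo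
    (f := fun g => ∑ k ∈ Finset.range n, lam * (-lam) ^ k * c k g)
    (a := (-1 / 2 : ℝ)) (b := 1 / 2)
    (continuousOn_finsetSum _ fun k _ => continuousOn_const.mul (hc k)) (by norm_num)
    (fun g hg => by
      have := abs_le.1 ((hbound g hg).trans h2)
      exact ⟨by linarith, by linarith⟩)
  refine ⟨g, hg, ?_, hfix⟩
  have := hbound g hg
  rwa [show ∑ k ∈ Finset.range n, lam * (-lam) ^ k * c k g = g from hfix] at this

/-- Perturbation theory to order `n` for a degenerate ground state of energy zero, separated by a
gap: if the words `P V (R V)^k P` of order `k + 1 < n` are scalars, then the effective Hamiltonian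
is given by the non-scalar part `T` of the word of order `n`. -/
theorem effectiveHamiltonian_of_words {A₀ P V T : K →L[ℂ] K} {R : ℝ → K →L[ℂ] K} {n d : ℕ}
    (hn : n ≠ 0) (hA : IsSelfAdjoint A₀) (hP : IsStarProjection P) (hP0 : P ≠ 0)
    (hV : IsSelfAdjoint V) (hTa : IsSelfAdjoint T) (hT : T = P * T * P) (hAP : A₀ * P = 0)
    (hgap : ∀ x, ‖x - P x‖ ^ 2 ≤ A₀.reApplyInnerSelf x)
    [FiniteDimensional ℂ (LinearMap.range (P : K →ₗ[ℂ] K))]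
    (hd : Module.finrank ℂ (LinearMap.range (P : K →ₗ[ℂ] K)) = d)
    (hRa : ∀ g ∈ Set.Icc (-1 / 2 : ℝ) (1 / 2), IsSelfAdjoint (R g))
    (hRc : ContinuousOn R (Set.Icc (-1 / 2 : ℝ) (1 / 2)))
    (hR : ∀ g ∈ Set.Icc (-1 / 2 : ℝ) (1 / 2), (A₀ - (g : ℂ) • (1 : K →L[ℂ] K)) * R g = 1 - P)
    (hword : ∀ g ∈ Set.Icc (-1 / 2 : ℝ) (1 / 2), ∀ k < n, ∃ c : ℂ,
      P * V * (R g * V) ^ k * P =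
        c • P + (((if k + 1 = n then ((1 - g)⁻¹) ^ (n - 1) else 0 : ℝ)) : ℂ) • T) :
    ∃ f : ℝ → ℝ, ∃ lam₀ > (0 : ℝ), ∃ C : ℝ, ∀ lam : ℝ, |lam| < lam₀ →
      (∃ (E : Fin d → ℝ) (φ : Fin d → K), IsLowestEigensystem (A₀ + (lam : ℂ) • V) E φ) ∧
      ∀ (E : Fin d → ℝ) (φ : Fin d → K), IsLowestEigensystem (A₀ + (lam : ℂ) • V) E φ →
        ‖shiftedEffectiveHamiltonian E φ (f lam) - ((-1 : ℂ) ^ (n - 1) * (lam : ℂ) ^ n) • T‖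
          ≤ C * |lam| ^ (n + 1) := by
  obtain ⟨c, hcc, hcw⟩ := exists_continuous_coefficients hP hP0 hV hTa hRa hRc hword
  obtain ⟨D, hD0, hD⟩ := exists_selfConsistent_energy hcc n
  obtain ⟨CR, hCR⟩ := isCompact_Icc.exists_bound_of_continuousOn hRc
  have hCR0 : 0 ≤ CR := (norm_nonneg _).trans (hCR 0 ⟨by norm_num, by norm_num⟩)
  have hPn : ‖P‖ ≤ 1 := hP.norm_le
  set ρ : ℝ := CR * ‖V‖ with hρ
  have hρ0 : 0 ≤ ρ := by positivity
  set m : ℝ := ‖V‖ + ∑ k ∈ Finset.range n, ρ ^ (k + 1) with hm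
  have hsum0 : 0 ≤ ∑ k ∈ Finset.range n, ρ ^ (k + 1) := Finset.sum_nonneg fun k _ => by positivity
  have hm0 : 0 ≤ m := by positivity
  set C₁ : ℝ := 2 * (n - 1 : ℕ) * 2 ^ (n - 1 - 1) with hC₁
  have hC₁0 : 0 ≤ C₁ := by positivity
  set lam₀ : ℝ := 1 / (1 + 16 * m + 2 * D) with hlam₀
  have hden : 0 < 1 + 16 * m + 2 * D := by positivity
  -- the three smallness conditions on `λ`
  have hsmall : ∀ lam : ℝ, |lam| < lam₀ → |lam| ≤ 1 ∧ |lam| * D ≤ 1 / 2 ∧ |lam| * m ≤ 1 / 16 := by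
    intro lam hlam
    rw [hlam₀, lt_div_iff₀ hden] at hlam
    have h0 := abs_nonneg lam
    have h1 := mul_nonneg h0 hm0
    have h2 := mul_nonneg h0 hD0
    refine ⟨?_, ?_, ?_⟩ <;> nlinarith
  have hsol : ∀ lam : ℝ, ∃ g : ℝ, |lam| < lam₀ → g ∈ Set.Icc (-1 / 2 : ℝ) (1 / 2) ∧
      |g| ≤ |lam| * D ∧ ∑ k ∈ Finset.range n, lam * (-lam) ^ k * c k g = g := by
    intro lam
    by_cases h : |lam| < lam₀
    · obtain ⟨g, h1, h2, h3⟩ := hD lam (hsmall lam h).1 (hsmall lam h).2.1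
      exact ⟨g, fun _ => ⟨h1, h2, h3⟩⟩
    · exact ⟨0, fun h' => absurd h' h⟩
  choose f hf using hsol
  refine ⟨f, lam₀, by positivity, 14 * m * ‖T‖ + 2 * (C₁ * D * ‖T‖ + ‖V‖ * ρ ^ n),
    fun lam hlam => ?_⟩
  obtain ⟨hl1, hlD, hlm⟩ := hsmall lam hlam
  obtain ⟨hg, hgl, hgfix⟩ := hf lam hlam
  set g := f lam with hgdef
  have hWn : ‖(lam : ℂ) • V‖ = |lam| * ‖V‖ := by
    rw [norm_smul, Complex.norm_real, Real.norm_eq_abs]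
  have hWm : ‖(lam : ℂ) • V‖ ≤ |lam| * m := by
    rw [hWn]; gcongr; rw [hm]; linarith
  have hWa : IsSelfAdjoint ((lam : ℂ) • V) := by
    rw [IsSelfAdjoint, star_smul, hV.star_eq]
    congr 1
    exact Complex.conj_ofReal _
  refine ⟨exists_isLowestEigensystem hA hWa hP hAP hgap (hWm.trans hlm) hd, fun E φ hE => ?_⟩
  have hXn : ∀ k, ‖(R g * V) ^ k * P‖ ≤ ρ ^ k := by
    intro k
    calc ‖(R g * V) ^ k * P‖ ≤ ‖(R g * V) ^ k‖ * ‖P‖ := norm_mul_le _ _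
      _ ≤ ρ ^ k * 1 := by
        gcongr
        have h1 : ‖R g * V‖ ≤ ρ := (norm_mul_le _ _).trans (by
          rw [hρ]; gcongr; exact hCR g hg)
        rcases Nat.eq_zero_or_pos k with rfl | hk
        · rw [pow_zero, pow_zero]
          exact ContinuousLinearMap.norm_id_le
        · exact (norm_pow_le' _ hk).trans (by gcongr)
      _ = ρ ^ k := mul_one _
  set u : K →L[ℂ] K := ∑ k ∈ Finset.range (n + 1), (-(lam : ℂ)) ^ k • ((R g * V) ^ k * P) with hu
  set s : ℝ := ((1 - g)⁻¹) ^ (n - 1) with hs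
  set t : ℂ := (-1 : ℂ) ^ (n - 1) * (lam : ℂ) ^ n with ht
  have hnegn : ∀ k, ‖(-(lam : ℂ)) ^ k‖ = |lam| ^ k := by
    intro k
    rw [norm_pow, norm_neg, Complex.norm_real, Real.norm_eq_abs]
  have htn : ‖t‖ = |lam| ^ n := by
    rw [ht, norm_mul, norm_pow, norm_neg, norm_one, one_pow, one_mul, norm_pow, Complex.norm_real,
      Real.norm_eq_abs]
  have huP : ‖u - P‖ ≤ |lam| * m := by
    rw [hu, Finset.sum_range_succ']
    simp only [pow_zero, one_mul, one_smul, add_sub_cancel_right]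
    refine (norm_sum_le _ _).trans ?_
    calc ∑ k ∈ Finset.range n, ‖(-(lam : ℂ)) ^ (k + 1) • ((R g * V) ^ (k + 1) * P)‖
        ≤ ∑ k ∈ Finset.range n, |lam| * ρ ^ (k + 1) := by
          refine Finset.sum_le_sum fun k _ => ?_
          rw [norm_smul, hnegn]
          gcongr
          · rw [pow_succ]
            exact mul_le_of_le_one_left (abs_nonneg _) (pow_le_one₀ (abs_nonneg _) hl1)
          · exact hXn _
      _ = |lam| * ∑ k ∈ Finset.range n, ρ ^ (k + 1) := by rw [Finset.mul_sum]
      _ ≤ |lam| * m := by gcongr; rw [hm]; linarith [norm_nonneg V]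
  set e : K →L[ℂ] K := (t * ((s : ℂ) - 1)) • T +
    ((lam : ℂ) * (-(lam : ℂ)) ^ n) • (V * (R g * V) ^ n * P) with he
  have hint : (A₀ + (lam : ℂ) • V - (g : ℂ) • (1 : K →L[ℂ] K)) * u = t • T + e := by
    rw [hu, brillouinWigner hAP (hR g hg) (lam : ℂ) n]
    have h1 : ∑ k ∈ Finset.range n,
        ((lam : ℂ) * (-(lam : ℂ)) ^ k) • (P * V * (R g * V) ^ k * P) =
        (g : ℂ) • P + (t * (s : ℂ)) • T := by
      have h2 : ∀ k ∈ Finset.range n,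
          ((lam : ℂ) * (-(lam : ℂ)) ^ k) • (P * V * (R g * V) ^ k * P) =
          ((lam * (-lam) ^ k * c k g : ℝ) : ℂ) • P +
            (if k = n - 1 then (t * (s : ℂ)) • T else 0) := by
        intro k hk
        rw [hcw g hg k (Finset.mem_range.1 hk), smul_add, smul_smul, smul_smul]
        congr 1
        · push_cast; rfl
        · by_cases hkn : k + 1 = n
          · have hk' : k = n - 1 := by omega
            rw [if_pos hkn, if_pos hk', ht]
            congr 1
            rw [hs, hk', neg_eq_neg_one_mul, mul_pow]
            obtain ⟨j, rfl⟩ : ∃ j, n = j + 1 := ⟨n - 1, by omega⟩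
            simp only [Nat.add_sub_cancel]
            push_cast
            ring
          · have hk' : k ≠ n - 1 := by omega
            rw [if_neg hkn, if_neg hk']; simp
      rw [Finset.sum_congr rfl h2, Finset.sum_add_distrib, ← Finset.sum_smul, ← Complex.ofReal_sum,
        hgfix, Finset.sum_ite_eq' (Finset.range n), if_pos (Finset.mem_range.2 (by omega))]
    rw [h1, he]
    module
  have hen : ‖e‖ ≤ (C₁ * D * ‖T‖ + ‖V‖ * ρ ^ n) * |lam| ^ (n + 1) := by
    have h1 : ‖(s : ℂ) - 1‖ ≤ C₁ * (|lam| * D) := by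
      have h2 : ((s : ℂ) - 1) = ((s - 1 : ℝ) : ℂ) := by push_cast; rfl
      rw [h2, Complex.norm_real, Real.norm_eq_abs]
      exact (abs_inv_pow_sub_one_le hg (n - 1)).trans (by rw [hC₁]; gcongr)
    rw [he]
    refine (norm_add_le _ _).trans ?_
    rw [norm_smul, norm_smul, norm_mul t, norm_mul (lam : ℂ), htn, hnegn, Complex.norm_real,
      Real.norm_eq_abs, mul_assoc V]
    calc _ ≤ |lam| ^ n * (C₁ * (|lam| * D)) * ‖T‖ + |lam| * |lam| ^ n * (‖V‖ * ρ ^ n) := by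
          gcongr
          exact (norm_mul_le _ _).trans (by gcongr; exact hXn n)
      _ = _ := by ring
  have hmain := norm_shiftedEffectiveHamiltonian_sub_le hA hWa hP hAP hgap hd hE hT hlm hWm huP hint
  refine hmain.trans ?_
  rw [htn]
  calc 14 * (|lam| * m) * (|lam| ^ n * ‖T‖) + 2 * ‖e‖
      ≤ 14 * (|lam| * m) * (|lam| ^ n * ‖T‖) +
        2 * ((C₁ * D * ‖T‖ + ‖V‖ * ρ ^ n) * |lam| ^ (n + 1)) := by gcongr
    _ = _ := by ring

end Perturbation

/-! ### The number operator of commuting projections -/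

section SpectralFamily

variable {A : Type*} [Ring A]

/-- For a list `l` of commuting idempotents, `defectProj l m` is the idempotent onto the common
eigenspace on which exactly `m` of them vanish. -/
def defectProj : List A → ℕ → A
  | [], 0 => 1
  | [], _ + 1 => 0
  | q :: l, 0 => q * defectProj l 0
  | q :: l, m + 1 => q * defectProj l (m + 1) + (1 - q) * defectProj l m

/-- The number `∑ q, (1 - q)` of idempotents of the list which vanish. -/
def defectNumber (l : List A) : A := (l.map fun q => 1 - q).sum

lemma defectProj_zero (l : List A) : defectProj l 0 = l.prod := by
  induction l with
  | nil => rfl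
  | cons q l ih => rw [defectProj, ih, List.prod_cons]

lemma sum_defectProj (l : List A) : ∀ N, l.length ≤ N →
    ∑ m ∈ Finset.range (N + 1), defectProj l m = 1 := by
  induction l with
  | nil =>
    intro N _
    rw [Finset.sum_range_succ']
    simp [defectProj]
  | cons q l ih =>
    intro N hN
    obtain ⟨N, rfl⟩ : ∃ M, N = M + 1 := ⟨N - 1, by simp at hN; omega⟩
    have hN' : l.length ≤ N := by simpa using hN
    have h1 := ih (N + 1) (by omega)
    have h2 := ih N hN'
    rw [Finset.sum_range_succ'] at h1
    rw [Finset.sum_range_succ']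
    simp only [defectProj]
    rw [Finset.sum_add_distrib, ← Finset.mul_sum, ← Finset.mul_sum, h2, add_right_comm, ← mul_add,
      h1]
    noncomm_ring

lemma commute_defectProj {l : List A} {a : A} (h : ∀ q ∈ l, Commute a q) (m : ℕ) :
    Commute a (defectProj l m) := by
  induction l generalizing m with
  | nil => cases m <;> simp [defectProj]
  | cons q l ih =>
    have hq := h q (by simp)
    have hl := ih fun q hq => h q (by simp [hq])
    cases m with
    | zero => exact hq.mul_right (hl 0)
    | succ m =>
      exact (hq.mul_right (hl _)).add_right (((Commute.one_right a).sub_right hq).mul_right (hl m))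

lemma commute_defectNumber {l : List A} {a : A} (h : ∀ q ∈ l, Commute a q) :
    Commute a (defectNumber l) := by
  induction l with
  | nil => simp [defectNumber]
  | cons q l ih =>
    have hl := ih fun q hq => h q (by simp [hq])
    simp only [defectNumber, List.map_cons, List.sum_cons] at hl ⊢
    exact ((Commute.one_right a).sub_right (h q (by simp))).add_right hl

lemma defectNumber_mul_defectProj {l : List A} (hi : ∀ q ∈ l, q * q = q)
    (hc : ∀ q ∈ l, ∀ r ∈ l, Commute q r) (m : ℕ) :
    defectNumber l * defectProj l m = m • defectProj l m := by
  induction l generalizing m with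
  | nil => cases m <;> simp [defectProj, defectNumber]
  | cons q l ih =>
    have ih := ih (fun q hq => hi q (by simp [hq]))
      (fun q hq r hr => hc q (by simp [hq]) r (by simp [hr]))
    have hq : q * q = q := hi q (by simp)
    have hN : Commute q (defectNumber l) :=
      commute_defectNumber fun r hr => hc q (by simp) r (by simp [hr])
    have hcons : defectNumber (q :: l) = (1 - q) + defectNumber l := by simp [defectNumber]
    have h0 : (1 - q) * q = 0 := by rw [sub_mul, hq, one_mul, sub_self]
    have h1 : (1 - q) * (1 - q) = 1 - q := by rw [mul_sub, h0, mul_one, sub_zero]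
    have hN' : Commute (1 - q) (defectNumber l) := (Commute.one_left _).sub_left hN
    have e1 : ∀ k, defectNumber (q :: l) * (q * defectProj l k) = k • (q * defectProj l k) := by
      intro k
      rw [hcons, add_mul, ← mul_assoc, h0, zero_mul, zero_add, ← mul_assoc, ← hN.eq, mul_assoc, ih,
        mul_smul_comm]
    have e2 : ∀ k, defectNumber (q :: l) * ((1 - q) * defectProj l k) =
        (k + 1) • ((1 - q) * defectProj l k) := by
      intro k
      rw [hcons, add_mul, ← mul_assoc, h1, ← mul_assoc (defectNumber l), ← hN'.eq, mul_assoc, ih,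
        mul_smul_comm, add_smul, one_smul, add_comm]
    cases m with
    | zero => exact e1 0
    | succ m => rw [defectProj, mul_add, e1, e2, smul_add]

lemma defectProj_smul_mem {X : Type*} [AddCommGroup X] [Module A X] {S : AddSubgroup X}
    {l : List A} (h : ∀ q ∈ l, ∀ x ∈ S, q • x ∈ S) (m : ℕ) {x : X} (hx : x ∈ S) :
    defectProj l m • x ∈ S := by
  induction l generalizing m with
  | nil => cases m <;> simp [defectProj, hx]
  | cons q l ih =>
    have hq := h q (by simp)
    have hl := ih fun q hq => h q (by simp [hq])
    cases m with
    | zero =>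
      rw [defectProj, mul_smul]
      exact hq _ (hl 0)
    | succ m =>
      rw [defectProj, add_smul, mul_smul, mul_smul, sub_smul, one_smul]
      exact S.add_mem (hq _ (hl _)) (S.sub_mem (hl m) (hq _ (hl m)))

end SpectralFamily

section SpectralFamilyOperator

variable {K : Type*} [NormedAddCommGroup K] [InnerProductSpace ℂ K]

lemma defectNumber_mul_prod {l : List (K →L[ℂ] K)} (hi : ∀ q ∈ l, q * q = q)
    (hc : ∀ q ∈ l, ∀ r ∈ l, Commute q r) : defectNumber l * l.prod = 0 := by
  rw [← defectProj_zero, defectNumber_mul_defectProj hi hc, zero_smul]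

/-- The reduced resolvent of the number operator `∑ q, (1 - q)` of a list of commuting projections:
the inverse of `∑ q, (1 - q) - g` off the common range, and zero on the common range. -/
def reducedResolvent (l : List (K →L[ℂ] K)) (g : ℝ) : K →L[ℂ] K :=
  ∑ m ∈ Finset.range l.length, (((m + 1 - g)⁻¹ : ℝ) : ℂ) • defectProj l (m + 1)

lemma natCast_succ_sub_pos {g : ℝ} (hg : g ∈ Set.Icc (-1 / 2 : ℝ) (1 / 2)) (m : ℕ) :
    (0 : ℝ) < m + 1 - g := by
  have := hg.2
  have : (0 : ℝ) ≤ m := Nat.cast_nonneg m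
  linarith

lemma sub_mul_reducedResolvent {l : List (K →L[ℂ] K)} (hi : ∀ q ∈ l, q * q = q)
    (hc : ∀ q ∈ l, ∀ r ∈ l, Commute q r) {g : ℝ} (hg : g ∈ Set.Icc (-1 / 2 : ℝ) (1 / 2)) :
    (defectNumber l - (g : ℂ) • (1 : K →L[ℂ] K)) * reducedResolvent l g = 1 - l.prod := by
  have h1 := sum_defectProj l l.length le_rfl
  rw [Finset.sum_range_succ', defectProj_zero] at h1
  rw [← eq_sub_of_add_eq h1, reducedResolvent, Finset.mul_sum]
  refine Finset.sum_congr rfl fun m _ => ?_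
  have hpos := (natCast_succ_sub_pos hg m).ne'
  rw [mul_smul_comm, sub_mul, smul_mul_assoc, one_mul, defectNumber_mul_defectProj hi hc,
    ← Nat.cast_smul_eq_nsmul ℂ, ← sub_smul, smul_smul]
  have : (((m + 1 - g)⁻¹ : ℝ) : ℂ) * (((m + 1 : ℕ) : ℂ) - (g : ℂ)) = 1 := by
    have h2 : (((m + 1 : ℕ) : ℂ) - (g : ℂ)) = ((m + 1 - g : ℝ) : ℂ) := by push_cast; rfl
    rw [h2, ← Complex.ofReal_mul, inv_mul_cancel₀ hpos, Complex.ofReal_one]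
  rw [this, one_smul]

lemma commute_reducedResolvent {l : List (K →L[ℂ] K)} {a : K →L[ℂ] K}
    (h : ∀ q ∈ l, Commute a q) (g : ℝ) : Commute a (reducedResolvent l g) :=
  Commute.sum_right _ _ _ fun m _ => (commute_defectProj h (m + 1)).smul_right _

lemma continuousOn_reducedResolvent (l : List (K →L[ℂ] K)) :
    ContinuousOn (reducedResolvent l) (Set.Icc (-1 / 2 : ℝ) (1 / 2)) := by
  unfold reducedResolvent
  refine continuousOn_finsetSum _ fun m _ => ContinuousOn.fun_smul ?_ continuousOn_const
  refine Complex.continuous_ofReal.comp_continuousOn (ContinuousOn.inv₀ (by fun_prop) ?_)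
  intro g hg
  exact (natCast_succ_sub_pos hg m).ne'

lemma reducedResolvent_smul_mem {H : Type*} [NormedAddCommGroup H] [InnerProductSpace ℂ H]
    {S : Submodule ℂ (H →ₗ[ℂ] K)} {l : List (K →L[ℂ] K)}
    (h : ∀ q ∈ l, ∀ x ∈ S, q • x ∈ S) (g : ℝ) {x : H →ₗ[ℂ] K} (hx : x ∈ S) :
    reducedResolvent l g • x ∈ S := by
  rw [reducedResolvent, Finset.sum_smul]
  exact S.sum_mem fun m _ =>
    S.smul_mem _ (defectProj_smul_mem (S := S.toAddSubgroup) h (m + 1) hx)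

lemma reducedResolvent_mul_sub {l : List (K →L[ℂ] K)} (hi : ∀ q ∈ l, q * q = q)
    (hc : ∀ q ∈ l, ∀ r ∈ l, Commute q r) {g : ℝ} (hg : g ∈ Set.Icc (-1 / 2 : ℝ) (1 / 2)) :
    reducedResolvent l g * (defectNumber l - (g : ℂ) • (1 : K →L[ℂ] K)) = 1 - l.prod := by
  rw [← sub_mul_reducedResolvent hi hc hg]
  have h1 : Commute (defectNumber l) (reducedResolvent l g) :=
    commute_reducedResolvent (fun q hq => (commute_defectNumber fun r hr => hc q hq r hr).symm) g
  exact (h1.sub_left ((Commute.one_left _).smul_left _)).symm.eq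

lemma operator_smul_smul {H : Type*} [NormedAddCommGroup H] [InnerProductSpace ℂ H]
    (T : K →L[ℂ] K) (c : ℂ) (v : H →ₗ[ℂ] K) : T • (c • v) = c • (T • v) :=
  smul_comm _ _ _

/-- On the eigenspace on which exactly one of the projections vanishes, the reduced resolvent is the
scalar `(1 - g)⁻¹`. -/
lemma reducedResolvent_smul_eq {H : Type*} [NormedAddCommGroup H] [InnerProductSpace ℂ H]
    {l : List (K →L[ℂ] K)} (hi : ∀ q ∈ l, q * q = q)
    (hc : ∀ q ∈ l, ∀ r ∈ l, Commute q r) {g : ℝ} (hg : g ∈ Set.Icc (-1 / 2 : ℝ) (1 / 2))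
    {v : H →ₗ[ℂ] K} (hv : defectNumber l • v = v) (hv0 : l.prod • v = 0) :
    reducedResolvent l g • v = (((1 - g)⁻¹ : ℝ) : ℂ) • v := by
  have h1 : reducedResolvent l g • ((defectNumber l - (g : ℂ) • (1 : K →L[ℂ] K)) • v) = v := by
    rw [← mul_smul, reducedResolvent_mul_sub hi hc hg, sub_smul, hv0, one_smul, sub_zero]
  have h2 : (defectNumber l - (g : ℂ) • (1 : K →L[ℂ] K)) • v = ((1 - g : ℝ) : ℂ) • v := by
    have h3 : ((g : ℂ) • (1 : K →L[ℂ] K)) • v = (g : ℂ) • v := rfl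
    rw [sub_smul, hv, h3]
    push_cast
    rw [sub_smul, one_smul]
  rw [h2, operator_smul_smul] at h1
  have hpos : ((1 - g : ℝ) : ℂ) ≠ 0 := by
    have := hg.2
    rw [Ne, Complex.ofReal_eq_zero]
    intro h
    linarith
  conv_rhs => rw [← h1]
  rw [smul_smul, Complex.ofReal_inv, inv_mul_cancel₀ hpos, one_smul]

variable [CompleteSpace K]

lemma isSelfAdjoint_defectProj {l : List (K →L[ℂ] K)} (hs : ∀ q ∈ l, IsStarProjection q)
    (hc : ∀ q ∈ l, ∀ r ∈ l, Commute q r) (m : ℕ) : IsSelfAdjoint (defectProj l m) := by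
  induction l generalizing m with
  | nil =>
    cases m
    · exact .one _
    · exact .zero _
  | cons q l ih =>
    have ih := ih (fun q hq => hs q (by simp [hq]))
      (fun q hq r hr => hc q (by simp [hq]) r (by simp [hr]))
    have hq := (hs q (by simp)).isSelfAdjoint
    have hcq : ∀ k, Commute q (defectProj l k) :=
      commute_defectProj fun r hr => hc q (by simp) r (by simp [hr])
    have h1 : ∀ k, IsSelfAdjoint (q * defectProj l k) := fun k =>
      (hq.commute_iff (ih k)).1 (hcq k)
    have h2 : ∀ k, IsSelfAdjoint ((1 - q) * defectProj l k) := fun k =>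
      (((IsSelfAdjoint.one _).sub hq).commute_iff (ih k)).1
        ((Commute.one_left _).sub_left (hcq k))
    cases m with
    | zero => exact h1 0
    | succ m => exact (h1 _).add (h2 m)

lemma isSelfAdjoint_reducedResolvent {l : List (K →L[ℂ] K)} (hs : ∀ q ∈ l, IsStarProjection q)
    (hc : ∀ q ∈ l, ∀ r ∈ l, Commute q r) (g : ℝ) : IsSelfAdjoint (reducedResolvent l g) := by
  refine isSelfAdjoint_sum _ fun m _ => ?_
  rw [IsSelfAdjoint, star_smul, (isSelfAdjoint_defectProj hs hc (m + 1)).star_eq]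
  congr 1
  exact Complex.conj_ofReal _

lemma isSelfAdjoint_defectNumber {l : List (K →L[ℂ] K)} (hs : ∀ q ∈ l, IsStarProjection q) :
    IsSelfAdjoint (defectNumber l) := by
  induction l with
  | nil => exact .zero _
  | cons q l ih =>
    simp only [defectNumber, List.map_cons, List.sum_cons] at ih ⊢
    exact ((IsSelfAdjoint.one _).sub (hs q (by simp)).isSelfAdjoint).add
      (ih fun q hq => hs q (by simp [hq]))

lemma isStarProjection_list_prod {l : List (K →L[ℂ] K)} (hs : ∀ q ∈ l, IsStarProjection q)
    (hc : ∀ q ∈ l, ∀ r ∈ l, Commute q r) : IsStarProjection l.prod := by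
  induction l with
  | nil => exact .one _
  | cons q l ih =>
    rw [List.prod_cons]
    exact (hs q (by simp)).mul (ih (fun q hq => hs q (by simp [hq]))
      (fun q hq r hr => hc q (by simp [hq]) r (by simp [hr])))
      (Commute.list_prod_right l q fun r hr => hc q (by simp) r (by simp [hr]))

/-- The number operator of commuting projections has a gap `1` above its kernel. -/
lemma one_sub_prod_le_defectNumber {l : List (K →L[ℂ] K)} (hs : ∀ q ∈ l, IsStarProjection q)
    (hc : ∀ q ∈ l, ∀ r ∈ l, Commute q r) : 1 - l.prod ≤ defectNumber l := by
  induction l with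
  | nil => simp [defectNumber]
  | cons q l ih =>
    have hs' : ∀ q ∈ l, IsStarProjection q := fun q hq => hs q (by simp [hq])
    have hc' : ∀ q ∈ l, ∀ r ∈ l, Commute q r :=
      fun q hq r hr => hc q (by simp [hq]) r (by simp [hr])
    have ih := ih hs' hc'
    have hcq : Commute q l.prod :=
      Commute.list_prod_right l q fun r hr => hc q (by simp) r (by simp [hr])
    have hpos : 0 ≤ (1 - q) * (1 - l.prod) :=
      ((hs q (by simp)).one_sub.mul (isStarProjection_list_prod hs' hc').one_sub
        ((Commute.one_left _).sub_left ((Commute.one_right q).sub_right hcq))).nonneg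
    have hcons : defectNumber (q :: l) = (1 - q) + defectNumber l := by simp [defectNumber]
    rw [hcons, List.prod_cons]
    have hexp : (1 - q) + defectNumber l - (1 - q * l.prod) =
        (1 - q) * (1 - l.prod) + (defectNumber l - (1 - l.prod)) := by noncomm_ring
    rw [← sub_nonneg, hexp]
    exact add_nonneg hpos (sub_nonneg.2 ih)

lemma norm_sub_prod_sq_le {l : List (K →L[ℂ] K)} (hs : ∀ q ∈ l, IsStarProjection q)
    (hc : ∀ q ∈ l, ∀ r ∈ l, Commute q r) (x : K) :
    ‖x - l.prod x‖ ^ 2 ≤ (defectNumber l).reApplyInnerSelf x := by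
  have hP := isStarProjection_list_prod hs hc
  have h1 := ((ContinuousLinearMap.le_def _ _).1
    (one_sub_prod_le_defectNumber hs hc)).re_inner_nonneg_left x
  rw [← ContinuousLinearMap.reApplyInnerSelf_apply, reApplyInnerSelf_sub] at h1
  have h2 : (1 - l.prod : K →L[ℂ] K).reApplyInnerSelf x = ‖x - l.prod x‖ ^ 2 := by
    have h3 : RCLike.re ⟪x - l.prod x, x - l.prod x⟫_ℂ = ‖x - l.prod x‖ ^ 2 :=
      inner_self_eq_norm_sq _
    have h4 : ⟪x - l.prod x, l.prod x⟫_ℂ = 0 := by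
      rw [← inner_conj_symm, inner_sub_apply_eq_zero hP]; simp
    rw [← h3, inner_sub_right, h4, sub_zero]
    rfl
  linarith

end SpectralFamilyOperator

/-! ### A single clock -/

section Products

/-- A factor which commutes with all the other factors of an ordered product can be moved into the
factor `α`. -/
lemma mul_prod_map_eq_smul {ι A : Type*} [DecidableEq ι] [Ring A] [Algebra ℂ A] {B : ι → A}
    {Y Z : A} {α : ι} {c : ℂ} (hY : ∀ β, β ≠ α → Commute Y (B β)) (hZ : Y * B α = c • Z)
    {l : List ι} (hl : l.Nodup) (hα : α ∈ l) :
    Y * (l.map B).prod = c • (l.map (Function.update B α Z)).prod := by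
  induction l with
  | nil => simp at hα
  | cons β l ih =>
    rw [List.nodup_cons] at hl
    simp only [List.map_cons, List.prod_cons]
    by_cases hβ : β = α
    · subst hβ
      have h1 : l.map (Function.update B β Z) = l.map B := by
        refine List.map_congr_left fun γ hγ => ?_
        rw [Function.update_of_ne]
        rintro rfl
        exact hl.1 hγ
      rw [Function.update_self, h1, ← mul_assoc, hZ, smul_mul_assoc]
    · have hα' : α ∈ l := by
        rcases List.mem_cons.1 hα with h | h
        · exact absurd h.symm hβ
        · exact h
      rw [Function.update_of_ne hβ, ← mul_assoc, (hY β hβ).eq, mul_assoc, ih hl.2 hα',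
        mul_smul_comm]

lemma mul_prod_ofFn_eq_smul {L : ℕ} {A : Type*} [Ring A] [Algebra ℂ A] {B : Fin L → A} {Y Z : A}
    {α : Fin L} {c : ℂ} (hY : ∀ β, β ≠ α → Commute Y (B β)) (hZ : Y * B α = c • Z) :
    Y * (List.ofFn B).prod = c • (List.ofFn (Function.update B α Z)).prod := by
  rw [List.ofFn_eq_map, List.ofFn_eq_map]
  exact mul_prod_map_eq_smul hY hZ (List.nodup_finRange L) (List.mem_finRange α)

end Products

section SingleClock

variable {H : Type*} [NormedAddCommGroup H] [InnerProductSpace ℂ H]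
variable {n : ℕ} [NeZero n]

/-- The position of the clock after `a` steps forwards. -/
def fwdPos (n : ℕ) [NeZero n] : ℕ → Fin n
  | 0 => 0
  | a + 1 => fwdPos n a + 1

/-- The position of the clock after `a` steps backwards. -/
def bwdPos (n : ℕ) [NeZero n] : ℕ → Fin n
  | 0 => 0
  | a + 1 => bwdPos n a - 1

lemma bwdPos_eq_neg (a : ℕ) : bwdPos n a = -fwdPos n a := by
  induction a with
  | zero => simp [bwdPos, fwdPos]
  | succ a ih => rw [bwdPos, fwdPos, ih]; abel

lemma val_fwdPos (a : ℕ) : (fwdPos n a).val = a % n := by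
  induction a with
  | zero => simp [fwdPos]
  | succ a ih => rw [fwdPos, Fin.val_add, ih, Fin.val_one', ← Nat.add_mod]

lemma fwdPos_val (i : Fin n) : fwdPos n i = i :=
  Fin.ext (by rw [val_fwdPos, Nat.mod_eq_of_lt i.isLt])

lemma fwdPos_ne_zero {a : ℕ} (h0 : a ≠ 0) (hn : a < n) : fwdPos n a ≠ 0 := by
  intro h
  have := congrArg Fin.val h
  rw [val_fwdPos, Nat.mod_eq_of_lt hn, Fin.val_zero] at this
  exact h0 this

lemma bwdPos_ne_zero {a : ℕ} (h0 : a ≠ 0) (hn : a < n) : bwdPos n a ≠ 0 := by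
  rw [bwdPos_eq_neg, neg_ne_zero]
  exact fwdPos_ne_zero h0 hn

lemma fwdPos_self : fwdPos n n = 0 := Fin.ext (by rw [val_fwdPos, Nat.mod_self, Fin.val_zero])

lemma bwdPos_self : bwdPos n n = 0 := by rw [bwdPos_eq_neg, fwdPos_self, neg_zero]

/-- The operator applied on the way of `a` steps backwards, starting in the range of `G`. -/
def bwdOp (M : Fin n → H →L[ℂ] H) (G : H →L[ℂ] H) : ℕ → H →L[ℂ] H
  | 0 => G
  | a + 1 => M (bwdPos n (a + 1)) * bwdOp M G a

lemma bwdOp_eq_mul (M : Fin n → H →L[ℂ] H) (G : H →L[ℂ] H) (a : ℕ) : bwdOp M G a =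
    (List.ofFn fun i : Fin a => M (bwdPos n (a - i))).prod * G := by
  induction a with
  | zero => simp [bwdOp]
  | succ a ih =>
    rw [bwdOp, ih, List.ofFn_succ, List.prod_cons, mul_assoc]
    simp

lemma bwdOp_self (M : Fin n → H →L[ℂ] H) (G : H →L[ℂ] H) : bwdOp M G n =
    (List.ofFn M).prod * G := by
  rw [bwdOp_eq_mul]
  congr 3
  ext1 i
  congr 1
  have h : fwdPos n (n - i) + fwdPos n i = 0 := by
    apply Fin.ext
    rw [Fin.val_add, val_fwdPos, val_fwdPos, ← Nat.add_mod, Nat.sub_add_cancel i.isLt.le,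
      Nat.mod_self, Fin.val_zero]
  rw [bwdPos_eq_neg, eq_neg_of_add_eq_zero_left h, neg_neg, fwdPos_val]

variable [CompleteSpace H]

/-- The relations between the operators `M i` of a single clock and its initial projection `G`
which make every closed walk of winding number zero a scalar. -/
structure ClockRules (M : Fin n → H →L[ℂ] H) (G : H →L[ℂ] H) : Prop where
  idem : G * G = G
  mul_adjoint_mul : ∀ i, PropTo (M i * (M i).adjoint * M i) (M i)
  adjoint_mul_mul : ∀ i, PropTo ((M i).adjoint * M i * (M i).adjoint) (M i).adjoint
  mul_adjoint : ∀ i, PropTo (M i * (M i).adjoint) ((M (i - 1)).adjoint * M (i - 1))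
  adjoint_mul : ∀ i, PropTo ((M i).adjoint * M i) (M (i + 1) * (M (i + 1)).adjoint)
  compress : PropTo (G * (M 0 * (M 0).adjoint * G)) G

/-- The operator applied on the way of `a` steps forwards, starting in the range of `G`. -/
def fwdOp (M : Fin n → H →L[ℂ] H) (G : H →L[ℂ] H) : ℕ → H →L[ℂ] H
  | 0 => G
  | a + 1 => (M (fwdPos n a)).adjoint * fwdOp M G a

/-- `IsClockState M G j i X`: a clock which has never been more than `j` steps away from its start
can be at the position `i` with the operator `X` applied. Up to scalars, the operator depends only
on the lifted position `±a`, except that at the start it can also be `M_0 M_0† G`. -/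
inductive IsClockState (M : Fin n → H →L[ℂ] H) (G : H →L[ℂ] H) (j : ℕ) :
    Fin n → (H →L[ℂ] H) → Prop
  | loop : IsClockState M G j 0 (M 0 * (M 0).adjoint * G)
  | fwd (a : ℕ) (ha : a ≤ j) : IsClockState M G j (fwdPos n a) (fwdOp M G a)
  | bwd (a : ℕ) (ha : a ≤ j) : IsClockState M G j (bwdPos n a) (bwdOp M G a)

variable {M : Fin n → H →L[ℂ] H} {G X : H →L[ℂ] H} {i : Fin n} {j k : ℕ}

lemma IsClockState.ground (M : Fin n → H →L[ℂ] H) (G : H →L[ℂ] H) (j : ℕ) :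
    IsClockState M G j 0 G := .fwd 0 (Nat.zero_le j)

lemma IsClockState.mono (hjk : j ≤ k) (h : IsClockState M G j i X) : IsClockState M G k i X := by
  cases h with
  | loop => exact .loop
  | fwd a ha => exact .fwd a (ha.trans hjk)
  | bwd a ha => exact .bwd a (ha.trans hjk)

lemma IsClockState.eq_of_zero (h : IsClockState M G j 0 X) (hj : j < n) :
    X = G ∨ X = M 0 * (M 0).adjoint * G := by
  generalize hi : (0 : Fin n) = i at h
  cases h with
  | loop => exact Or.inr rfl
  | fwd a ha =>
    by_cases h0 : a = 0
    · subst h0; exact Or.inl rfl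
    · exact absurd hi.symm (fwdPos_ne_zero h0 (by omega))
  | bwd a ha =>
    by_cases h0 : a = 0
    · subst h0; exact Or.inl rfl
    · exact absurd hi.symm (bwdPos_ne_zero h0 (by omega))

lemma IsClockState.compress (hr : ClockRules M G) (h : IsClockState M G j 0 X) (hj : j < n) :
    ∃ c : ℂ, G * X = c • G := by
  rcases h.eq_of_zero hj with rfl | rfl
  · exact ⟨1, by rw [hr.idem, one_smul]⟩
  · exact hr.compress

/-- A step backwards after a step forwards is a step of the shorter walk. -/
lemma exists_bwd_fwdOp (hr : ClockRules M G) (a : ℕ) : ∃ (c : ℂ) (Z : H →L[ℂ] H),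
    M (fwdPos n (a + 1) - 1) * fwdOp M G (a + 1) = c • Z ∧
      IsClockState M G (a + 1) (fwdPos n (a + 1) - 1) Z := by
  have hpos : fwdPos n (a + 1) - 1 = fwdPos n a := by rw [fwdPos, add_sub_cancel_right]
  rw [hpos, fwdOp, ← mul_assoc]
  cases a with
  | zero => exact ⟨1, _, (one_smul _ _).symm, .loop⟩
  | succ b =>
    obtain ⟨c, hc⟩ := hr.mul_adjoint (fwdPos n (b + 1))
    obtain ⟨c', hc'⟩ := hr.adjoint_mul_mul (fwdPos n b)
    have hpos' : fwdPos n (b + 1) - 1 = fwdPos n b := by rw [fwdPos, add_sub_cancel_right]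
    refine ⟨c * c', fwdOp M G (b + 1), ?_, .fwd _ (by omega)⟩
    rw [hc, hpos', fwdOp, smul_mul_assoc, ← mul_assoc, hc', smul_mul_assoc, smul_smul]

/-- A step forwards after a step backwards is a step of the shorter walk. -/
lemma exists_fwd_bwdOp (hr : ClockRules M G) (a : ℕ) : ∃ (c : ℂ) (Z : H →L[ℂ] H),
    (M (bwdPos n (a + 1))).adjoint * bwdOp M G (a + 1) = c • Z ∧
      IsClockState M G (a + 1) (bwdPos n (a + 1) + 1) Z := by
  have hpos : bwdPos n (a + 1) + 1 = bwdPos n a := by rw [bwdPos, sub_add_cancel]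
  obtain ⟨c, hc⟩ := hr.adjoint_mul (bwdPos n (a + 1))
  rw [hpos] at hc
  rw [hpos, bwdOp, ← mul_assoc, hc]
  cases a with
  | zero => exact ⟨c, _, smul_mul_assoc _ _ _, .loop⟩
  | succ b =>
    obtain ⟨c', hc'⟩ := hr.mul_adjoint_mul (bwdPos n (b + 1))
    refine ⟨c * c', bwdOp M G (b + 1), ?_, .bwd _ (by omega)⟩
    rw [bwdOp, smul_mul_assoc, ← mul_assoc, hc', smul_mul_assoc, smul_smul]

lemma IsClockState.exists_fwd (hr : ClockRules M G) (h : IsClockState M G j i X) :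
    ∃ (c : ℂ) (Z : H →L[ℂ] H), (M i).adjoint * X = c • Z ∧ IsClockState M G (j + 1) (i + 1) Z := by
  cases h with
  | loop =>
    obtain ⟨c, hc⟩ := hr.adjoint_mul_mul 0
    refine ⟨c, fwdOp M G 1, ?_, .fwd 1 (by omega)⟩
    rw [← mul_assoc, ← mul_assoc, hc, smul_mul_assoc]; rfl
  | fwd a ha => exact ⟨1, fwdOp M G (a + 1), (one_smul _ _).symm, .fwd (a + 1) (by omega)⟩
  | bwd a ha =>
    cases a with
    | zero => exact ⟨1, fwdOp M G 1, (one_smul _ _).symm, .fwd 1 (by omega)⟩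
    | succ a =>
      obtain ⟨c, Z, hZ, hs⟩ := exists_fwd_bwdOp hr a
      exact ⟨c, Z, hZ, hs.mono (by omega)⟩

lemma IsClockState.exists_bwd (hr : ClockRules M G) (h : IsClockState M G j i X) :
    ∃ (c : ℂ) (Z : H →L[ℂ] H), M (i - 1) * X = c • Z ∧ IsClockState M G (j + 1) (i - 1) Z := by
  cases h with
  | loop =>
    obtain ⟨c, hc⟩ := hr.mul_adjoint 0
    obtain ⟨c', hc'⟩ := hr.mul_adjoint_mul (0 - 1)
    refine ⟨c * c', bwdOp M G 1, ?_, .bwd 1 (by omega)⟩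
    rw [hc, smul_mul_assoc, mul_smul_comm, ← mul_assoc, ← mul_assoc, hc', smul_mul_assoc, smul_smul]
    rfl
  | bwd a ha => exact ⟨1, bwdOp M G (a + 1), (one_smul _ _).symm, .bwd (a + 1) (by omega)⟩
  | fwd a ha =>
    cases a with
    | zero => exact ⟨1, bwdOp M G 1, (one_smul _ _).symm, .bwd 1 (by omega)⟩
    | succ a =>
      obtain ⟨c, Z, hZ, hs⟩ := exists_bwd_fwdOp hr a
      exact ⟨c, Z, hZ, hs.mono (by omega)⟩

lemma IsClockState.commute {Y : H →L[ℂ] H} (hG : Commute Y G)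
    (hM : ∀ i, Commute Y (M i)) (hM' : ∀ i, Commute Y (M i).adjoint)
    (h : IsClockState M G j i X) : Commute Y X := by
  cases h with
  | loop => exact ((hM 0).mul_right (hM' 0)).mul_right hG
  | fwd a ha =>
    clear ha
    induction a with
    | zero => exact hG
    | succ a ih => exact (hM' _).mul_right ih
  | bwd a ha =>
    clear ha
    induction a with
    | zero => exact hG
    | succ a ih => exact (hM _).mul_right ih

lemma fwdOp_eq_mul (M : Fin n → H →L[ℂ] H) (G : H →L[ℂ] H) (a : ℕ) : fwdOp M G a =
    (List.ofFn fun i : Fin a => (M (fwdPos n i)).adjoint).reverse.prod * G := by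
  induction a with
  | zero => simp [fwdOp]
  | succ a ih =>
    rw [fwdOp, ih, List.ofFn_succ', List.concat_eq_append, List.reverse_append]
    simp [mul_assoc]

lemma fwdOp_self (M : Fin n → H →L[ℂ] H) (G : H →L[ℂ] H) : fwdOp M G n =
    (List.ofFn fun i => (M i).adjoint).reverse.prod * G := by
  rw [fwdOp_eq_mul]
  simp only [fwdPos_val]

/-- Up to scalars, the `M i` are either partial isometries matching along the cycle, or all zero. -/
lemma clockRules_of_propTo (hG : G * G = G)
    (h_ii : ∀ i, PropTo ((M i * (M i).adjoint) ^ 2) (M i * (M i).adjoint))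
    (h_iii : ∀ i, PropTo (M i * (M i).adjoint) ((M (i - 1)).adjoint * M (i - 1)))
    (h_iv : PropTo (G * M 0 * (M 0).adjoint * G) G) : ClockRules M G := by
  have hcube : ∀ i, PropTo (M i * (M i).adjoint * M i) (M i) := by
    intro i
    obtain ⟨c, hc⟩ := h_ii i
    refine ⟨c, ?_⟩
    -- `D = M M† M - c M` satisfies `D D† = 0`
    rw [← sub_eq_zero, ← CStarRing.mul_star_self_eq_zero_iff]
    have hfac : M i * (M i).adjoint * M i - c • M i = (M i * (M i).adjoint - c • 1) * M i := by
      rw [sub_mul, smul_mul_assoc, one_mul]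
    have hz : (M i * (M i).adjoint - c • 1) * M i * (M i).adjoint = 0 := by
      rw [mul_assoc, sub_mul, smul_mul_assoc, one_mul, ← sq, hc, sub_self]
    rw [hfac, star_mul, ContinuousLinearMap.star_eq_adjoint (M i), ← mul_assoc, hz, zero_mul]
  refine ⟨hG, hcube, fun i => ?_, h_iii, fun i => ?_, ?_⟩
  · obtain ⟨c, hc⟩ := hcube i
    refine ⟨star c, ?_⟩
    have := congrArg star hc
    rw [star_smul, star_mul, star_mul] at this
    simpa only [ContinuousLinearMap.star_eq_adjoint, ContinuousLinearMap.adjoint_adjoint,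
      mul_assoc] using this
  · obtain ⟨c, hc⟩ := h_iii (i + 1)
    rw [add_sub_cancel_right] at hc
    by_cases h0 : c = 0
    · -- if one of the `M i` vanishes, then so do the following ones, hence all of them
      have hzero : ∀ k, M (i + 1 + fwdPos n k) = 0 := by
        intro k
        induction k with
        | zero =>
          rw [fwdPos, add_zero, ← CStarRing.mul_star_self_eq_zero_iff,
            ContinuousLinearMap.star_eq_adjoint, hc, h0, zero_smul]
        | succ k ih =>
          obtain ⟨c', hc'⟩ := h_iii (i + 1 + fwdPos n (k + 1))
          have hpos : i + 1 + fwdPos n (k + 1) - 1 = i + 1 + fwdPos n k := by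
            rw [fwdPos]; abel
          rw [hpos, ih, mul_zero, smul_zero] at hc'
          rw [← CStarRing.mul_star_self_eq_zero_iff, ContinuousLinearMap.star_eq_adjoint, hc']
      have hi : M i = 0 := by
        have h1 := hzero (i - (i + 1) : Fin n)
        rwa [fwdPos_val, add_sub_cancel] at h1
      exact ⟨0, by rw [hi, mul_zero, zero_smul]⟩
    · exact ⟨c⁻¹, by rw [hc, smul_smul, inv_mul_cancel₀ h0, one_smul]⟩
  · simpa only [mul_assoc] using h_iv

end SingleClock

/-! ### The space of the clocks -/

section ClockSpace

variable {L n : ℕ}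

/-- The basis vector `|s 1⟩ ⊗ ⋯ ⊗ |s L⟩` of the clock space. -/
def clockKet (s : Fin L → Fin n) : ClockSpace L n := EuclideanSpace.single s 1

lemma ketBra_clockKet_self (s : Fin L → Fin n) (α : Fin L) (i : Fin n) :
    ketBra α i (s α) (clockKet s) = clockKet (Function.update s α i) := by
  ext r
  simp only [ketBra, clockKet, Matrix.ofLp_toEuclideanCLM, PiLp.ofLp_single,
    Matrix.mulVec_single_one, Matrix.col_apply, Matrix.of_apply, Pi.single_apply, true_and]
  congr 1
  rw [eq_iff_iff, funext_iff]
  constructor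
  · rintro ⟨h1, h2⟩ β
    by_cases hβ : β = α
    · subst hβ; simpa using h1
    · rw [Function.update_of_ne hβ]; exact h2 β hβ
  · intro h
    refine ⟨by simpa using h α, fun β hβ => ?_⟩
    rw [h β, Function.update_of_ne hβ]

lemma ketBra_clockKet_of_ne {s : Fin L → Fin n} {α : Fin L} {j : Fin n} (h : s α ≠ j) (i : Fin n) :
    ketBra α i j (clockKet s) = 0 := by
  ext r
  simp [ketBra, clockKet, Matrix.ofLp_toEuclideanCLM, h]

lemma zeroProj_clockKet [NeZero n] {S : Set (Fin L)} {s : Fin L → Fin n} (h : ∀ β ∈ S, s β = 0) :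
    zeroProj S (clockKet s) = clockKet s := by
  ext r
  simp only [zeroProj, clockKet, Matrix.ofLp_toEuclideanCLM, PiLp.ofLp_single,
    Matrix.mulVec_single_one, Matrix.col_apply, Matrix.diagonal_apply, Pi.single_apply]
  by_cases hr : r = s
  · subst hr; simpa using h
  · simp [hr]

lemma zeroProj_clockKet_of_not [NeZero n] {S : Set (Fin L)} {s : Fin L → Fin n}
    (h : ¬ ∀ β ∈ S, s β = 0) : zeroProj S (clockKet s) = 0 := by
  ext r
  simp only [zeroProj, clockKet, Matrix.ofLp_toEuclideanCLM, PiLp.ofLp_single,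
    Matrix.mulVec_single_one, Matrix.col_apply, Matrix.diagonal_apply]
  by_cases hr : r = s
  · subst hr; simp only [if_true, if_neg h]; rfl
  · simp [hr]

lemma adjoint_ketBra (α : Fin L) (i j : Fin n) :
    (ketBra α i j : ClockSpace L n →L[ℂ] ClockSpace L n).adjoint = ketBra α j i := by
  rw [← ContinuousLinearMap.star_eq_adjoint, ketBra, ← map_star]
  congr 1
  ext r s
  simp only [Matrix.star_apply, Matrix.of_apply]
  by_cases h : s α = i ∧ r α = j ∧ ∀ β, β ≠ α → s β = r β
  · rw [if_pos h, if_pos ⟨h.2.1, h.1, fun β hβ => (h.2.2 β hβ).symm⟩, star_one]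
  · rw [if_neg h, if_neg fun h' => h ⟨h'.2.1, h'.1, fun β hβ => (h'.2.2 β hβ).symm⟩, star_zero]

lemma adjoint_zeroProj [NeZero n] (S : Set (Fin L)) :
    (zeroProj S : ClockSpace L n →L[ℂ] ClockSpace L n).adjoint = zeroProj S := by
  rw [← ContinuousLinearMap.star_eq_adjoint, zeroProj, ← map_star]
  congr 1
  rw [Matrix.star_eq_conjTranspose, Matrix.diagonal_conjTranspose]
  congr 1
  ext s
  simp only [Pi.star_apply]
  split_ifs <;> simp

end ClockSpace

section Tensor

variable {H : Type*} [NormedAddCommGroup H] [InnerProductSpace ℂ H] {L n : ℕ}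

/-- The map `x ↦ X x ⊗ |s⟩`. An operator `T` on the tensor product acts on such maps by composition,
written `T • v`. -/
def tensorKet (X : H →L[ℂ] H) (s : Fin L → Fin n) : H →ₗ[ℂ] H ⊗[ℂ] ClockSpace L n :=
  ((TensorProduct.mk ℂ H (ClockSpace L n)).flip (clockKet s)) ∘ₗ (X : H →ₗ[ℂ] H)

lemma tensorKet_apply (X : H →L[ℂ] H) (s : Fin L → Fin n) (x : H) :
    tensorKet X s x = X x ⊗ₜ[ℂ] clockKet s := rfl

lemma tensorKet_smul (c : ℂ) (X : H →L[ℂ] H) (s : Fin L → Fin n) :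
    tensorKet (c • X) s = c • tensorKet X s := by
  ext x
  exact TensorProduct.smul_tmul' c (X x) (clockKet s)

lemma tensorKet_sum {ι : Type*} (t : Finset ι) (X : ι → H →L[ℂ] H) (s : Fin L → Fin n) :
    tensorKet (∑ i ∈ t, X i) s = ∑ i ∈ t, tensorKet (X i) s := by
  ext x
  simp [tensorKet_apply, TensorProduct.sum_tmul]

lemma mapL_smul_tensorKet (Y X : H →L[ℂ] H) {A : ClockSpace L n →L[ℂ] ClockSpace L n}
    {s r : Fin L → Fin n} (h : A (clockKet s) = clockKet r) :
    TensorProduct.mapL Y A • tensorKet X s = tensorKet (Y * X) r := by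
  ext x
  change TensorProduct.mapL Y A (X x ⊗ₜ clockKet s) = _
  rw [TensorProduct.mapL_tmul, h]
  rfl

lemma mapL_smul_tensorKet_of_eq_zero (Y X : H →L[ℂ] H)
    {A : ClockSpace L n →L[ℂ] ClockSpace L n} {s : Fin L → Fin n} (h : A (clockKet s) = 0) :
    TensorProduct.mapL Y A • tensorKet X s = 0 := by
  ext x
  change TensorProduct.mapL Y A (X x ⊗ₜ clockKet s) = _
  rw [TensorProduct.mapL_tmul, h, TensorProduct.tmul_zero]
  rfl

lemma clockSpace_eq_sum (y : ClockSpace L n) : y = ∑ s, y s • clockKet s := by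
  ext r
  simp [clockKet, Finset.sum_apply, Pi.single_apply]

/-- An operator is determined by its values on the vectors `x ⊗ |s⟩`. -/
lemma ext_tensorKet {T T' : (H ⊗[ℂ] ClockSpace L n) →L[ℂ] (H ⊗[ℂ] ClockSpace L n)}
    (h : ∀ s : Fin L → Fin n, T • tensorKet (1 : H →L[ℂ] H) s = T' • tensorKet 1 s) : T = T' := by
  apply ContinuousLinearMap.coe_inj.1
  apply TensorProduct.ext'
  intro x y
  change T (x ⊗ₜ y) = T' (x ⊗ₜ y)
  rw [clockSpace_eq_sum y, TensorProduct.tmul_sum, map_sum, map_sum]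
  refine Finset.sum_congr rfl fun s _ => ?_
  rw [TensorProduct.tmul_smul, map_smul, map_smul]
  congr 1
  exact LinearMap.congr_fun (h s) x

/-- The tensor product with the finite-dimensional clock space is complete, being isomorphic to a
finite power of `H`. -/
instance completeSpace_tensor [CompleteSpace H] : CompleteSpace (H ⊗[ℂ] ClockSpace L n) := by
  let J : ((Fin L → Fin n) → H) →L[ℂ] H ⊗[ℂ] ClockSpace L n :=
    ∑ s, ((TensorProduct.mkL ℂ H (ClockSpace L n)).flip (clockKet s)) ∘L
      ContinuousLinearMap.proj s
  let I : (H ⊗[ℂ] ClockSpace L n) →L[ℂ] ((Fin L → Fin n) → H) :=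
    ContinuousLinearMap.pi fun s =>
      (TensorProduct.ridIsometry ℂ H).toContinuousLinearEquiv.toContinuousLinearMap ∘L
        TensorProduct.mapL (ContinuousLinearMap.id ℂ H) (innerSL ℂ (clockKet s))
  have hJ : ∀ x, J x = ∑ s, x s ⊗ₜ[ℂ] clockKet s := by
    intro x
    simp only [J, sum_apply]
    rfl
  have hI : ∀ x y s, I (x ⊗ₜ y) s = y s • x := by
    intro x y s
    change TensorProduct.rid ℂ H (x ⊗ₜ (innerSL ℂ (clockKet s) y)) = _
    rw [TensorProduct.rid_tmul]
    simp [clockKet, EuclideanSpace.inner_single_left]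
  have hIJ : Function.LeftInverse I J := by
    intro x
    rw [hJ, map_sum]
    ext s
    simp [hI, clockKet]
  have hJI : Function.RightInverse I J := by
    intro y
    induction y with
    | zero => simp
    | add y z hy hz => rw [map_add, map_add, hy, hz]
    | tmul x y =>
      rw [hJ]
      simp only [hI]
      conv_rhs => rw [clockSpace_eq_sum y, TensorProduct.tmul_sum]
      exact Finset.sum_congr rfl fun s _ => by rw [TensorProduct.smul_tmul]
  let e := (ContinuousLinearEquiv.equivOfInverse J I hIJ hJI).symm
  exact (e.isUniformEmbedding.completeSpace_congr e.surjective).2 inferInstance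

end Tensor

/-! ### Walks of several clocks -/

section MultiClock

variable {H : Type*} [NormedAddCommGroup H] [InnerProductSpace ℂ H]
variable {L n : ℕ} [NeZero n]

/-- The projection `Γ_0^α ⊗ |0⟩⟨0|_α`. -/
def clockProj (n : ℕ) [NeZero n] (Γ₀ : Fin L → H →L[ℂ] H) (α : Fin L) :
    (H ⊗[ℂ] ClockSpace L n) →L[ℂ] (H ⊗[ℂ] ClockSpace L n) :=
  TensorProduct.mapL (Γ₀ α) (ketBra α 0 0)

variable {Γ₀ : Fin L → H →L[ℂ] H} {s : Fin L → Fin n} {α : Fin L}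

lemma clockProj_smul_tensorKet (X : H →L[ℂ] H) (h : s α = 0) :
    clockProj n Γ₀ α • tensorKet X s = tensorKet (Γ₀ α * X) s := by
  refine mapL_smul_tensorKet _ _ ?_
  have := ketBra_clockKet_self s α 0
  rwa [h, ← h, Function.update_eq_self, h] at this

lemma clockProj_smul_tensorKet_of_ne (X : H →L[ℂ] H) (h : s α ≠ 0) :
    clockProj n Γ₀ α • tensorKet X s = 0 :=
  mapL_smul_tensorKet_of_eq_zero _ _ (ketBra_clockKet_of_ne h 0)

/-- The unperturbed ground projection `Γ ⊗ |0⟩⟨0| ⊗ ⋯ ⊗ |0⟩⟨0|`. -/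
def groundProj (n : ℕ) [NeZero n] (Γ₀ : Fin L → H →L[ℂ] H) :
    (H ⊗[ℂ] ClockSpace L n) →L[ℂ] (H ⊗[ℂ] ClockSpace L n) :=
  TensorProduct.mapL (totalProj Γ₀) (zeroProj Set.univ)

lemma mapL_zeroProj_smul_tensorKet (Y X : H →L[ℂ] H) :
    TensorProduct.mapL Y (zeroProj (n := n) (Set.univ : Set (Fin L))) •
      tensorKet X (0 : Fin L → Fin n) = tensorKet (Y * X) 0 :=
  mapL_smul_tensorKet _ _ (zeroProj_clockKet fun _ _ => rfl)

lemma mapL_zeroProj_smul_tensorKet_of_ne (Y X : H →L[ℂ] H) (h : s ≠ 0) :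
    TensorProduct.mapL Y (zeroProj (n := n) (Set.univ : Set (Fin L))) • tensorKet X s = 0 :=
  mapL_smul_tensorKet_of_eq_zero _ _ (zeroProj_clockKet_of_not fun h' =>
    h (funext fun β => h' β (Set.mem_univ β)))

lemma groundProj_eq_prod : groundProj n Γ₀ = (List.ofFn (clockProj n Γ₀)).prod := by
  have key : ∀ (l : List (Fin L)) (s : Fin L → Fin n) (X : H →L[ℂ] H),
      ((∀ α ∈ l, s α = 0) →
        (l.map (clockProj n Γ₀)).prod • tensorKet X s = tensorKet ((l.map Γ₀).prod * X) s) ∧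
      ((¬ ∀ α ∈ l, s α = 0) → (l.map (clockProj n Γ₀)).prod • tensorKet X s = 0) := by
    intro l s X
    induction l with
    | nil => simp
    | cons α l ih =>
      simp only [List.map_cons, List.prod_cons, mul_smul, List.forall_mem_cons, mul_assoc]
      by_cases hl : ∀ α ∈ l, s α = 0
      · rw [ih.1 hl]
        refine ⟨fun h => clockProj_smul_tensorKet _ h.1, fun h => ?_⟩
        exact clockProj_smul_tensorKet_of_ne _ fun h' => h ⟨h', hl⟩
      · rw [ih.2 hl]
        exact ⟨fun h => absurd h.2 hl, fun _ => smul_zero _⟩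
  refine ext_tensorKet fun s => ?_
  rw [List.ofFn_eq_map]
  by_cases h : s = 0
  · subst h
    rw [(key _ 0 _).1 fun _ _ => rfl, groundProj, mapL_zeroProj_smul_tensorKet, totalProj,
      List.ofFn_eq_map]
  · rw [(key _ _ _).2 fun h' => h (funext fun α => h' α (List.mem_finRange α)), groundProj,
      mapL_zeroProj_smul_tensorKet_of_ne _ _ h]

variable [CompleteSpace H]

/-- The hypotheses on a system of clocks which are used in the analysis of closed walks. -/
structure MultiClockRules (Γ₀ : Fin L → H →L[ℂ] H) (M : Fin L → Fin n → H →L[ℂ] H) : Prop where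
  rules : ∀ α, ClockRules (M α) (Γ₀ α)
  comm_proj : ∀ α β, Commute (Γ₀ α) (Γ₀ β)
  comm_op_proj : ∀ α β, α ≠ β → ∀ i,
    Commute (M α i) (Γ₀ β) ∧ Commute ((M α i).adjoint) (Γ₀ β)
  comm_op_loop : ∀ α β, α ≠ β → ∀ i,
    Commute (M α i) (M β 0 * (M β 0).adjoint) ∧
      Commute ((M α i).adjoint) (M β 0 * (M β 0).adjoint)

/-- The part of the perturbation which moves the clock `α` forwards. -/
def hopFwd (M : Fin L → Fin n → H →L[ℂ] H) (α : Fin L) :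
    (H ⊗[ℂ] ClockSpace L n) →L[ℂ] (H ⊗[ℂ] ClockSpace L n) :=
  ∑ i, TensorProduct.mapL ((M α i).adjoint) (ketBra α (i + 1) i * zeroProj (chi M α i))

/-- The part of the perturbation which moves the clock `α` backwards. -/
def hopBwd (M : Fin L → Fin n → H →L[ℂ] H) (α : Fin L) :
    (H ⊗[ℂ] ClockSpace L n) →L[ℂ] (H ⊗[ℂ] ClockSpace L n) :=
  ∑ i, TensorProduct.mapL (M α i) (ketBra α i (i + 1) * zeroProj (chi M α i))

variable {M : Fin L → Fin n → H →L[ℂ] H} {β : Fin L} {B : Fin L → H →L[ℂ] H} {j k : ℕ}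

lemma perturbation_eq_sum_hop : perturbation M = ∑ α, (hopFwd M α + hopBwd M α) := by
  simp only [perturbation, hopFwd, hopBwd, Finset.sum_add_distrib]

lemma hopFwd_smul_tensorKet (X : H →L[ℂ] H) (h : ∀ β ∈ chi M α (s α), s β = 0) :
    hopFwd M α • tensorKet X s =
      tensorKet ((M α (s α)).adjoint * X) (Function.update s α (s α + 1)) := by
  rw [hopFwd, Finset.sum_smul, Finset.sum_eq_single (s α)]
  · refine mapL_smul_tensorKet _ _ ?_
    rw [mul_apply_eq_comp, zeroProj_clockKet h, ketBra_clockKet_self]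
  · intro i _ hi
    refine mapL_smul_tensorKet_of_eq_zero _ _ ?_
    rw [mul_apply_eq_comp]
    by_cases h' : ∀ β ∈ chi M α i, s β = 0
    · rw [zeroProj_clockKet h', ketBra_clockKet_of_ne hi.symm]
    · rw [zeroProj_clockKet_of_not h', map_zero]
  · simp

lemma hopFwd_smul_tensorKet_of_not (X : H →L[ℂ] H) (h : ¬ ∀ β ∈ chi M α (s α), s β = 0) :
    hopFwd M α • tensorKet X s = 0 := by
  rw [hopFwd, Finset.sum_smul]
  refine Finset.sum_eq_zero fun i _ => mapL_smul_tensorKet_of_eq_zero _ _ ?_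
  rw [mul_apply_eq_comp]
  by_cases h' : ∀ β ∈ chi M α i, s β = 0
  · rw [zeroProj_clockKet h', ketBra_clockKet_of_ne]
    rintro rfl
    exact h h'
  · rw [zeroProj_clockKet_of_not h', map_zero]

lemma hopBwd_smul_tensorKet (X : H →L[ℂ] H) (h : ∀ β ∈ chi M α (s α - 1), s β = 0) :
    hopBwd M α • tensorKet X s =
      tensorKet (M α (s α - 1) * X) (Function.update s α (s α - 1)) := by
  rw [hopBwd, Finset.sum_smul, Finset.sum_eq_single (s α - 1)]
  · refine mapL_smul_tensorKet _ _ ?_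
    rw [mul_apply_eq_comp, zeroProj_clockKet h, sub_add_cancel, ketBra_clockKet_self]
  · intro i _ hi
    refine mapL_smul_tensorKet_of_eq_zero _ _ ?_
    rw [mul_apply_eq_comp]
    by_cases h' : ∀ β ∈ chi M α i, s β = 0
    · rw [zeroProj_clockKet h', ketBra_clockKet_of_ne]
      exact fun h'' => hi (eq_sub_of_add_eq h''.symm)
    · rw [zeroProj_clockKet_of_not h', map_zero]
  · simp

lemma hopBwd_smul_tensorKet_of_not (X : H →L[ℂ] H) (h : ¬ ∀ β ∈ chi M α (s α - 1), s β = 0) :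
    hopBwd M α • tensorKet X s = 0 := by
  rw [hopBwd, Finset.sum_smul]
  refine Finset.sum_eq_zero fun i _ => mapL_smul_tensorKet_of_eq_zero _ _ ?_
  rw [mul_apply_eq_comp]
  by_cases h' : ∀ β ∈ chi M α i, s β = 0
  · rw [zeroProj_clockKet h', ketBra_clockKet_of_ne]
    intro h''
    rw [h'', add_sub_cancel_right] at h
    exact h h'
  · rw [zeroProj_clockKet_of_not h', map_zero]

/-- The clocks at the positions `s` are in the states `B`. -/
def IsMultiClockState (Γ₀ : Fin L → H →L[ℂ] H) (M : Fin L → Fin n → H →L[ℂ] H) (j : ℕ)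
    (s : Fin L → Fin n) (B : Fin L → H →L[ℂ] H) : Prop :=
  ∀ α, IsClockState (M α) (Γ₀ α) j (s α) (B α)

/-- The span of the maps `x ↦ (∏ α, B α) x ⊗ |s⟩`, where every clock `α` is in a state `B α` reached
without ever being more than `j` steps away from the start. -/
def walkSpan (Γ₀ : Fin L → H →L[ℂ] H) (M : Fin L → Fin n → H →L[ℂ] H) (j : ℕ) :
    Submodule ℂ (H →ₗ[ℂ] H ⊗[ℂ] ClockSpace L n) :=
  Submodule.span ℂ {v | ∃ s B, IsMultiClockState Γ₀ M j s B ∧ v = tensorKet (List.ofFn B).prod s}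

lemma IsMultiClockState.tensorKet_mem (h : IsMultiClockState Γ₀ M j s B) :
    tensorKet (List.ofFn B).prod s ∈ walkSpan Γ₀ M j :=
  Submodule.subset_span ⟨s, B, h, rfl⟩

lemma IsMultiClockState.update (h : IsMultiClockState Γ₀ M j s B) (hjk : j ≤ k) {i : Fin n}
    {Z : H →L[ℂ] H} (hZ : IsClockState (M α) (Γ₀ α) k i Z) :
    IsMultiClockState Γ₀ M k (Function.update s α i) (Function.update B α Z) := by
  intro β
  by_cases hβ : β = α
  · subst hβ; simpa using hZ
  · rw [Function.update_of_ne hβ, Function.update_of_ne hβ]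
    exact (h β).mono hjk

lemma isMultiClockState_ground (Γ₀ : Fin L → H →L[ℂ] H) (M : Fin L → Fin n → H →L[ℂ] H) (j : ℕ) :
    IsMultiClockState Γ₀ M j 0 Γ₀ := fun α => IsClockState.ground (M α) (Γ₀ α) j

/-- A step of the clock `α` which is not suppressed commutes with the states of the other clocks:
a clock which is not at the start is not in `χ(α, i)`, and for a clock at the start there are only
the operators `Γ_0^β` and `M_0^β (M_0^β)† Γ_0^β`. -/
lemma commute_state_of_chi (hr : MultiClockRules Γ₀ M) (hB : IsMultiClockState Γ₀ M j s B)
    (hj : j < n) {i : Fin n} (h : ∀ β ∈ chi M α i, s β = 0) (hβ : β ≠ α) :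
    Commute (M α i) (B β) ∧ Commute (M α i).adjoint (B β) := by
  by_cases h0 : s β = 0
  · have hG := hr.comm_op_proj α β hβ.symm i
    have hN := hr.comm_op_loop α β hβ.symm i
    have hBβ := hB β
    rw [h0] at hBβ
    rcases hBβ.eq_of_zero hj with h1 | h1
    · rw [h1]; exact hG
    · rw [h1]; exact ⟨hN.1.mul_right hG.1, hN.2.mul_right hG.2⟩
  · have hχ : β ∉ chi M α i := fun h' => h0 (h β h')
    have hc : ∀ l, Commute (M α i) (M β l) ∧ Commute (M α i) ((M β l).adjoint) := by
      intro l
      by_contra hcon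
      exact hχ ⟨hβ, l, by tauto⟩
    have hc' : ∀ l, Commute (M α i).adjoint (M β l) ∧ Commute (M α i).adjoint (M β l).adjoint := by
      intro l
      have h1 := (hc l).1.star_star
      have h2 := (hc l).2.star_star
      simp only [ContinuousLinearMap.star_eq_adjoint, ContinuousLinearMap.adjoint_adjoint] at h1 h2
      exact ⟨h2, h1⟩
    exact ⟨(hB β).commute (hr.comm_op_proj α β hβ.symm i).1 (fun l => (hc l).1) fun l => (hc l).2,
      (hB β).commute (hr.comm_op_proj α β hβ.symm i).2 (fun l => (hc' l).1) fun l => (hc' l).2⟩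

lemma commute_proj_state (hr : MultiClockRules Γ₀ M) (hB : IsMultiClockState Γ₀ M j s B)
    (hβ : β ≠ α) : Commute (Γ₀ α) (B β) :=
  (hB β).commute (hr.comm_proj α β) (fun i => ((hr.comm_op_proj β α hβ i).1).symm)
    fun i => ((hr.comm_op_proj β α hβ i).2).symm

lemma hopFwd_mem (hr : MultiClockRules Γ₀ M) (hB : IsMultiClockState Γ₀ M j s B) (hj : j < n)
    (hjk : j ≤ k) (h : ∃ (c : ℂ) (Z : H →L[ℂ] H), (M α (s α)).adjoint * B α = c • Z ∧
      IsClockState (M α) (Γ₀ α) k (s α + 1) Z) :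
    hopFwd M α • tensorKet (List.ofFn B).prod s ∈ walkSpan Γ₀ M k := by
  obtain ⟨c, Z, hZ, hs⟩ := h
  by_cases hχ : ∀ β ∈ chi M α (s α), s β = 0
  · rw [hopFwd_smul_tensorKet _ hχ, mul_prod_ofFn_eq_smul
      (fun β hβ => (commute_state_of_chi hr hB hj hχ hβ).2) hZ, tensorKet_smul]
    exact Submodule.smul_mem _ _ (hB.update hjk hs).tensorKet_mem
  · rw [hopFwd_smul_tensorKet_of_not _ hχ]
    exact Submodule.zero_mem _

lemma hopBwd_mem (hr : MultiClockRules Γ₀ M) (hB : IsMultiClockState Γ₀ M j s B) (hj : j < n)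
    (hjk : j ≤ k) (h : ∃ (c : ℂ) (Z : H →L[ℂ] H), M α (s α - 1) * B α = c • Z ∧
      IsClockState (M α) (Γ₀ α) k (s α - 1) Z) :
    hopBwd M α • tensorKet (List.ofFn B).prod s ∈ walkSpan Γ₀ M k := by
  obtain ⟨c, Z, hZ, hs⟩ := h
  by_cases hχ : ∀ β ∈ chi M α (s α - 1), s β = 0
  · rw [hopBwd_smul_tensorKet _ hχ, mul_prod_ofFn_eq_smul
      (fun β hβ => (commute_state_of_chi hr hB hj hχ hβ).1) hZ, tensorKet_smul]
    exact Submodule.smul_mem _ _ (hB.update hjk hs).tensorKet_mem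
  · rw [hopBwd_smul_tensorKet_of_not _ hχ]
    exact Submodule.zero_mem _

/-- To prove that an operator maps `walkSpan Γ₀ M j` into a submodule, it suffices to consider the
spanning vectors. -/
lemma smul_mem_of_walkSpan {T : (H ⊗[ℂ] ClockSpace L n) →L[ℂ] (H ⊗[ℂ] ClockSpace L n)}
    {S : Submodule ℂ (H →ₗ[ℂ] H ⊗[ℂ] ClockSpace L n)}
    (h : ∀ s B, IsMultiClockState Γ₀ M j s B → T • tensorKet (List.ofFn B).prod s ∈ S)
    {v : H →ₗ[ℂ] H ⊗[ℂ] ClockSpace L n} (hv : v ∈ walkSpan Γ₀ M j) : T • v ∈ S := by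
  induction hv using Submodule.span_induction with
  | mem v hv =>
    obtain ⟨s, B, hB, rfl⟩ := hv
    exact h s B hB
  | zero => rw [smul_zero]; exact S.zero_mem
  | add v w _ _ hv hw => rw [smul_add]; exact S.add_mem hv hw
  | smul c v _ hv => rw [smul_comm]; exact S.smul_mem c hv

lemma perturbation_smul_mem (hr : MultiClockRules Γ₀ M) (hj : j + 1 < n)
    {v : H →ₗ[ℂ] H ⊗[ℂ] ClockSpace L n} (hv : v ∈ walkSpan Γ₀ M j) :
    perturbation M • v ∈ walkSpan Γ₀ M (j + 1) := by
  refine smul_mem_of_walkSpan (fun s B hB => ?_) hv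
  rw [perturbation_eq_sum_hop, Finset.sum_smul]
  refine Submodule.sum_mem _ fun α _ => ?_
  rw [add_smul]
  exact Submodule.add_mem _
    (hopFwd_mem hr hB (by omega) (by omega) ((hB α).exists_fwd (hr.rules α)))
    (hopBwd_mem hr hB (by omega) (by omega) ((hB α).exists_bwd (hr.rules α)))

lemma clockProj_smul_mem (hr : MultiClockRules Γ₀ M) (hj : j < n) (α : Fin L)
    {v : H →ₗ[ℂ] H ⊗[ℂ] ClockSpace L n} (hv : v ∈ walkSpan Γ₀ M j) :
    clockProj n Γ₀ α • v ∈ walkSpan Γ₀ M j := by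
  refine smul_mem_of_walkSpan (fun s B hB => ?_) hv
  by_cases h : s α = 0
  · have hBα := hB α
    rw [h] at hBα
    obtain ⟨c, hc⟩ := hBα.compress (hr.rules α) hj
    rw [clockProj_smul_tensorKet _ h, mul_prod_ofFn_eq_smul
      (fun β hβ => commute_proj_state hr hB hβ) hc, tensorKet_smul]
    refine Submodule.smul_mem _ _ ?_
    have := hB.update le_rfl (IsClockState.ground (M α) (Γ₀ α) j)
    rw [← h, Function.update_eq_self] at this
    exact this.tensorKet_mem
  · rw [clockProj_smul_tensorKet_of_ne _ h]
    exact Submodule.zero_mem _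

/-- A walk along which no clock winds around its cycle acts on the ground space as a scalar. -/
lemma groundProj_smul_of_mem_walkSpan (hr : MultiClockRules Γ₀ M) (hj : j < n)
    {v : H →ₗ[ℂ] H ⊗[ℂ] ClockSpace L n} (hv : v ∈ walkSpan Γ₀ M j) :
    ∃ c : ℂ, groundProj n Γ₀ • v = c • tensorKet (totalProj Γ₀) 0 := by
  suffices h : groundProj n Γ₀ • v ∈
      Submodule.span ℂ {(tensorKet (totalProj Γ₀) 0 : H →ₗ[ℂ] H ⊗[ℂ] ClockSpace L n)} by
    obtain ⟨c, hc⟩ := Submodule.mem_span_singleton.1 h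
    exact ⟨c, hc.symm⟩
  refine smul_mem_of_walkSpan (fun s B hB => ?_) hv
  by_cases hs : s = 0
  · subst hs
    -- the factors of `Γ` replace the states of the clocks, one after the other
    have key : ∀ l : List (Fin L), ∃ (c : ℂ) (B' : Fin L → H →L[ℂ] H), (∀ β ∈ l, B' β = Γ₀ β) ∧
        IsMultiClockState Γ₀ M j 0 B' ∧
        (l.map Γ₀).prod * (List.ofFn B).prod = c • (List.ofFn B').prod := by
      intro l
      induction l with
      | nil => exact ⟨1, B, by simp, hB, by simp⟩
      | cons α l ih =>
        obtain ⟨c, B', h1, h2, h3⟩ := ih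
        obtain ⟨c', hc'⟩ := (h2 α).compress (hr.rules α) hj
        have hup := h2.update le_rfl (IsClockState.ground (M α) (Γ₀ α) j)
        refine ⟨c * c', Function.update B' α (Γ₀ α), ?_, ?_, ?_⟩
        · intro β hβ
          by_cases hβα : β = α
          · subst hβα; simp
          · rw [Function.update_of_ne hβα]
            exact h1 β ((List.mem_cons.1 hβ).resolve_left hβα)
        · rwa [show (0 : Fin n) = (0 : Fin L → Fin n) α from rfl, Function.update_eq_self] at hup
        · rw [List.map_cons, List.prod_cons, mul_assoc, h3, mul_smul_comm, mul_prod_ofFn_eq_smul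
            (fun β hβ => commute_proj_state hr h2 hβ) hc', smul_smul]
    obtain ⟨c, B', h1, -, h3⟩ := key (List.finRange L)
    have hB' : B' = Γ₀ := funext fun β => h1 β (List.mem_finRange β)
    rw [groundProj, mapL_zeroProj_smul_tensorKet, totalProj, List.ofFn_eq_map, h3, hB',
      tensorKet_smul, List.ofFn_eq_map]
    exact Submodule.smul_mem _ _ (Submodule.mem_span_singleton_self _)
  · rw [groundProj, mapL_zeroProj_smul_tensorKet_of_ne _ _ hs]
    exact Submodule.zero_mem _

end MultiClock

/-! ### The walks of leading order -/

section LeadingOrder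

variable {H : Type*} [NormedAddCommGroup H] [InnerProductSpace ℂ H]
variable {L n : ℕ} [NeZero n] {Γ₀ : Fin L → H →L[ℂ] H}

lemma clockProj_mul_self (hi : ∀ α, Γ₀ α * Γ₀ α = Γ₀ α) (α : Fin L) :
    clockProj n Γ₀ α * clockProj n Γ₀ α = clockProj n Γ₀ α := by
  refine ext_tensorKet fun s => ?_
  rw [mul_smul]
  by_cases h : s α = 0
  · rw [clockProj_smul_tensorKet _ h, clockProj_smul_tensorKet _ h, ← mul_assoc, hi]
  · rw [clockProj_smul_tensorKet_of_ne _ h, smul_zero]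

lemma commute_clockProj (hc : ∀ α β, Commute (Γ₀ α) (Γ₀ β)) (α β : Fin L) :
    Commute (clockProj n Γ₀ α) (clockProj n Γ₀ β) := by
  refine ext_tensorKet fun s => ?_
  rw [mul_smul, mul_smul]
  by_cases hα : s α = 0 <;> by_cases hβ : s β = 0
  · rw [clockProj_smul_tensorKet _ hα, clockProj_smul_tensorKet _ hβ,
      clockProj_smul_tensorKet _ hα, clockProj_smul_tensorKet _ hβ, ← mul_assoc, ← mul_assoc,
      (hc α β).eq]
  · rw [clockProj_smul_tensorKet _ hα, clockProj_smul_tensorKet_of_ne _ hβ,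
      clockProj_smul_tensorKet_of_ne _ hβ, smul_zero]
  · rw [clockProj_smul_tensorKet _ hβ, clockProj_smul_tensorKet_of_ne _ hα,
      clockProj_smul_tensorKet_of_ne _ hα, smul_zero]
  · rw [clockProj_smul_tensorKet_of_ne _ hα, clockProj_smul_tensorKet_of_ne _ hβ, smul_zero,
      smul_zero]

/-- The unperturbed Hamiltonian, shifted to ground state energy zero. -/
def shiftedUnperturbed (n : ℕ) [NeZero n] (Γ₀ : Fin L → H →L[ℂ] H) :
    (H ⊗[ℂ] ClockSpace L n) →L[ℂ] (H ⊗[ℂ] ClockSpace L n) :=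
  defectNumber (List.ofFn (clockProj n Γ₀))

lemma shiftedUnperturbed_eq_sum :
    shiftedUnperturbed n Γ₀ = ∑ α, (1 - clockProj n Γ₀ α) := by
  rw [shiftedUnperturbed, defectNumber, List.map_ofFn, List.sum_ofFn]
  rfl

lemma mul_self_of_mem_ofFn_clockProj (hi : ∀ α, Γ₀ α * Γ₀ α = Γ₀ α) :
    ∀ q ∈ List.ofFn (clockProj n Γ₀), q * q = q := by
  intro q hq
  obtain ⟨α, rfl⟩ := (List.mem_ofFn' _ _).1 hq
  exact clockProj_mul_self hi α

lemma commute_of_mem_ofFn_clockProj (hc : ∀ α β, Commute (Γ₀ α) (Γ₀ β)) :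
    ∀ q ∈ List.ofFn (clockProj n Γ₀), ∀ r ∈ List.ofFn (clockProj n Γ₀), Commute q r := by
  intro q hq r hr
  obtain ⟨α, rfl⟩ := (List.mem_ofFn' _ _).1 hq
  obtain ⟨β, rfl⟩ := (List.mem_ofFn' _ _).1 hr
  exact commute_clockProj hc α β

/-- The reduced resolvent of the shifted unperturbed Hamiltonian. -/
def clockResolvent (n : ℕ) [NeZero n] (Γ₀ : Fin L → H →L[ℂ] H) (g : ℝ) :
    (H ⊗[ℂ] ClockSpace L n) →L[ℂ] (H ⊗[ℂ] ClockSpace L n) :=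
  reducedResolvent (List.ofFn (clockProj n Γ₀)) g

lemma sub_mul_clockResolvent (hi : ∀ α, Γ₀ α * Γ₀ α = Γ₀ α)
    (hc : ∀ α β, Commute (Γ₀ α) (Γ₀ β)) {g : ℝ} (hg : g ∈ Set.Icc (-1 / 2 : ℝ) (1 / 2)) :
    (shiftedUnperturbed n Γ₀ -
      (g : ℂ) • (1 : (H ⊗[ℂ] ClockSpace L n) →L[ℂ] (H ⊗[ℂ] ClockSpace L n))) *
        clockResolvent n Γ₀ g = 1 - groundProj n Γ₀ := by
  rw [groundProj_eq_prod]
  exact sub_mul_reducedResolvent (mul_self_of_mem_ofFn_clockProj hi)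
    (commute_of_mem_ofFn_clockProj hc) hg

/-- The clock `α` has made `k` steps backwards, the other clocks are at the start. -/
def bwdKet (Γ₀ : Fin L → H →L[ℂ] H) (M : Fin L → Fin n → H →L[ℂ] H) (α : Fin L) (k : ℕ) :
    H →ₗ[ℂ] H ⊗[ℂ] ClockSpace L n :=
  tensorKet (List.ofFn (Function.update Γ₀ α (bwdOp (M α) (Γ₀ α) k))).prod
    (Function.update 0 α (bwdPos n k))

lemma bwdKet_zero (Γ₀ : Fin L → H →L[ℂ] H) (M : Fin L → Fin n → H →L[ℂ] H) (α : Fin L) :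
    bwdKet Γ₀ M α 0 = tensorKet (totalProj Γ₀) 0 := by
  have h : Function.update (0 : Fin L → Fin n) α 0 = 0 := Function.update_eq_self α 0
  rw [bwdKet, bwdOp, bwdPos, Function.update_eq_self, h]
  rfl

variable [CompleteSpace H] {M : Fin L → Fin n → H →L[ℂ] H} {s : Fin L → Fin n}
  {α : Fin L} {B : Fin L → H →L[ℂ] H} {j k : ℕ}

/-- While exactly one clock is away from the start, the shifted unperturbed energy is `1`. -/
lemma clockResolvent_smul_of_single (hr : MultiClockRules Γ₀ M) (hB : IsMultiClockState Γ₀ M j s B)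
    (hα : s α ≠ 0) (hne : ∀ β, β ≠ α → s β = 0 ∧ B β = Γ₀ β) {g : ℝ}
    (hg : g ∈ Set.Icc (-1 / 2 : ℝ) (1 / 2)) :
    clockResolvent n Γ₀ g • tensorKet (List.ofFn B).prod s =
      (((1 - g)⁻¹ : ℝ) : ℂ) • tensorKet (List.ofFn B).prod s := by
  set v : H →ₗ[ℂ] H ⊗[ℂ] ClockSpace L n := tensorKet (List.ofFn B).prod s with hv
  have hi := fun α => (hr.rules α).idem
  have hA : shiftedUnperturbed n Γ₀ • v = v := by
    rw [shiftedUnperturbed_eq_sum, Finset.sum_smul, Finset.sum_eq_single α]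
    · rw [sub_smul, one_smul, hv, clockProj_smul_tensorKet_of_ne _ hα, sub_zero]
    · intro β _ hβ
      obtain ⟨h0, hBβ⟩ := hne β hβ
      have h1 : Γ₀ β * B β = (1 : ℂ) • Γ₀ β := by rw [hBβ, hi, one_smul]
      rw [sub_smul, one_smul, hv, clockProj_smul_tensorKet _ h0, mul_prod_ofFn_eq_smul
        (fun γ hγ => commute_proj_state hr hB hγ) h1, one_smul, ← hBβ, Function.update_eq_self,
        sub_self]
    · simp
  have hP : groundProj n Γ₀ • v = 0 :=
    mapL_zeroProj_smul_tensorKet_of_ne _ _ fun h => hα (by rw [h]; rfl)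
  rw [groundProj_eq_prod] at hP
  exact reducedResolvent_smul_eq (mul_self_of_mem_ofFn_clockProj hi)
    (commute_of_mem_ofFn_clockProj hr.comm_proj) hg hA hP

/-- The clock `α` has made `k` steps forwards, the other clocks are at the start. -/
def fwdKet (Γ₀ : Fin L → H →L[ℂ] H) (M : Fin L → Fin n → H →L[ℂ] H) (α : Fin L) (k : ℕ) :
    H →ₗ[ℂ] H ⊗[ℂ] ClockSpace L n :=
  tensorKet (List.ofFn (Function.update Γ₀ α (fwdOp (M α) (Γ₀ α) k))).prod
    (Function.update 0 α (fwdPos n k))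

lemma isMultiClockState_fwd (Γ₀ : Fin L → H →L[ℂ] H) (M : Fin L → Fin n → H →L[ℂ] H)
    (α : Fin L) (k : ℕ) : IsMultiClockState Γ₀ M k (Function.update 0 α (fwdPos n k))
      (Function.update Γ₀ α (fwdOp (M α) (Γ₀ α) k)) :=
  (isMultiClockState_ground Γ₀ M k).update le_rfl (.fwd k le_rfl)

lemma isMultiClockState_bwd (Γ₀ : Fin L → H →L[ℂ] H) (M : Fin L → Fin n → H →L[ℂ] H)
    (α : Fin L) (k : ℕ) : IsMultiClockState Γ₀ M k (Function.update 0 α (bwdPos n k))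
      (Function.update Γ₀ α (bwdOp (M α) (Γ₀ α) k)) :=
  (isMultiClockState_ground Γ₀ M k).update le_rfl (.bwd k le_rfl)

lemma fwdKet_zero (Γ₀ : Fin L → H →L[ℂ] H) (M : Fin L → Fin n → H →L[ℂ] H) (α : Fin L) :
    fwdKet Γ₀ M α 0 = tensorKet (totalProj Γ₀) 0 := by
  have h : Function.update (0 : Fin L → Fin n) α 0 = 0 := Function.update_eq_self α 0
  rw [fwdKet, fwdOp, fwdPos, Function.update_eq_self, h]
  rfl

lemma hopFwd_smul_fwdKet (hr : MultiClockRules Γ₀ M) (hk : k < n) (α : Fin L) :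
    hopFwd M α • fwdKet Γ₀ M α k = fwdKet Γ₀ M α (k + 1) := by
  have hs : (Function.update (0 : Fin L → Fin n) α (fwdPos n k)) α = fwdPos n k :=
    Function.update_self ..
  have hχ : ∀ β ∈ chi M α ((Function.update (0 : Fin L → Fin n) α (fwdPos n k)) α),
      (Function.update (0 : Fin L → Fin n) α (fwdPos n k)) β = 0 := fun β hβ => by
    rw [Function.update_of_ne hβ.1]; rfl
  have hZ : (M α ((Function.update (0 : Fin L → Fin n) α (fwdPos n k)) α)).adjoint *
      (Function.update Γ₀ α (fwdOp (M α) (Γ₀ α) k)) α =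
      (1 : ℂ) • fwdOp (M α) (Γ₀ α) (k + 1) := by
    rw [hs, Function.update_self, one_smul]; rfl
  rw [fwdKet, hopFwd_smul_tensorKet _ hχ, mul_prod_ofFn_eq_smul (fun β hβ =>
    (commute_state_of_chi hr (isMultiClockState_fwd Γ₀ M α k) hk hχ hβ).2) hZ, one_smul, hs,
    Function.update_idem, Function.update_idem]
  rfl

lemma hopBwd_smul_bwdKet (hr : MultiClockRules Γ₀ M) (hk : k < n) (α : Fin L) :
    hopBwd M α • bwdKet Γ₀ M α k = bwdKet Γ₀ M α (k + 1) := by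
  have hs : (Function.update (0 : Fin L → Fin n) α (bwdPos n k)) α = bwdPos n k :=
    Function.update_self ..
  have hχ : ∀ β ∈ chi M α ((Function.update (0 : Fin L → Fin n) α (bwdPos n k)) α - 1),
      (Function.update (0 : Fin L → Fin n) α (bwdPos n k)) β = 0 := fun β hβ => by
    rw [Function.update_of_ne hβ.1]; rfl
  have hZ : M α ((Function.update (0 : Fin L → Fin n) α (bwdPos n k)) α - 1) *
      (Function.update Γ₀ α (bwdOp (M α) (Γ₀ α) k)) α =
      (1 : ℂ) • bwdOp (M α) (Γ₀ α) (k + 1) := by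
    rw [hs, Function.update_self, one_smul]; rfl
  rw [bwdKet, hopBwd_smul_tensorKet _ hχ, mul_prod_ofFn_eq_smul (fun β hβ =>
    (commute_state_of_chi hr (isMultiClockState_bwd Γ₀ M α k) hk hχ hβ).1) hZ, one_smul, hs,
    Function.update_idem, Function.update_idem]
  rfl

/-- A clock at the start makes its first step. -/
lemma exists_step_of_ground (hr : MultiClockRules Γ₀ M) (hk : 1 ≤ k) {β : Fin L} (h0 : s β = 0)
    (hB : B β = Γ₀ β) :
    (∃ (c : ℂ) (Z : H →L[ℂ] H), (M β (s β)).adjoint * B β = c • Z ∧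
      IsClockState (M β) (Γ₀ β) k (s β + 1) Z) ∧
    ∃ (c : ℂ) (Z : H →L[ℂ] H), M β (s β - 1) * B β = c • Z ∧
      IsClockState (M β) (Γ₀ β) k (s β - 1) Z := by
  rw [h0, hB]
  obtain ⟨c, Z, hZ, hs⟩ := (IsClockState.ground (M β) (Γ₀ β) 0).exists_fwd (hr.rules β)
  obtain ⟨c', Z', hZ', hs'⟩ := (IsClockState.ground (M β) (Γ₀ β) 0).exists_bwd (hr.rules β)
  exact ⟨⟨c, Z, hZ, hs.mono hk⟩, ⟨c', Z', hZ', hs'.mono hk⟩⟩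

lemma sum_sub_mem_of_single {ι X : Type*} [DecidableEq ι] [AddCommGroup X] [Module ℂ X]
    {S : Submodule ℂ X} {t : Finset ι} {f : ι → X} {w : X} {a : ι} (ha : a ∈ t)
    (h1 : f a - w ∈ S) (h2 : ∀ b, b ≠ a → f b ∈ S) : ∑ b ∈ t, f b - w ∈ S := by
  rw [← Finset.add_sum_erase t f ha, add_sub_right_comm]
  exact S.add_mem h1 (S.sum_mem fun b hb => h2 b (Finset.ne_of_mem_erase hb))

lemma perturbation_smul_fwdKet (hr : MultiClockRules Γ₀ M) (hk : 1 ≤ k) (hkn : k < n)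
    (α : Fin L) :
    perturbation M • fwdKet Γ₀ M α k - fwdKet Γ₀ M α (k + 1) ∈ walkSpan Γ₀ M k := by
  rw [perturbation_eq_sum_hop, Finset.sum_smul]
  have hst := isMultiClockState_fwd Γ₀ M α k
  refine sum_sub_mem_of_single (Finset.mem_univ α) ?_ fun β hβ => ?_
  · rw [add_smul, hopFwd_smul_fwdKet hr hkn, add_sub_cancel_left]
    refine hopBwd_mem hr hst hkn le_rfl ?_
    rw [Function.update_self, Function.update_self]
    obtain ⟨a, rfl⟩ : ∃ a, k = a + 1 := ⟨k - 1, by omega⟩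
    exact exists_bwd_fwdOp (hr.rules α) a
  · rw [add_smul]
    have h := exists_step_of_ground (s := Function.update 0 α (fwdPos n k))
      (B := Function.update Γ₀ α (fwdOp (M α) (Γ₀ α) k)) hr hk
      (by rw [Function.update_of_ne hβ]; rfl) (Function.update_of_ne hβ _ _)
    exact Submodule.add_mem _ (hopFwd_mem hr hst hkn le_rfl h.1) (hopBwd_mem hr hst hkn le_rfl h.2)

lemma perturbation_smul_bwdKet (hr : MultiClockRules Γ₀ M) (hk : 1 ≤ k) (hkn : k < n)
    (α : Fin L) :
    perturbation M • bwdKet Γ₀ M α k - bwdKet Γ₀ M α (k + 1) ∈ walkSpan Γ₀ M k := by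
  rw [perturbation_eq_sum_hop, Finset.sum_smul]
  have hst := isMultiClockState_bwd Γ₀ M α k
  refine sum_sub_mem_of_single (Finset.mem_univ α) ?_ fun β hβ => ?_
  · rw [add_smul, hopBwd_smul_bwdKet hr hkn, add_sub_cancel_right]
    refine hopFwd_mem hr hst hkn le_rfl ?_
    rw [Function.update_self, Function.update_self]
    obtain ⟨a, rfl⟩ : ∃ a, k = a + 1 := ⟨k - 1, by omega⟩
    exact exists_fwd_bwdOp (hr.rules α) a
  · rw [add_smul]
    have h := exists_step_of_ground (s := Function.update 0 α (bwdPos n k))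
      (B := Function.update Γ₀ α (bwdOp (M α) (Γ₀ α) k)) hr hk
      (by rw [Function.update_of_ne hβ]; rfl) (Function.update_of_ne hβ _ _)
    exact Submodule.add_mem _ (hopFwd_mem hr hst hkn le_rfl h.1) (hopBwd_mem hr hst hkn le_rfl h.2)

/-- One of the clocks has made `k` steps in one of the two directions. -/
def leadingKet (Γ₀ : Fin L → H →L[ℂ] H) (M : Fin L → Fin n → H →L[ℂ] H) (k : ℕ) :
    H →ₗ[ℂ] H ⊗[ℂ] ClockSpace L n :=
  ∑ α, (fwdKet Γ₀ M α k + bwdKet Γ₀ M α k)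

lemma perturbation_smul_leadingKet (hr : MultiClockRules Γ₀ M) (hk : 1 ≤ k) (hkn : k < n) :
    perturbation M • leadingKet Γ₀ M k - leadingKet Γ₀ M (k + 1) ∈ walkSpan Γ₀ M k := by
  rw [leadingKet, leadingKet, Finset.smul_sum, ← Finset.sum_sub_distrib]
  refine Submodule.sum_mem _ fun α _ => ?_
  rw [smul_add, add_sub_add_comm]
  exact Submodule.add_mem _ (perturbation_smul_fwdKet hr hk hkn α)
    (perturbation_smul_bwdKet hr hk hkn α)

lemma perturbation_smul_ground (hr : MultiClockRules Γ₀ M) :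
    perturbation M • tensorKet (totalProj Γ₀) 0 = leadingKet Γ₀ M 1 := by
  rw [perturbation_eq_sum_hop, Finset.sum_smul, leadingKet]
  refine Finset.sum_congr rfl fun α _ => ?_
  have hn : 0 < n := Nat.pos_of_ne_zero (NeZero.ne n)
  rw [add_smul, ← hopFwd_smul_fwdKet hr hn, ← hopBwd_smul_bwdKet hr hn, fwdKet_zero, bwdKet_zero]

lemma clockResolvent_smul_leadingKet (hr : MultiClockRules Γ₀ M) (hk : 1 ≤ k) (hkn : k < n)
    {g : ℝ} (hg : g ∈ Set.Icc (-1 / 2 : ℝ) (1 / 2)) :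
    clockResolvent n Γ₀ g • leadingKet Γ₀ M k = (((1 - g)⁻¹ : ℝ) : ℂ) • leadingKet Γ₀ M k := by
  rw [leadingKet, Finset.smul_sum, Finset.smul_sum]
  refine Finset.sum_congr rfl fun α _ => ?_
  rw [smul_add, smul_add]
  congr 1
  · refine clockResolvent_smul_of_single (α := α) hr (isMultiClockState_fwd Γ₀ M α k) ?_
      (fun β hβ => ⟨by rw [Function.update_of_ne hβ]; rfl, Function.update_of_ne hβ _ _⟩) hg
    rw [Function.update_self]
    exact fwdPos_ne_zero (by omega) hkn
  · refine clockResolvent_smul_of_single (α := α) hr (isMultiClockState_bwd Γ₀ M α k) ?_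
      (fun β hβ => ⟨by rw [Function.update_of_ne hβ]; rfl, Function.update_of_ne hβ _ _⟩) hg
    rw [Function.update_self]
    exact bwdPos_ne_zero (by omega) hkn

/-- The walks of `k + 1` steps which lead a single clock straight in one direction, and the others,
which stay within `k` steps from the start. -/
lemma word_sub_leadingKet_mem (hr : MultiClockRules Γ₀ M) {g : ℝ}
    (hg : g ∈ Set.Icc (-1 / 2 : ℝ) (1 / 2)) (k : ℕ) (hk : k < n) :
    perturbation M • ((clockResolvent n Γ₀ g * perturbation M) ^ k • tensorKet (totalProj Γ₀) 0) -
      (((1 - g)⁻¹ ^ k : ℝ) : ℂ) • leadingKet Γ₀ M (k + 1) ∈ walkSpan Γ₀ M k := by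
  induction k with
  | zero =>
    rw [pow_zero, one_smul, perturbation_smul_ground hr, pow_zero, Complex.ofReal_one, one_smul,
      sub_self]
    exact Submodule.zero_mem _
  | succ k ih =>
    have ih := ih (by omega)
    set y := perturbation M •
      ((clockResolvent n Γ₀ g * perturbation M) ^ k • tensorKet (totalProj Γ₀) 0) -
      (((1 - g)⁻¹ ^ k : ℝ) : ℂ) • leadingKet Γ₀ M (k + 1) with hy
    have h1 : (clockResolvent n Γ₀ g * perturbation M) ^ (k + 1) • tensorKet (totalProj Γ₀) 0 =
        (((1 - g)⁻¹ ^ (k + 1) : ℝ) : ℂ) • leadingKet Γ₀ M (k + 1) +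
          clockResolvent n Γ₀ g • y := by
      rw [hy, smul_sub, operator_smul_smul,
        clockResolvent_smul_leadingKet hr (by omega) hk hg, pow_succ', mul_smul, mul_smul]
      have e : (((1 - g)⁻¹ ^ k : ℝ) : ℂ) • ((((1 - g)⁻¹ : ℝ) : ℂ) • leadingKet Γ₀ M (k + 1)) =
          (((1 - g)⁻¹ ^ (k + 1) : ℝ) : ℂ) • leadingKet Γ₀ M (k + 1) := by
        rw [pow_succ, Complex.ofReal_mul]
        exact smul_smul _ _ _
      rw [e]
      exact (add_sub_cancel _ _).symm
    have h2 : clockResolvent n Γ₀ g • y ∈ walkSpan Γ₀ M k := by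
      refine reducedResolvent_smul_mem (fun q hq x hx => ?_) g ih
      obtain ⟨α, rfl⟩ := (List.mem_ofFn' _ _).1 hq
      exact clockProj_smul_mem hr (by omega) α hx
    have h3 := perturbation_smul_mem hr hk h2
    have h4 := perturbation_smul_leadingKet hr (Nat.succ_pos k) hk
    rw [h1, smul_add, operator_smul_smul, add_sub_right_comm]
    refine Submodule.add_mem _ ?_ h3
    convert Submodule.smul_mem _ (((1 - g)⁻¹ ^ (k + 1) : ℝ) : ℂ) h4 using 1
    exact (smul_sub _ _ _).symm

lemma groundProj_smul_leadingKet (hr : MultiClockRules Γ₀ M) (hk : 1 ≤ k) (hkn : k ≤ n) :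
    groundProj n Γ₀ • leadingKet Γ₀ M k =
      if k = n then tensorKet (∑ α, targetHamiltonian Γ₀ M α) 0 else 0 := by
  rw [leadingKet, Finset.smul_sum]
  split_ifs with h
  · subst h
    rw [tensorKet_sum]
    refine Finset.sum_congr rfl fun α _ => ?_
    have h0 : Function.update (0 : Fin L → Fin k) α 0 = 0 := Function.update_eq_self α 0
    have hofFn : ∀ (l : List (H →L[ℂ] H)), (∀ β, β ≠ α → ∀ x ∈ l, Commute x (Γ₀ β)) →
        (List.ofFn (Function.update Γ₀ α (l.prod * Γ₀ α))).prod = l.prod * totalProj Γ₀ := by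
      intro l hl
      have h1 : l.prod * Γ₀ α = (1 : ℂ) • (l.prod * Γ₀ α) := (one_smul _ _).symm
      rw [totalProj, mul_prod_ofFn_eq_smul
        (fun β hβ => (Commute.list_prod_right l (Γ₀ β) fun x hx => (hl β hβ x hx).symm).symm) h1,
        one_smul]
    rw [smul_add, fwdKet, bwdKet, fwdPos_self, bwdPos_self, h0, fwdOp_self, bwdOp_self,
      hofFn _ (fun β hβ x hx => ?_), hofFn _ (fun β hβ x hx => ?_), groundProj,
      mapL_zeroProj_smul_tensorKet, mapL_zeroProj_smul_tensorKet, targetHamiltonian, add_comm,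
      ← mul_assoc, ← mul_assoc]
    · ext x
      simp [tensorKet_apply, TensorProduct.add_tmul]
    · obtain ⟨i, rfl⟩ := (List.mem_ofFn' _ _).1 hx
      exact (hr.comm_op_proj α β hβ.symm i).1
    · obtain ⟨i, rfl⟩ := (List.mem_ofFn' _ _).1 (List.mem_reverse.1 hx)
      exact (hr.comm_op_proj α β hβ.symm i).2
  · refine Finset.sum_eq_zero fun α _ => ?_
    have hs : ∀ i : Fin n, i ≠ 0 → Function.update (0 : Fin L → Fin n) α i ≠ 0 := by
      intro i hi h0
      apply hi
      have := congrFun h0 α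
      rwa [Function.update_self] at this
    rw [smul_add, fwdKet, bwdKet, groundProj,
      mapL_zeroProj_smul_tensorKet_of_ne _ _ (hs _ (fwdPos_ne_zero (by omega) (by omega))),
      mapL_zeroProj_smul_tensorKet_of_ne _ _ (hs _ (bwdPos_ne_zero (by omega) (by omega))),
      add_zero]

/-- The words of the Brillouin–Wigner expansion up to order `n`: only the walks which lead a single
clock once around its cycle contribute more than a scalar. -/
theorem exists_word_eq (hr : MultiClockRules Γ₀ M) {g : ℝ}
    (hg : g ∈ Set.Icc (-1 / 2 : ℝ) (1 / 2)) (k : ℕ) (hk : k < n) :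
    ∃ c : ℂ, groundProj n Γ₀ * perturbation M * (clockResolvent n Γ₀ g * perturbation M) ^ k *
        groundProj n Γ₀ =
      c • groundProj n Γ₀ + (((if k + 1 = n then ((1 - g)⁻¹) ^ (n - 1) else 0 : ℝ)) : ℂ) •
        TensorProduct.mapL (∑ α, targetHamiltonian Γ₀ M α) (zeroProj (Set.univ : Set (Fin L))) := by
  obtain ⟨c, hc⟩ := groundProj_smul_of_mem_walkSpan hr hk (word_sub_leadingKet_mem hr hg k hk)
  refine ⟨c, ext_tensorKet fun s => ?_⟩
  have hadd : ∀ (a b : ℂ) (T T' : (H ⊗[ℂ] ClockSpace L n) →L[ℂ] (H ⊗[ℂ] ClockSpace L n))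
      (v : H →ₗ[ℂ] H ⊗[ℂ] ClockSpace L n), (a • T + b • T') • v = a • (T • v) + b • (T' • v) :=
    fun _ _ _ _ _ => rfl
  rw [hadd, mul_smul]
  by_cases hs : s = 0
  · subst hs
    have hP : groundProj n Γ₀ • tensorKet (1 : H →L[ℂ] H) (0 : Fin L → Fin n) =
        tensorKet (totalProj Γ₀) 0 := by
      rw [groundProj, mapL_zeroProj_smul_tensorKet, mul_one]
    rw [hP, mapL_zeroProj_smul_tensorKet, mul_one, mul_smul, mul_smul]
    rw [smul_sub, sub_eq_iff_eq_add, operator_smul_smul,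
      groundProj_smul_leadingKet hr (by omega) hk] at hc
    rw [hc]
    congr 1
    by_cases hkn : k + 1 = n
    · have hk' : n - 1 = k := by omega
      rw [if_pos hkn, if_pos hkn, hk']
    · rw [if_neg hkn, if_neg hkn, smul_zero, Complex.ofReal_zero, zero_smul]
  · rw [groundProj, mapL_zeroProj_smul_tensorKet_of_ne _ _ hs,
      mapL_zeroProj_smul_tensorKet_of_ne _ _ hs, smul_zero, smul_zero, smul_zero, add_zero]

end LeadingOrder

/-! ### The ground space and the self-adjointness of the gadget -/

section Shift

variable {K : Type*} [NormedAddCommGroup K] [InnerProductSpace ℂ K]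

lemma IsLowestEigensystem.add_smul_one {A : K →L[ℂ] K} {d : ℕ} {E : Fin d → ℝ} {φ : Fin d → K}
    (h : IsLowestEigensystem A E φ) (c : ℝ) :
    IsLowestEigensystem (A + (c : ℂ) • (1 : K →L[ℂ] K)) (fun i => E i + c) φ := by
  refine ⟨h.orthonormal, fun i => ?_, fun ψ hψ i => ?_⟩
  · change A (φ i) + (c : ℂ) • φ i = _
    rw [h.eigenvector, Complex.ofReal_add, add_smul]
  · rw [reApplyInnerSelf_add, reApplyInnerSelf_smul_one, add_mul]
    exact add_le_add_left (h.lowest ψ hψ i) _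

lemma isLowestEigensystem_add_smul_one_iff {A : K →L[ℂ] K} {d : ℕ} {E : Fin d → ℝ}
    {φ : Fin d → K} (c : ℝ) : IsLowestEigensystem (A + (c : ℂ) • (1 : K →L[ℂ] K)) E φ ↔
      IsLowestEigensystem A (fun i => E i - c) φ := by
  constructor
  · intro h
    have h1 := h.add_smul_one (-c)
    rwa [add_assoc, ← add_smul, ← Complex.ofReal_add, add_neg_cancel, Complex.ofReal_zero,
      zero_smul, add_zero] at h1
  · intro h
    have h1 := h.add_smul_one c
    simpa only [sub_add_cancel] using h1

lemma shiftedEffectiveHamiltonian_add {d : ℕ} (E : Fin d → ℝ) (φ : Fin d → K) (δ c : ℝ) :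
    shiftedEffectiveHamiltonian (fun i => E i + c) φ (δ + c) =
      shiftedEffectiveHamiltonian E φ δ := by
  have h : effectiveHamiltonian (fun i => E i + c) φ =
      effectiveHamiltonian E φ + (c : ℂ) • lowEnergyProjection φ := by
    simp only [effectiveHamiltonian, lowEnergyProjection, Finset.smul_sum,
      ← Finset.sum_add_distrib, Complex.ofReal_add, add_smul]
  rw [shiftedEffectiveHamiltonian, shiftedEffectiveHamiltonian, h, Complex.ofReal_add, add_smul]
  abel

/-- The infimum defining the ground state energy is attained on the range of `P`. -/
lemma groundEnergy_add_smul_one {A₀ P : K →L[ℂ] K} (hP0 : P ≠ 0)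
    (hAP : A₀ * P = 0) (hgap : ∀ x, ‖x - P x‖ ^ 2 ≤ A₀.reApplyInnerSelf x) (c : ℝ) :
    groundEnergy (A₀ + (c : ℂ) • (1 : K →L[ℂ] K)) = c := by
  obtain ⟨p, hp⟩ : ∃ p, P p ≠ 0 := by
    by_contra hcon
    push Not at hcon
    exact hP0 (ContinuousLinearMap.ext hcon)
  have hval : ∀ ψ : {ψ : K // ψ ≠ 0},
      (A₀ + (c : ℂ) • (1 : K →L[ℂ] K)).rayleighQuotient (ψ : K) =
        A₀.reApplyInnerSelf (ψ : K) / ‖(ψ : K)‖ ^ 2 + c := by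
    intro ψ
    have hψ : ‖(ψ : K)‖ ^ 2 ≠ 0 := by simpa using ψ.2
    rw [ContinuousLinearMap.rayleighQuotient, reApplyInnerSelf_add, reApplyInnerSelf_smul_one,
      add_div, mul_div_cancel_right₀ _ hψ]
  have hlow : ∀ ψ : {ψ : K // ψ ≠ 0},
      c ≤ (A₀ + (c : ℂ) • (1 : K →L[ℂ] K)).rayleighQuotient (ψ : K) := by
    intro ψ
    rw [hval, le_add_iff_nonneg_left]
    exact div_nonneg ((sq_nonneg _).trans (hgap _)) (sq_nonneg _)
  have : Nonempty {ψ : K // ψ ≠ 0} := ⟨⟨P p, hp⟩⟩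
  refine le_antisymm ((ciInf_le ⟨c, ?_⟩ ⟨P p, hp⟩).trans_eq ?_) (le_ciInf hlow)
  · rintro _ ⟨ψ, rfl⟩
    exact hlow ψ
  · have h0 : A₀ (P p) = 0 := DFunLike.congr_fun hAP p
    rw [hval, ContinuousLinearMap.reApplyInnerSelf_apply]
    simp [h0]

lemma groundSpace_add_smul_one {A₀ P : K →L[ℂ] K} (hP0 : P ≠ 0)
    (hAP : A₀ * P = 0) (hgap : ∀ x, ‖x - P x‖ ^ 2 ≤ A₀.reApplyInnerSelf x) (c : ℝ) :
    groundSpace (A₀ + (c : ℂ) • (1 : K →L[ℂ] K)) = LinearMap.range (P : K →ₗ[ℂ] K) := by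
  ext x
  rw [groundSpace, groundEnergy_add_smul_one hP0 hAP hgap, Module.End.mem_eigenspace_iff]
  change A₀ x + (c : ℂ) • x = (c : ℂ) • x ↔ _
  rw [add_eq_right]
  constructor
  · intro h
    have h1 := hgap x
    rw [ContinuousLinearMap.reApplyInnerSelf_apply, h, inner_zero_left, map_zero] at h1
    have h2 : x - P x = 0 := by
      rw [← norm_eq_zero, ← sq_eq_zero_iff]
      exact le_antisymm h1 (sq_nonneg _)
    exact ⟨x, (sub_eq_zero.1 h2).symm⟩
  · rintro ⟨y, rfl⟩
    exact DFunLike.congr_fun hAP y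

lemma neg_eq_sub_add_neg_smul (S : K →L[ℂ] K) (c : ℂ) :
    -S = (c • (1 : K →L[ℂ] K) - S) + (-c) • (1 : K →L[ℂ] K) := by
  rw [neg_smul]
  abel

end Shift

section GroundSpace

variable {H : Type*} [NormedAddCommGroup H] [InnerProductSpace ℂ H]
variable {L n : ℕ} [NeZero n] {Γ₀ : Fin L → H →L[ℂ] H}

lemma groundProj_ne_zero (h : totalProj Γ₀ ≠ 0) : groundProj n Γ₀ ≠ 0 := by
  obtain ⟨x, hx⟩ : ∃ x, totalProj Γ₀ x ≠ 0 := by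
    by_contra hcon
    push Not at hcon
    exact h (ContinuousLinearMap.ext hcon)
  intro h0
  have h1 : groundProj n Γ₀ (x ⊗ₜ clockKet (0 : Fin L → Fin n)) = 0 := by rw [h0]; rfl
  rw [groundProj, TensorProduct.mapL_tmul, zeroProj_clockKet (s := 0) fun _ _ => rfl,
    ← norm_eq_zero, TensorProduct.norm_tmul, clockKet, PiLp.norm_single, norm_one, mul_one,
    norm_eq_zero] at h1
  exact hx h1

lemma finiteDimensional_range_groundProj
    (h : FiniteDimensional ℂ (LinearMap.range (totalProj Γ₀ : H →ₗ[ℂ] H))) :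
    FiniteDimensional ℂ (LinearMap.range
      (groundProj n Γ₀ : (H ⊗[ℂ] ClockSpace L n) →ₗ[ℂ] (H ⊗[ℂ] ClockSpace L n))) := by
  have h1 : (groundProj n Γ₀ : (H ⊗[ℂ] ClockSpace L n) →ₗ[ℂ] (H ⊗[ℂ] ClockSpace L n)) =
      TensorProduct.map (totalProj Γ₀ : H →ₗ[ℂ] H)
        ((zeroProj Set.univ : ClockSpace L n →L[ℂ] ClockSpace L n) :
          ClockSpace L n →ₗ[ℂ] ClockSpace L n) := by
    rw [groundProj, TensorProduct.toLinearMap_mapL]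
  rw [h1, TensorProduct.range_map]
  exact Module.Finite.iff_fg.2 (Submodule.FG.map₂ _ (Module.Finite.iff_fg.1 h)
    (Module.Finite.iff_fg.1 inferInstance))

lemma unperturbed_eq_shiftedUnperturbed_add :
    unperturbed (n := n) Γ₀ = shiftedUnperturbed n Γ₀ + (((-L : ℝ)) : ℂ) •
      (1 : (H ⊗[ℂ] ClockSpace L n) →L[ℂ] (H ⊗[ℂ] ClockSpace L n)) := by
  rw [shiftedUnperturbed_eq_sum, Finset.sum_sub_distrib, Finset.sum_const, Finset.card_univ,
    Fintype.card_fin, unperturbed, ← Nat.cast_smul_eq_nsmul ℂ]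
  push_cast
  exact neg_eq_sub_add_neg_smul _ _

end GroundSpace

section SelfAdjoint

lemma star_list_prod {A : Type*} [Monoid A] [StarMul A] (l : List A) :
    star l.prod = (l.map star).reverse.prod := by
  induction l with
  | nil => simp
  | cons a l ih => simp [ih]

variable {H : Type*} [NormedAddCommGroup H] [InnerProductSpace ℂ H] [CompleteSpace H]
variable {L n : ℕ} {Γ₀ : Fin L → H →L[ℂ] H} {M : Fin L → Fin n → H →L[ℂ] H}

lemma isStarProjection_totalProj (hi : ∀ α, Γ₀ α * Γ₀ α = Γ₀ α)
    (ha : ∀ α, (Γ₀ α).adjoint = Γ₀ α) (hc : ∀ α β, Commute (Γ₀ α) (Γ₀ β)) :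
    IsStarProjection (totalProj Γ₀) := by
  refine isStarProjection_list_prod (fun q hq => ?_) fun q hq r hr => ?_
  · obtain ⟨α, rfl⟩ := (List.mem_ofFn' _ _).1 hq
    exact ⟨hi α, ha α⟩
  · obtain ⟨α, rfl⟩ := (List.mem_ofFn' _ _).1 hq
    obtain ⟨β, rfl⟩ := (List.mem_ofFn' _ _).1 hr
    exact hc α β

lemma isSelfAdjoint_targetHamiltonian (hG : IsStarProjection (totalProj Γ₀)) (α : Fin L) :
    IsSelfAdjoint (targetHamiltonian Γ₀ M α) := by
  have hG' := hG.isSelfAdjoint.star_eq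
  have h1 : star (List.ofFn (M α)).prod = (List.ofFn fun i => (M α i).adjoint).reverse.prod := by
    rw [star_list_prod, List.map_ofFn]
    rfl
  rw [IsSelfAdjoint, targetHamiltonian, star_add, ← h1, star_mul, star_mul, star_mul, star_mul,
    star_star, hG', add_comm, mul_assoc, mul_assoc]

lemma totalProj_mul_targetHamiltonian_mul (hG : IsStarProjection (totalProj Γ₀)) (α : Fin L) :
    totalProj Γ₀ * targetHamiltonian Γ₀ M α * totalProj Γ₀ = targetHamiltonian Γ₀ M α := by
  have h := hG.isIdempotentElem.eq
  have h2 : ∀ X : H →L[ℂ] H, totalProj Γ₀ * (totalProj Γ₀ * X * totalProj Γ₀) * totalProj Γ₀ =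
      totalProj Γ₀ * X * totalProj Γ₀ := by
    intro X
    rw [← mul_assoc, ← mul_assoc, h, mul_assoc, h]
  rw [targetHamiltonian, mul_add, add_mul, h2, h2]

variable [NeZero n]

/-- Operators on different clocks commute, so that the order of the factors is restored. -/
lemma adjoint_ketBra_mul_zeroProj {α : Fin L} {S : Set (Fin L)} (h : α ∉ S) (i j : Fin n) :
    (ketBra α i j * zeroProj S : ClockSpace L n →L[ℂ] ClockSpace L n).adjoint =
      ketBra α j i * zeroProj S := by
  rw [← ContinuousLinearMap.star_eq_adjoint, star_mul, ContinuousLinearMap.star_eq_adjoint,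
    ContinuousLinearMap.star_eq_adjoint, adjoint_ketBra, adjoint_zeroProj]
  have key : ∀ s : Fin L → Fin n, zeroProj S (ketBra α j i (clockKet s)) =
      ketBra α j i (zeroProj S (clockKet s)) := by
    intro s
    have hS : ∀ k, (∀ β ∈ S, Function.update s α k β = 0) ↔ ∀ β ∈ S, s β = 0 := by
      intro k
      refine forall₂_congr fun β hβ => ?_
      rw [Function.update_of_ne (by rintro rfl; exact h hβ)]
    by_cases hi : s α = i
    · subst hi
      rw [ketBra_clockKet_self]
      by_cases h0 : ∀ β ∈ S, s β = 0
      · rw [zeroProj_clockKet h0, zeroProj_clockKet ((hS j).2 h0), ketBra_clockKet_self]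
      · rw [zeroProj_clockKet_of_not h0, zeroProj_clockKet_of_not (fun h' => h0 ((hS j).1 h')),
          map_zero]
    · rw [ketBra_clockKet_of_ne hi, map_zero]
      by_cases h0 : ∀ β ∈ S, s β = 0
      · rw [zeroProj_clockKet h0, ketBra_clockKet_of_ne hi]
      · rw [zeroProj_clockKet_of_not h0, map_zero]
  ext1 y
  rw [clockSpace_eq_sum y, map_sum, map_sum]
  refine Finset.sum_congr rfl fun s _ => ?_
  rw [map_smul, map_smul, mul_apply_eq_comp, mul_apply_eq_comp, key]

lemma isSelfAdjoint_sum_adjoint_add {K : Type*} [NormedAddCommGroup K] [InnerProductSpace ℂ K]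
    [CompleteSpace K] {ι κ : Type*} [Fintype ι] [Fintype κ] (T : ι → κ → K →L[ℂ] K) :
    IsSelfAdjoint (∑ i, ∑ j, ((T i j).adjoint + T i j)) := by
  refine isSelfAdjoint_sum _ fun i _ => ?_
  refine isSelfAdjoint_sum _ fun j _ => ?_
  exact IsSelfAdjoint.star_add_self _

lemma isSelfAdjoint_perturbation (M : Fin L → Fin n → H →L[ℂ] H) :
    IsSelfAdjoint (perturbation M) := by
  have h : perturbation M = ∑ α, ∑ i,
      ((TensorProduct.mapL (M α i) (ketBra α i (i + 1) * zeroProj (chi M α i))).adjoint +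
        TensorProduct.mapL (M α i) (ketBra α i (i + 1) * zeroProj (chi M α i))) := by
    refine Finset.sum_congr rfl fun α _ => Finset.sum_congr rfl fun i _ => ?_
    have hα : α ∉ chi M α i := fun h => h.1 rfl
    rw [TensorProduct.adjoint_mapL, adjoint_ketBra_mul_zeroProj hα]
  rw [h]
  exact isSelfAdjoint_sum_adjoint_add _

lemma isStarProjection_clockProj (hi : ∀ α, Γ₀ α * Γ₀ α = Γ₀ α)
    (ha : ∀ α, (Γ₀ α).adjoint = Γ₀ α) (α : Fin L) : IsStarProjection (clockProj n Γ₀ α) := by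
  refine ⟨clockProj_mul_self hi α, ?_⟩
  rw [IsSelfAdjoint, ContinuousLinearMap.star_eq_adjoint, clockProj, TensorProduct.adjoint_mapL,
    ha, adjoint_ketBra]

lemma zeroProj_mul_self (S : Set (Fin L)) :
    (zeroProj S * zeroProj S : ClockSpace L n →L[ℂ] ClockSpace L n) = zeroProj S := by
  ext1 y
  rw [clockSpace_eq_sum y, map_sum, map_sum]
  refine Finset.sum_congr rfl fun s _ => ?_
  rw [map_smul, map_smul, mul_apply_eq_comp]
  by_cases h0 : ∀ β ∈ S, s β = 0
  · rw [zeroProj_clockKet h0, zeroProj_clockKet h0]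
  · rw [zeroProj_clockKet_of_not h0, map_zero]

end SelfAdjoint

end

end ClockGadget

theorem mainTheorem2
    {H : Type*} [NormedAddCommGroup H] [InnerProductSpace ℂ H] [CompleteSpace H]
    (L n : ℕ) [NeZero n]
    (Γ₀ : Fin L → H →L[ℂ] H) (M : Fin L → Fin n → H →L[ℂ] H)
    -- the `Γ₀ α` are commuting orthogonal projections
    (hΓ_idem : ∀ α, Γ₀ α * Γ₀ α = Γ₀ α)
    (hΓ_adj : ∀ α, (Γ₀ α).adjoint = Γ₀ α)
    (hΓ_comm : ∀ α β, Commute (Γ₀ α) (Γ₀ β))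
    -- their product is a nonzero projection of finite rank
    (hΓ_ne : totalProj Γ₀ ≠ 0)
    (hΓ_fin : FiniteDimensional ℂ (LinearMap.range (totalProj Γ₀ : H →ₗ[ℂ] H)))
    -- the rules (i)-(iv) for every single index `α`
    (h_i : ∀ α i, PropTo
      (M α i * M α (i + 1) * (M α (i + 1)).adjoint * (M α i).adjoint)
      ((M α i * (M α i).adjoint) ^ 2))
    (h_ii : ∀ α i, PropTo ((M α i * (M α i).adjoint) ^ 2) (M α i * (M α i).adjoint))
    (h_iii : ∀ α i, PropTo (M α i * (M α i).adjoint) ((M α (i - 1)).adjoint * M α (i - 1)))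
    (h_iv : ∀ α, PropTo (Γ₀ α * M α 0 * (M α 0).adjoint * Γ₀ α) (Γ₀ α))
    -- the commutation relations between different indices
    (hMΓ : ∀ α β, α ≠ β → ∀ i,
      Commute (M α i) (Γ₀ β) ∧ Commute ((M α i).adjoint) (Γ₀ β))
    (hMM : ∀ α β, α ≠ β → ∀ i,
      Commute (M α i) (M β 0 * (M β 0).adjoint) ∧
        Commute ((M α i).adjoint) (M β 0 * (M β 0).adjoint)) :
    ∃ f : ℝ → ℝ, ∃ lam₀ > (0 : ℝ), ∃ C : ℝ, ∀ lam : ℝ, |lam| < lam₀ →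
      (∃ (E : Fin (Module.finrank ℂ (groundSpace (unperturbed (n := n) Γ₀))) → ℝ)
          (φ : Fin (Module.finrank ℂ (groundSpace (unperturbed (n := n) Γ₀))) →
            H ⊗[ℂ] ClockSpace L n),
        IsLowestEigensystem (unperturbed Γ₀ + (lam : ℂ) • perturbation M) E φ) ∧
      ∀ (E : Fin (Module.finrank ℂ (groundSpace (unperturbed (n := n) Γ₀))) → ℝ)
          (φ : Fin (Module.finrank ℂ (groundSpace (unperturbed (n := n) Γ₀))) →
            H ⊗[ℂ] ClockSpace L n),
        IsLowestEigensystem (unperturbed Γ₀ + (lam : ℂ) • perturbation M) E φ →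
        ‖shiftedEffectiveHamiltonian E φ (f lam) -
            ((-1 : ℂ) ^ (n - 1) * (lam : ℂ) ^ n) •
              TensorProduct.mapL (∑ α, targetHamiltonian Γ₀ M α)
                (zeroProj (Set.univ : Set (Fin L)))‖
          ≤ C * |lam| ^ (n + 1) := by 
  have hrules : MultiClockRules Γ₀ M :=
    { rules := fun α => clockRules_of_propTo (hΓ_idem α) (h_ii α) (h_iii α) (h_iv α)
      comm_proj := hΓ_comm
      comm_op_proj := hMΓ
      comm_op_loop := hMM }
  have hΓ := isStarProjection_totalProj hΓ_idem hΓ_adj hΓ_comm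
  have hs : ∀ q ∈ List.ofFn (clockProj n Γ₀), IsStarProjection q := by
    intro q hq
    obtain ⟨α, rfl⟩ := (List.mem_ofFn' _ _).1 hq
    exact isStarProjection_clockProj hΓ_idem hΓ_adj α
  have hi := mul_self_of_mem_ofFn_clockProj (n := n) hΓ_idem
  have hc := commute_of_mem_ofFn_clockProj (n := n) hΓ_comm
  have hP : IsStarProjection (groundProj n Γ₀) := by
    rw [groundProj_eq_prod]
    exact isStarProjection_list_prod hs hc
  have hP0 := groundProj_ne_zero (n := n) hΓ_ne
  have hAP : shiftedUnperturbed n Γ₀ * groundProj n Γ₀ = 0 := by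
    rw [groundProj_eq_prod]
    exact defectNumber_mul_prod hi hc
  have hgap : ∀ x, ‖x - groundProj n Γ₀ x‖ ^ 2 ≤ (shiftedUnperturbed n Γ₀).reApplyInnerSelf x := by
    rw [groundProj_eq_prod]
    exact norm_sub_prod_sq_le hs hc
  have := finiteDimensional_range_groundProj (n := n) hΓ_fin
  have hd : Module.finrank ℂ (LinearMap.range
      (groundProj n Γ₀ : (H ⊗[ℂ] ClockSpace L n) →ₗ[ℂ] (H ⊗[ℂ] ClockSpace L n))) =
      Module.finrank ℂ (groundSpace (unperturbed (n := n) Γ₀)) := by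
    rw [unperturbed_eq_shiftedUnperturbed_add,
      groundSpace_add_smul_one hP0 hAP hgap]
  have hTa : IsSelfAdjoint (TensorProduct.mapL (∑ α, targetHamiltonian Γ₀ M α)
      (zeroProj (n := n) (Set.univ : Set (Fin L)))) := by
    rw [IsSelfAdjoint, ContinuousLinearMap.star_eq_adjoint, TensorProduct.adjoint_mapL,
      adjoint_zeroProj, ← ContinuousLinearMap.star_eq_adjoint,
      (isSelfAdjoint_sum _ fun α _ => isSelfAdjoint_targetHamiltonian hΓ α).star_eq]
  have hT : TensorProduct.mapL (∑ α, targetHamiltonian Γ₀ M α)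
      (zeroProj (n := n) (Set.univ : Set (Fin L))) =
      groundProj n Γ₀ * TensorProduct.mapL (∑ α, targetHamiltonian Γ₀ M α)
        (zeroProj (n := n) (Set.univ : Set (Fin L))) * groundProj n Γ₀ := by
    rw [groundProj, ← TensorProduct.mapL_mul, ← TensorProduct.mapL_mul, zeroProj_mul_self,
      zeroProj_mul_self, Finset.mul_sum, Finset.sum_mul]
    simp only [totalProj_mul_targetHamiltonian_mul hΓ]
  obtain ⟨f, lam₀, hlam₀, C, h⟩ := effectiveHamiltonian_of_words (NeZero.ne n)
    (isSelfAdjoint_defectNumber hs) hP hP0 (isSelfAdjoint_perturbation M) hTa hT hAP hgap hd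
    (R := clockResolvent n Γ₀) (fun g _ => isSelfAdjoint_reducedResolvent hs hc g)
    (continuousOn_reducedResolvent _) (fun g hg => sub_mul_clockResolvent hΓ_idem hΓ_comm hg)
    (fun g hg k hk => exists_word_eq hrules hg k hk)
  -- the energies of `H` and of the shifted Hamiltonian differ by the constant `L`
  have hdown : unperturbed Γ₀ = shiftedUnperturbed n Γ₀ + ((-L : ℝ) : ℂ) • 1 :=
    unperturbed_eq_shiftedUnperturbed_add
  refine ⟨fun lam => f lam + (-L : ℝ), lam₀, hlam₀, C, fun lam hlam => ?_⟩
  obtain ⟨⟨E, φ, hE⟩, hbound⟩ := h lam hlam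
  have hsum : unperturbed Γ₀ + (lam : ℂ) • perturbation M =
      (shiftedUnperturbed n Γ₀ + (lam : ℂ) • perturbation M) + ((-L : ℝ) : ℂ) • 1 := by
    rw [hdown, add_right_comm]
  refine ⟨⟨fun i => E i + (-L : ℝ), φ, ?_⟩, fun E φ hE => ?_⟩
  · rw [hsum]
    exact hE.add_smul_one (-L : ℝ)
  · rw [hsum, isLowestEigensystem_add_smul_one_iff] at hE
    have h2 := hbound _ φ hE
    rw [← shiftedEffectiveHamiltonian_add _ φ (f lam) (-L : ℝ)] at h2
    simpa only [sub_add_cancel] using h2
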